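/- Let $S^1=\mathbb{R}/2\pi\mathbb{Z}$ with its geodesic metric $d$, write $[\theta]$ for the point of angle $\theta$, and let $r\in[0,\pi)$. Let $\mathrm{VR}^m_\leq(S^1;r)$ be the space of finitely supported probability measures $\mu$ on $S^1$ with $\mathrm{diam}(\mathrm{supp}(\mu))\leq r$, with the topology of the 1-Wasserstein distance. For such a $\mu$, a point of $S^1$ is excluded by $\mu$ if it is at distance greater than $r$ from some point of $\mathrm{supp}(\mu)$, and a $\mu$-arc is a maximal closed arc (possibly a single point) that contains a point of $\mathrm{supp}(\mu)$ and no point excluded by $\mu$. For $k\geq 0$ let $V_{2k+1}(r)$ be the set of all $\mu\in\mathrm{VR}^m_\leq(S^1;r)$ with exactly $2k+1$ $\mu$-arcs. For $\mu\in V_{2k+1}(r)$ choose a point $[\theta_0]$ excluded by $\mu$, let $x$ be the coordinate on $S^1\setminus\{[\theta_0]\}$ that sends a point to its representative angle in $(\theta_0,\theta_0+2\pi)$, let $A_0,\dots,A_{2k}$ be the $\mu$-arcs in counterclockwise order starting from $[\theta_0]$, and put $v(p)=i$ for $p\in A_i$. Put $$m=\int_{S^1}\Big(x-\frac{2\pi}{2k+1}v\Big)\,d\mu,\qquad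 F_{2k+1}(p,\mu,t)=\Big[(1-t)\,x(p)+t\Big(\frac{2\pi}{2k+1}v(p)+m\Big)\Big]$$ for $p\in\mathrm{supp}(\mu)$ and $t\in[0,1]$ (this does not depend on the choice of $[\theta_0]$), and $\widetilde F_{2k+1}(\mu,t)=\sum_i a_i\,\delta_{F_{2k+1}(p_i,\mu,t)}$ for $\mu=\sum_i a_i\delta_{p_i}$ with all $a_i>0$. For $\mu_1,\mu_2\in\mathrm{VR}^m_\leq(S^1;r)$ define $\mu_1\sim\mu_2$ if and only if, for some $k\geq 0$, both $\mu_1$ and $\mu_2$ lie in $V_{2k+1}(r)$ and $\widetilde F_{2k+1}(\mu_1,1)=\widetilde F_{2k+1}(\mu_2,1)$. **Theorem.** The relation $\sim$ is an equivalence relation on $\mathrm{VR}^m_\leq(S^1;r)$, and the quotient map $\mathrm{VR}^m_\leq(S^1;r)\to\mathrm{VR}^m_\leq(S^1;r)/\!\sim$ is a homotopy equivalence. -/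

import Mathlib

open Convexity

noncomputable section

namespace VRCircle

/-! ### Finitely supported probability measures and the 1-Wasserstein distance -/

/-- The finitely supported probability measures `∑ aᵢ δ_{xᵢ}` on `X`: finitely supported
nonnegative weight functions on `X` of total mass one. -/
def FinProb (X : Type*) := StdSimplex ℝ X

namespace FinProb

variable {X Y Z : Type*}

/-- The mass `μ({x})`. -/
def mass (μ : FinProb X) (x : X) : ℝ := μ.weights x

/-- The support of `μ`, the finite set of points of positive mass. -/
def supp (μ : FinProb X) : Finset X := μ.weights.support

/-- The integral `∫ f dμ = ∑_{x ∈ supp μ} μ({x}) f(x)`. -/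
def integral (μ : FinProb X) (f : X → ℝ) : ℝ := ∑ x ∈ μ.supp, μ.mass x * f x

/-- The push-forward `∑ aᵢ δ_{g(xᵢ)}` of `μ = ∑ aᵢ δ_{xᵢ}`. -/
def map (g : X → Y) (μ : FinProb X) : FinProb Y := StdSimplex.map g μ

/-- A matching (transport plan) `κ` from `μ` to `ν`: the mass `κ(x, y)` is moved from `x` to `y`,
and the marginals of `κ` are `μ` and `ν`. -/
def IsMatching (κ : FinProb (X × Y)) (μ : FinProb X) (ν : FinProb Y) : Prop :=
  κ.map Prod.fst = μ ∧ κ.map Prod.snd = ν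

/-- The cost `∑ κ(x, y) d(x, y)` of a matching. -/
def cost [PseudoMetricSpace X] (κ : FinProb (X × X)) : ℝ := κ.integral fun p => dist p.1 p.2

/-- The 1-Wasserstein distance, the infimum of the costs of all matchings. -/
def wassersteinDist [PseudoMetricSpace X] (μ ν : FinProb X) : ℝ :=
  sInf {c | ∃ κ : FinProb (X × X), κ.IsMatching μ ν ∧ κ.cost = c}

theorem mass_nonneg (μ : FinProb X) (x : X) : 0 ≤ μ.mass x := μ.nonneg x

theorem mem_supp {μ : FinProb X} {x : X} : x ∈ μ.supp ↔ μ.mass x ≠ 0 := Finsupp.mem_support_iff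

theorem sum_mass (μ : FinProb X) : ∑ x ∈ μ.supp, μ.mass x = 1 := μ.total

theorem integral_eq_sum (μ : FinProb X) (f : X → ℝ) :
    μ.integral f = μ.weights.sum fun x a => a * f x := rfl

theorem ext_mass {μ ν : FinProb X} (h : ∀ x, μ.mass x = ν.mass x) : μ = ν :=
  StdSimplex.ext (Finsupp.ext h)

theorem integral_map (g : X → Y) (μ : FinProb X) (f : Y → ℝ) :
    (μ.map g).integral f = μ.integral fun x => f (g x) := by
  rw [integral_eq_sum, integral_eq_sum]
  exact Finsupp.sum_mapDomain_index (by simp) (by intros; ring)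

theorem integral_mono (μ : FinProb X) {f g : X → ℝ} (h : ∀ x, f x ≤ g x) :
    μ.integral f ≤ μ.integral g :=
  Finset.sum_le_sum fun x _ => mul_le_mul_of_nonneg_left (h x) (μ.mass_nonneg x)

theorem integral_add (μ : FinProb X) (f g : X → ℝ) :
    (μ.integral fun x => f x + g x) = μ.integral f + μ.integral g := by
  simp [integral, mul_add, Finset.sum_add_distrib]

open Classical in
theorem integral_ite (μ : FinProb X) (x : X) :
    (μ.integral fun y => if y = x then 1 else 0) = μ.mass x := by
  simp only [integral, mul_ite, mul_one, mul_zero, Finset.sum_ite_eq']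
  by_cases h : x ∈ μ.supp
  · simp [h]
  · simp only [h, if_false]
    by_contra h0
    exact h (mem_supp.2 (Ne.symm h0))

theorem ext_integral {μ ν : FinProb X} (h : ∀ f : X → ℝ, μ.integral f = ν.integral f) : μ = ν := by
  classical
  refine ext_mass fun x => ?_
  rw [← integral_ite, ← integral_ite, h]

theorem cost_nonneg [PseudoMetricSpace X] (κ : FinProb (X × X)) : 0 ≤ κ.cost :=
  Finset.sum_nonneg fun p _ => mul_nonneg (κ.mass_nonneg p) dist_nonneg

theorem cost_bddBelow [PseudoMetricSpace X] (μ ν : FinProb X) :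
    BddBelow {c | ∃ κ : FinProb (X × X), κ.IsMatching μ ν ∧ κ.cost = c} :=
  ⟨0, by rintro _ ⟨κ, -, rfl⟩; exact κ.cost_nonneg⟩

theorem wassersteinDist_nonneg [PseudoMetricSpace X] (μ ν : FinProb X) :
    0 ≤ wassersteinDist μ ν :=
  Real.sInf_nonneg (by rintro _ ⟨κ, -, rfl⟩; exact κ.cost_nonneg)

open Classical in
/-- Two plans `X → Y` and `Y → Z` with the common marginal `ν` on `Y` can be glued. -/
theorem exists_gluing {ν : FinProb Y} (κ : FinProb (X × Y)) (l : FinProb (Y × Z))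
    (hκ : κ.map Prod.snd = ν) (hl : l.map Prod.fst = ν) :
    ∃ γ : FinProb (X × Y × Z), γ.map (fun t => (t.1, t.2.1)) = κ ∧ γ.map Prod.snd = l := by
  have hκ' : ∀ y, (κ.integral fun p => if p.2 = y then 1 else 0) = ν.mass y := by
    intro y
    rw [← integral_ite, ← hκ, integral_map]
  have hl' : ∀ y, (l.integral fun q => if q.1 = y then 1 else 0) = ν.mass y := by
    intro y
    rw [← integral_ite, ← hl, integral_map]
  have hκs : ∀ p ∈ κ.supp, ν.mass p.2 ≠ 0 := by
    intro p hp h0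
    have h1 : κ.mass p ≤ κ.integral fun p' => if p'.2 = p.2 then 1 else 0 := by
      rw [← integral_ite κ p]
      refine κ.integral_mono fun p' => ?_
      by_cases h : p' = p
      · simp [h]
      · simp only [h, if_false]; split_ifs <;> norm_num
    rw [hκ', h0] at h1
    exact mem_supp.1 hp (le_antisymm h1 (κ.mass_nonneg p))
  have hls : ∀ q ∈ l.supp, ν.mass q.1 ≠ 0 := by
    intro p hp h0
    have h1 : l.mass p ≤ l.integral fun p' => if p'.1 = p.1 then 1 else 0 := by
      rw [← integral_ite l p]
      refine l.integral_mono fun p' => ?_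
      by_cases h : p' = p
      · simp [h]
      · simp only [h, if_false]; split_ifs <;> norm_num
    rw [hl', h0] at h1
    exact mem_supp.1 hp (le_antisymm h1 (l.mass_nonneg p))
  let c : X × Y → Y × Z → ℝ := fun p q =>
    if q.1 = p.2 then κ.mass p * l.mass q / ν.mass p.2 else 0
  let g : (X × Y × Z) →₀ ℝ := ∑ p ∈ κ.supp, ∑ q ∈ l.supp, Finsupp.single (p.1, p.2, q.2) (c p q)
  have hg : ∀ f : X × Y × Z → ℝ, (g.sum fun t a => a * f t) =
      ∑ p ∈ κ.supp, ∑ q ∈ l.supp, c p q * f (p.1, p.2, q.2) := by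
    intro f
    have : ∀ w : (X × Y × Z) →₀ ℝ, (w.sum fun t a => a * f t) = Finsupp.linearCombination ℝ f w := by
      intro w; simp [Finsupp.linearCombination_apply]
    rw [this]
    simp only [g, map_sum, Finsupp.linearCombination_single, smul_eq_mul]
  have hfst : ∀ f : X × Y → ℝ, (g.sum fun t a => a * f (t.1, t.2.1)) = κ.integral f := by
    intro f
    rw [hg]
    refine Finset.sum_congr rfl fun p hp => ?_
    have h2 : ∑ q ∈ l.supp, l.mass q * (if q.1 = p.2 then 1 else 0) = ν.mass p.2 := hl' p.2
    have h3 : ∀ q ∈ l.supp, c p q * f (p.1, p.2) =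
        κ.mass p * f p / ν.mass p.2 * (l.mass q * (if q.1 = p.2 then 1 else 0)) := by
      intro q _
      simp only [c]
      split_ifs
      · ring
      · ring
    rw [Finset.sum_congr rfl h3, ← Finset.mul_sum, h2]
    field_simp [hκs p hp]
  have hsnd : ∀ f : Y × Z → ℝ, (g.sum fun t a => a * f t.2) = l.integral f := by
    intro f
    rw [hg, Finset.sum_comm]
    refine Finset.sum_congr rfl fun q hq => ?_
    have h2 : ∑ p ∈ κ.supp, κ.mass p * (if p.2 = q.1 then 1 else 0) = ν.mass q.1 := hκ' q.1
    have h3 : ∀ p ∈ κ.supp, c p q * f (p.2, q.2) =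
        l.mass q * f q / ν.mass q.1 * (κ.mass p * (if p.2 = q.1 then 1 else 0)) := by
      intro p _
      simp only [c]
      by_cases h : q.1 = p.2
      · rw [if_pos h, if_pos h.symm, ← h]; ring
      · rw [if_neg h, if_neg (Ne.symm h)]; ring
    rw [Finset.sum_congr rfl h3, ← Finset.mul_sum, h2]
    field_simp [hls q hq]
  let γ : FinProb (X × Y × Z) :=
    { weights := g
      nonneg := by
        refine Finset.sum_nonneg fun p _ => Finset.sum_nonneg fun q _ => ?_
        refine Finsupp.single_nonneg.2 ?_
        simp only [c]
        split_ifs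
        · exact div_nonneg (mul_nonneg (κ.mass_nonneg p) (l.mass_nonneg q)) (ν.mass_nonneg _)
        · exact le_rfl
      total := by
        have := hfst fun _ => 1
        simp only [mul_one, integral, sum_mass] at this
        exact this }
  refine ⟨γ, ext_integral fun f => ?_, ext_integral fun f => ?_⟩
  · rw [integral_map]; exact hfst f
  · rw [integral_map]; exact hsnd f

/-- There is always a matching. -/
theorem exists_isMatching (μ : FinProb X) (ν : FinProb Y) :
    ∃ κ : FinProb (X × Y), κ.IsMatching μ ν := by
  have hμ : (μ.map fun x => (x, ())).map Prod.snd = (StdSimplex.single () : FinProb Unit) := by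
    exact (StdSimplex.map_map μ _ _).trans (StdSimplex.map_const μ ())
  have hν : (ν.map fun y => ((), y)).map Prod.fst = (StdSimplex.single () : FinProb Unit) := by
    exact (StdSimplex.map_map ν _ _).trans (StdSimplex.map_const ν ())
  obtain ⟨γ, h, h'⟩ := exists_gluing _ _ hμ hν
  refine ⟨γ.map fun t => (t.1, t.2.2), ext_integral fun f => ?_, ext_integral fun f => ?_⟩
  · have := congrArg (fun w => integral w fun p => f p.1) h
    simpa [integral_map] using this
  · have := congrArg (fun w => integral w fun p => f p.2) h'
    simpa [integral_map] using this

theorem wassersteinDist_le [PseudoMetricSpace X] {μ ν : FinProb X} {κ : FinProb (X × X)}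
    (h : κ.IsMatching μ ν) : wassersteinDist μ ν ≤ κ.cost :=
  csInf_le (cost_bddBelow μ ν) ⟨κ, h, rfl⟩

theorem exists_cost_lt [PseudoMetricSpace X] {μ ν : FinProb X} {c : ℝ}
    (h : wassersteinDist μ ν < c) : ∃ κ : FinProb (X × X), κ.IsMatching μ ν ∧ κ.cost < c := by
  obtain ⟨κ₀, h₀⟩ := exists_isMatching μ ν
  have hne : {c | ∃ κ : FinProb (X × X), κ.IsMatching μ ν ∧ κ.cost = c}.Nonempty :=
    ⟨κ₀.cost, κ₀, h₀, rfl⟩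
  obtain ⟨_, ⟨κ, hκ, rfl⟩, hc⟩ := exists_lt_of_csInf_lt hne h
  exact ⟨κ, hκ, hc⟩

theorem wassersteinDist_self [PseudoMetricSpace X] (μ : FinProb X) : wassersteinDist μ μ = 0 := by
  refine le_antisymm ?_ (wassersteinDist_nonneg μ μ)
  have h : (μ.map fun x => (x, x)).IsMatching μ μ :=
    ⟨ext_integral fun f => by simp [integral_map], ext_integral fun f => by simp [integral_map]⟩
  refine (wassersteinDist_le h).trans_eq ?_
  rw [cost, integral_map]
  simp [integral]

theorem wassersteinDist_comm_le [PseudoMetricSpace X] (μ ν : FinProb X) :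
    wassersteinDist μ ν ≤ wassersteinDist ν μ := by
  refine le_of_forall_gt fun c hc => ?_
  obtain ⟨κ, ⟨h1, h2⟩, hκ⟩ := exists_cost_lt hc
  have h : (κ.map Prod.swap).IsMatching μ ν :=
    ⟨ext_integral fun f => by simp [integral_map, ← h2],
      ext_integral fun f => by simp [integral_map, ← h1]⟩
  refine (wassersteinDist_le h).trans_lt (lt_of_eq_of_lt ?_ hκ)
  simp [cost, integral_map, dist_comm]

theorem wassersteinDist_triangle [PseudoMetricSpace X] (μ ν ρ : FinProb X) :
    wassersteinDist μ ρ ≤ wassersteinDist μ ν + wassersteinDist ν ρ := by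
  refine le_of_forall_pos_le_add fun ε hε => ?_
  obtain ⟨κ, ⟨h1, h2⟩, hκ⟩ := exists_cost_lt (lt_add_of_pos_right (wassersteinDist μ ν) (half_pos hε))
  obtain ⟨l, ⟨h3, h4⟩, hl⟩ := exists_cost_lt (lt_add_of_pos_right (wassersteinDist ν ρ) (half_pos hε))
  obtain ⟨γ, rfl, rfl⟩ := exists_gluing κ l h2 h3
  have h : (γ.map fun t => (t.1, t.2.2)).IsMatching μ ρ :=
    ⟨ext_integral fun f => by simp [integral_map, ← h1],
      ext_integral fun f => by simp [integral_map, ← h4]⟩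
  have hc : (γ.map fun t => (t.1, t.2.2)).cost ≤
      (γ.map fun t => (t.1, t.2.1)).cost + (γ.map Prod.snd).cost := by
    simp only [cost, integral_map, ← integral_add]
    exact γ.integral_mono fun t => dist_triangle _ _ _
  have := wassersteinDist_le h
  linarith

theorem mass_le_of_wassersteinDist_eq_zero [MetricSpace X] {μ ν : FinProb X}
    (h : wassersteinDist μ ν = 0) (x : X) : μ.mass x ≤ ν.mass x := by
  classical
  -- a lower bound for the distance from `x` to the other points of the support of `ν`
  obtain ⟨d, hd, hdist⟩ : ∃ d : ℝ, 0 < d ∧ ∀ y ∈ ν.supp, y ≠ x → d ≤ dist x y := by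
    by_cases hne : (ν.supp.erase x).Nonempty
    · obtain ⟨y₀, hy₀, hmin⟩ := (ν.supp.erase x).exists_min_image (dist x) hne
      exact ⟨dist x y₀, dist_pos.2 (Finset.ne_of_mem_erase hy₀).symm,
        fun y hy hyx => hmin y (Finset.mem_erase.2 ⟨hyx, hy⟩)⟩
    · refine ⟨1, one_pos, fun y hy hyx => ?_⟩
      exact absurd ⟨y, Finset.mem_erase.2 ⟨hyx, hy⟩⟩ hne
  refine le_of_forall_pos_le_add fun ε hε => ?_
  obtain ⟨κ, ⟨h1, h2⟩, hκ⟩ := exists_cost_lt (c := d * ε) (by rw [h]; positivity)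
  have hs : ∀ p ∈ κ.supp, p.2 ∈ ν.supp := by
    intro p hp
    rw [mem_supp, ← h2, ← integral_ite, integral_map]
    have h3 : κ.mass p ≤ κ.integral fun p' => if p'.2 = p.2 then 1 else 0 := by
      rw [← integral_ite κ p]
      refine κ.integral_mono fun p' => ?_
      by_cases h : p' = p
      · simp [h]
      · simp only [h, if_false]; split_ifs <;> norm_num
    exact ne_of_gt (lt_of_lt_of_le (lt_of_le_of_ne (κ.mass_nonneg p) (mem_supp.1 hp).symm) h3)
  have key : d * μ.mass x ≤ d * ν.mass x + κ.cost := by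
    rw [← integral_ite μ, ← integral_ite ν, ← h1, ← h2, integral_map, integral_map]
    simp only [integral, cost, Finset.mul_sum, ← Finset.sum_add_distrib]
    refine Finset.sum_le_sum fun p hp => ?_
    have hm := κ.mass_nonneg p
    by_cases hp1 : p.1 = x
    · by_cases hp2 : p.2 = x
      · simp [hp1, hp2]
      · have := mul_le_mul_of_nonneg_left (hdist p.2 (hs p hp) hp2) hm
        simp only [hp1, hp2, if_true, if_false]
        linarith
    · have : 0 ≤ κ.mass p * dist p.1 p.2 := mul_nonneg hm dist_nonneg
      have h5 : 0 ≤ d * (κ.mass p * if p.2 = x then 1 else 0) := by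
        refine mul_nonneg hd.le (mul_nonneg hm ?_)
        split_ifs <;> norm_num
      simp only [hp1, if_false]
      linarith
  have : d * μ.mass x ≤ d * (ν.mass x + ε) := by linarith
  exact le_of_mul_le_mul_left this hd

/-- The finitely supported probability measures on a metric space, with the 1-Wasserstein
metric. -/
instance [MetricSpace X] : MetricSpace (FinProb X) where
  dist := wassersteinDist
  dist_self := wassersteinDist_self
  dist_comm μ ν := le_antisymm (wassersteinDist_comm_le μ ν) (wassersteinDist_comm_le ν μ)
  dist_triangle := wassersteinDist_triangle
  eq_of_dist_eq_zero := fun {μ ν} h => ext_mass fun x =>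
    le_antisymm (mass_le_of_wassersteinDist_eq_zero h x)
      (mass_le_of_wassersteinDist_eq_zero
        ((le_antisymm (wassersteinDist_comm_le ν μ) (wassersteinDist_comm_le μ ν)).trans h) x)

end FinProb

/-- The Vietoris–Rips metric thickening of `X` with the convention `≤`: the subspace of all
finitely supported probability measures whose support has diameter at most `r`. -/
abbrev VRm (X : Type*) [MetricSpace X] (r : ℝ) :=
  {μ : FinProb X // Metric.diam (μ.supp : Set X) ≤ r}

/-! ### The circle and the arcs of a measure -/

instance : Fact (0 < 2 * Real.pi) := ⟨Real.two_pi_pos⟩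

/-- The circle `ℝ / 2πℤ`; its metric is the geodesic metric (shortest arc length), and `(θ : S1)`
is the point `[θ]` of angle `θ`. -/
abbrev S1 := AddCircle (2 * Real.pi)

/-- The points excluded by `Θ`: those at distance greater than `r` from some point of `Θ`, that is,
those in the open arc of length `2 (π - r)` opposite to some point of `Θ`. -/
def excluded (r : ℝ) (Θ : Set S1) : Set S1 := {p | ∃ q ∈ Θ, r < dist p q}

/-- Closed arcs of the circle, single points included. -/
def IsClosedArc (A : Set S1) : Prop :=
  ∃ a b : ℝ, a ≤ b ∧ A = (fun θ : ℝ => (θ : S1)) '' Set.Icc a b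

/-- The `(Θ; r)`-arcs: the maximal closed arcs which contain a point of `Θ` and contain no point
excluded by `Θ`. -/
def IsArcOf (r : ℝ) (Θ : Set S1) (A : Set S1) : Prop :=
  Maximal (fun B => IsClosedArc B ∧ (B ∩ Θ).Nonempty ∧ Disjoint B (excluded r Θ)) A

/-- `V r k` is the set of the measures in the thickening that have exactly `2k+1` arcs
(the set usually written `V_{2k+1}(r)`). -/
def V (r : ℝ) (k : ℕ) : Set (VRm S1 r) :=
  {μ | {A | IsArcOf r (μ.1.supp : Set S1) A}.encard = 2 * k + 1}

/-! ### The collapse to regular polygons -/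

/-- The coordinate on the circle cut at `[θ₀]`: the representative of `p` in `[θ₀, θ₀ + 2π)`, which
for `p ≠ [θ₀]` lies in the open interval. The periodic left inverse `τ` is then `θ ↦ [θ]`. -/
def coord (θ₀ : ℝ) (p : S1) : ℝ := (AddCircle.equivIco (2 * Real.pi) θ₀ p : ℝ)

/-- The counterclockwise position, starting from the cut `[θ₀]`, of the arc of `μ` that contains
`p`: if the arcs are `A₀, …, A_{2k}` in this order and `p ∈ Aᵢ`, then this is `i`, the number of
arcs that lie before `p`. -/
def arcIndex (r : ℝ) (μ : FinProb S1) (θ₀ : ℝ) (p : S1) : ℕ :=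
  {A | IsArcOf r (μ.supp : Set S1) A ∧ ∀ q ∈ A, coord θ₀ q < coord θ₀ p}.ncard

/-- The average `m = ∫ (x - (2π/(2k+1)) v) dμ` for the coordinate `x` cut at `[θ₀]` and the arc
index `v`. -/
def meanPosition (r : ℝ) (k : ℕ) (μ : FinProb S1) (θ₀ : ℝ) : ℝ :=
  μ.integral fun p => coord θ₀ p - 2 * Real.pi / (2 * k + 1) * arcIndex r μ θ₀ p

/-- The motion `τ((1-t) x(p) + t ((2π/(2k+1)) v(p) + m))` of the support points of `μ`, computed in
the coordinate cut at `[θ₀]`. -/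
def moveIn (r : ℝ) (k : ℕ) (θ₀ : ℝ) (μ : FinProb S1) (p : S1) (t : unitInterval) : S1 :=
  (((1 - (t : ℝ)) * coord θ₀ p +
    t * (2 * Real.pi / (2 * k + 1) * arcIndex r μ θ₀ p + meanPosition r k μ θ₀) : ℝ) : S1)

/-- A cut: an angle of some point excluded by `μ`. Such points exist for `r < π`, since the
antipode of a support point is excluded, and the resulting motion does not depend on the cut. -/
def cut (r : ℝ) (μ : FinProb S1) : ℝ :=
  Classical.epsilon fun θ : ℝ => (θ : S1) ∈ excluded r (μ.supp : Set S1)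

/-- The support homotopy `F_{2k+1}`. -/
def F (r : ℝ) (k : ℕ) (p : S1) (μ : FinProb S1) (t : unitInterval) : S1 :=
  moveIn r k (cut r μ) μ p t

/-- The collapsing homotopy `F̃_{2k+1}`, `∑ aᵢ δ_{pᵢ} ↦ ∑ aᵢ δ_{F_{2k+1}(pᵢ, μ, t)}`. -/
def Ftilde (r : ℝ) (k : ℕ) (μ : FinProb S1) (t : unitInterval) : FinProb S1 :=
  μ.map fun p => F r k p μ t

/-- Two measures are identified if for some `k` both have exactly `2k+1` arcs and both are sent to
the same measure by the collapsing homotopy at time `1`. -/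
def Rel (r : ℝ) (μ₁ μ₂ : VRm S1 r) : Prop :=
  ∃ k : ℕ, μ₁ ∈ V r k ∧ μ₂ ∈ V r k ∧ Ftilde r k μ₁.1 1 = Ftilde r k μ₂.1 1

end VRCircle

end

/-!
The quotient map is a homotopy equivalence as soon as there is a homotopy of the thickening that
starts at the identity, respects the equivalence relation at all times, and ends in a map that is
constant on the classes: its last map induces a homotopy inverse on the quotient
(`exists_homotopyEquiv_quot`). Such a homotopy is built on the union of the strata of order less
than `k`, by induction on `k` (`VRCircle.exists_isCollapse`); as `r < π`, there are only finitely
many strata (`VRCircle.exists_idx_lt`).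

*Arcs as labels.* The arcs of a measure are handled through integer labels `ℓ x` of the lifts `x` of
its support points to the line: `ℓ` is of order `k` if `x < y + π` is equivalent to `ℓ x ≤ ℓ y + k`,
and full if every integer is a label (`VRCircle.IsFullLabelling`). Rounding the angles gives some
labelling of large order, and deleting missing labels makes it full
(`VRCircle.IsLabelling.exists_full`). A full labelling is unique up to a constant
(`VRCircle.IsFullLabelling.unique`), and its classes modulo `2k+1` are the arcs
(`VRCircle.IsFullLabelling.encard_arcs`). This shows that the number of arcs is odd, hence that the
relation is reflexive, and expresses the collapse to regular polygons by labels
(`VRCircle.IsFullLabelling.Ftilde_eq`).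

*One stratum.* On the stratum of order `k` a flow removes the same mass `c` from each arc, rescales,
moves the points over a fraction `s` of their way to a regular polygon, and rotates so that the mean
stays fixed. The labels survive the motion, so that the class of the result depends only on `c` and
on the class of the measure (`VRCircle.rel_flowVR_of_rel`), and for `s = 1` so does the result
itself (`VRCircle.flowVR_one_eq`). Removing the mass of the smallest arc leads into a lower stratum
(`VRCircle.idx_flowVR_lt_idx`).

*Gluing.* The stratum of order `k` is first moved by the flow, with `s` and `c` functions of the
smallest mass of an arc such that measures whose arcs all have mass at least `1/(4(2k+1))` become
polygons, while measures with an arc of mass at most `1/(2(2k+1))` arrive in the lower strata, where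
the collapse already constructed is applied. The two ranges overlap, and over the overlap the second
collapse is faded in (`VRCircle.extendCollapse`).

*Continuity.* Near a measure the number of arcs is at least as large (`VRCircle.eventually_idx_le`).
Where it is larger, the smallest mass of an arc is small (`VRCircle.eventually_minMass_lt`), and
there the flow is close to the identity (`VRCircle.dist_collapseStratum_le`). Within a stratum the
labels are locally constant up to a common constant, and the flow is a push-forward of a reweighted
measure whose density and displacement are continuous along the supports; this is enough for
continuity in the Wasserstein distance (`VRCircle.FinProb.continuousWithinAt_of_push`).
-/

noncomputable section

namespace VRCircle

/-! ### Integrals and push-forwards of finitely supported measures -/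

namespace FinProb

variable {X Y Z I : Type*}

theorem mass_pos {μ : FinProb X} {x : X} (hx : x ∈ μ.supp) : 0 < μ.mass x :=
  lt_of_le_of_ne (μ.mass_nonneg x) (mem_supp.1 hx).symm

theorem supp_nonempty (μ : FinProb X) : μ.supp.Nonempty := by
  by_contra h
  have := μ.sum_mass
  rw [Finset.not_nonempty_iff_eq_empty.1 h, Finset.sum_empty] at this
  exact zero_ne_one this

theorem integral_congr {μ : FinProb X} {f g : X → ℝ} (h : ∀ x ∈ μ.supp, f x = g x) :
    μ.integral f = μ.integral g :=
  Finset.sum_congr rfl fun x hx => by rw [h x hx]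

theorem integral_le_integral {μ : FinProb X} {f g : X → ℝ} (h : ∀ x ∈ μ.supp, f x ≤ g x) :
    μ.integral f ≤ μ.integral g :=
  Finset.sum_le_sum fun x hx => mul_le_mul_of_nonneg_left (h x hx) (μ.mass_nonneg x)

theorem integral_const (μ : FinProb X) (c : ℝ) : (μ.integral fun _ => c) = c := by
  simp only [integral, ← Finset.sum_mul, sum_mass, one_mul]

theorem integral_const_mul (μ : FinProb X) (c : ℝ) (f : X → ℝ) :
    (μ.integral fun x => c * f x) = c * μ.integral f := by
  simp only [integral, Finset.mul_sum]
  exact Finset.sum_congr rfl fun x _ => by ring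

theorem integral_sub (μ : FinProb X) (f g : X → ℝ) :
    (μ.integral fun x => f x - g x) = μ.integral f - μ.integral g := by
  simp only [integral, mul_sub, Finset.sum_sub_distrib]

theorem abs_integral_le (μ : FinProb X) (f : X → ℝ) :
    |μ.integral f| ≤ μ.integral fun x => |f x| := by
  refine (Finset.abs_sum_le_sum_abs _ _).trans (Finset.sum_le_sum fun x _ => ?_)
  rw [abs_mul, abs_of_nonneg (μ.mass_nonneg x)]

theorem integral_nonneg {μ : FinProb X} {f : X → ℝ} (h : ∀ x ∈ μ.supp, 0 ≤ f x) :
    0 ≤ μ.integral f :=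
  Finset.sum_nonneg fun x hx => mul_nonneg (μ.mass_nonneg x) (h x hx)

theorem integral_pos {μ : FinProb X} {f : X → ℝ} (h : ∀ x ∈ μ.supp, 0 ≤ f x) {y : X}
    (hy : y ∈ μ.supp) (hfy : 0 < f y) : 0 < μ.integral f :=
  Finset.sum_pos' (fun x hx => mul_nonneg (μ.mass_nonneg x) (h x hx))
    ⟨y, hy, mul_pos (mass_pos hy) hfy⟩

/-- As all weights are nonnegative, no cancellation occurs, and the support of a push-forward is the
image of the support. -/
theorem mem_supp_map {g : X → Y} {μ : FinProb X} {y : Y} :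
    y ∈ (μ.map g).supp ↔ ∃ x ∈ μ.supp, g x = y := by
  classical
  have key : (μ.map g).mass y = μ.integral fun x => if g x = y then 1 else 0 := by
    rw [← integral_ite, integral_map]
  constructor
  · intro h
    by_contra! hn
    refine mem_supp.1 h ?_
    rw [key, integral_congr (g := fun _ => 0) fun x hx => by simp [hn x hx], integral_const]
  · rintro ⟨x, hx, rfl⟩
    refine mem_supp.2 (ne_of_gt ?_)
    rw [key]
    exact integral_pos (fun z _ => by split_ifs <;> norm_num) hx (by simp)

theorem map_congr {μ : FinProb X} {f g : X → Y} (h : ∀ x ∈ μ.supp, f x = g x) :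
    μ.map f = μ.map g :=
  ext_integral fun F => by
    rw [integral_map, integral_map]
    exact integral_congr fun x hx => by rw [h x hx]

theorem map_map (μ : FinProb X) (f : X → Y) (g : Y → Z) :
    (μ.map f).map g = μ.map fun x => g (f x) :=
  ext_integral fun F => by simp only [integral_map]

theorem map_id_of_eq {μ : FinProb X} {f : X → X} (h : ∀ x ∈ μ.supp, f x = x) : μ.map f = μ :=
  ext_integral fun F => by
    rw [integral_map]
    exact integral_congr fun x hx => by rw [h x hx]

/-- The measure with given point masses. -/
def ofFinsupp (v : X →₀ ℝ) (h0 : 0 ≤ v) (h1 : (v.sum fun _ a => a) = 1) : FinProb X where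
  weights := v
  nonneg := h0
  total := h1

theorem integral_sum_single {s : Finset I} (x : I → X) (c : I → ℝ) (f : X → ℝ) :
    ((∑ i ∈ s, Finsupp.single (x i) (c i)).sum fun y a => a * f y) = ∑ i ∈ s, c i * f (x i) := by
  have : ∀ v : X →₀ ℝ, (v.sum fun y a => a * f y) = Finsupp.linearCombination ℝ f v := by
    intro v; simp [Finsupp.linearCombination_apply]
  rw [this]
  simp only [map_sum, Finsupp.linearCombination_single, smul_eq_mul]

open Classical in
/-- The measure `w μ` with density `w` with respect to `μ`. When `w` is not a probability density,
the value is `μ` itself. -/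
def reweight (μ : FinProb X) (w : X → ℝ) : FinProb X :=
  if h : (∀ x ∈ μ.supp, 0 ≤ w x) ∧ μ.integral w = 1 then
    ofFinsupp (∑ x ∈ μ.supp, Finsupp.single x (μ.mass x * w x))
      (Finset.sum_nonneg fun x hx =>
        Finsupp.single_nonneg.2 (mul_nonneg (μ.mass_nonneg x) (h.1 x hx)))
      (by
        have := integral_sum_single (s := μ.supp) (fun x => x) (fun x => μ.mass x * w x) fun _ => 1
        simp only [mul_one] at this
        exact this.trans h.2)
  else μ

theorem integral_reweight {μ : FinProb X} {w : X → ℝ} (h0 : ∀ x ∈ μ.supp, 0 ≤ w x)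
    (h1 : μ.integral w = 1) (f : X → ℝ) :
    (μ.reweight w).integral f = μ.integral fun x => w x * f x := by
  rw [reweight, dif_pos ⟨h0, h1⟩, integral_eq_sum]
  exact (integral_sum_single _ _ _).trans (Finset.sum_congr rfl fun x _ => mul_assoc _ _ _)

theorem mass_reweight {μ : FinProb X} {w : X → ℝ} (h0 : ∀ x ∈ μ.supp, 0 ≤ w x)
    (h1 : μ.integral w = 1) (x : X) : (μ.reweight w).mass x = μ.mass x * w x := by
  classical
  rw [← integral_ite, integral_reweight h0 h1]
  simp only [integral, mul_ite, mul_one, mul_zero, Finset.sum_ite_eq']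
  by_cases h : x ∈ μ.supp
  · simp [h]
  · have : μ.mass x = 0 := by
      by_contra h'
      exact h (mem_supp.2 h')
    simp [h, this]

theorem supp_reweight_subset (μ : FinProb X) (w : X → ℝ) : (μ.reweight w).supp ⊆ μ.supp := by
  intro x hx
  by_cases h : (∀ x ∈ μ.supp, 0 ≤ w x) ∧ μ.integral w = 1
  · rw [mem_supp, mass_reweight h.1 h.2] at hx
    exact mem_supp.2 fun h0 => hx (by rw [h0, zero_mul])
  · rwa [reweight, dif_neg h] at hx

theorem mem_supp_reweight {μ : FinProb X} {w : X → ℝ} (h0 : ∀ x ∈ μ.supp, 0 ≤ w x)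
    (h1 : μ.integral w = 1) {x : X} : x ∈ (μ.reweight w).supp ↔ x ∈ μ.supp ∧ w x ≠ 0 := by
  rw [mem_supp, mass_reweight h0 h1, mul_ne_zero_iff, mem_supp]

theorem integral_integral_mul (κ : FinProb I) (l : FinProb I) (f g : I → ℝ) :
    (κ.integral fun i => l.integral fun j => f i * g j) = κ.integral f * l.integral g := by
  simp only [integral_const_mul]
  rw [mul_comm, ← integral_const_mul]
  exact integral_congr fun x _ => mul_comm _ _

/-- Stability of weighted push-forwards in the Wasserstein distance. Two measures are presented as
push-forwards, with densities `w` and `w'`, of a common measure `κ` under maps `f` and `g`. The mass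
`min w w'` is transported from `f i` to `g i`, and the remaining mass arbitrarily. -/
theorem dist_le_of_common_push [MetricSpace Z] {D : ℝ} (hD : ∀ x y : Z, dist x y ≤ D)
    (κ : FinProb I) {μ ν : FinProb Z} {w w' : I → ℝ} {f g : I → Z}
    (hw : ∀ i ∈ κ.supp, 0 ≤ w i) (hw' : ∀ i ∈ κ.supp, 0 ≤ w' i)
    (hμ : ∀ h : Z → ℝ, μ.integral h = κ.integral fun i => w i * h (f i))
    (hν : ∀ h : Z → ℝ, ν.integral h = κ.integral fun i => w' i * h (g i)) :
    dist μ ν ≤ κ.integral fun i => w i * dist (f i) (g i) + D * |w i - w' i| := by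
  have hw1 : κ.integral w = 1 := by
    have := hμ fun _ => 1
    simpa [integral_const] using this.symm
  have hw1' : κ.integral w' = 1 := by
    have := hν fun _ => 1
    simpa [integral_const] using this.symm
  let ω : I → ℝ := fun i => min (w i) (w' i)
  let a : I → ℝ := fun i => w i - ω i
  let b : I → ℝ := fun i => w' i - ω i
  have ha : ∀ i, 0 ≤ a i := fun i => sub_nonneg.2 (min_le_left _ _)
  have hb : ∀ i, 0 ≤ b i := fun i => sub_nonneg.2 (min_le_right _ _)
  have hω : ∀ i ∈ κ.supp, 0 ≤ ω i := fun i hi => le_min (hw i hi) (hw' i hi)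
  set e : ℝ := κ.integral a with he
  have heb : κ.integral b = e := by
    simp only [he, a, b, integral_sub, hw1, hw1']
  have he0 : 0 ≤ e := integral_nonneg fun i _ => ha i
  -- multiplying by `e / e` is harmless even when `e = 0`, as then `a` and `b` vanish
  have cancel : ∀ (c : I → ℝ), (∀ i, 0 ≤ c i) → κ.integral c = e → ∀ h : I → ℝ,
      (κ.integral fun i => c i * h i) * e / e = κ.integral fun i => c i * h i := by
    intro c hc hce h
    rcases eq_or_ne e 0 with h0 | h0
    · rw [h0] at hce
      have hz : ∀ i ∈ κ.supp, c i = 0 := by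
        intro i hi
        by_contra hne
        exact (integral_pos (fun j _ => hc j) hi (lt_of_le_of_ne (hc i) (Ne.symm hne))).ne' hce
      have : (κ.integral fun i => c i * h i) = 0 := by
        rw [integral_congr (g := fun _ => 0) fun i hi => by rw [hz i hi, zero_mul], integral_const]
      simp [this]
    · field_simp
  let G : (Z × Z) →₀ ℝ := (∑ i ∈ κ.supp, Finsupp.single (f i, g i) (κ.mass i * ω i)) +
    ∑ i ∈ κ.supp, ∑ j ∈ κ.supp, Finsupp.single (f i, g j) (κ.mass i * (κ.mass j * (a i * b j / e)))
  have hG : ∀ h : Z × Z → ℝ, (G.sum fun t c => c * h t) =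
      (κ.integral fun i => ω i * h (f i, g i)) +
        κ.integral fun i => κ.integral fun j => a i * b j / e * h (f i, g j) := by
    intro h
    have : ∀ v : (Z × Z) →₀ ℝ, (v.sum fun t c => c * h t) = Finsupp.linearCombination ℝ h v := by
      intro v; simp [Finsupp.linearCombination_apply]
    rw [this]
    simp only [G, map_add, map_sum, Finsupp.linearCombination_single, smul_eq_mul, integral,
      Finset.mul_sum, mul_assoc]
  have hfst : ∀ h : Z → ℝ, (G.sum fun t c => c * h t.1) = μ.integral h := by
    intro h
    rw [hG, hμ]
    have h2 : (κ.integral fun i => κ.integral fun j => a i * b j / e * h (f i)) =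
        (κ.integral fun i => a i * h (f i)) * e / e := by
      rw [← heb, ← integral_integral_mul, div_eq_inv_mul, ← integral_const_mul]
      refine integral_congr fun i _ => ?_
      rw [← integral_const_mul]
      exact integral_congr fun j _ => by rw [heb]; ring
    rw [h2, cancel a ha rfl, ← integral_add]
    exact integral_congr fun i _ => by simp only [a]; ring
  have hsnd : ∀ h : Z → ℝ, (G.sum fun t c => c * h t.2) = ν.integral h := by
    intro h
    rw [hG, hν]
    have h2 : (κ.integral fun i => κ.integral fun j => a i * b j / e * h (g j)) =
        (κ.integral fun i => b i * h (g i)) * e / e := by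
      conv_rhs => rw [mul_comm (κ.integral _), he]
      rw [← integral_integral_mul, div_eq_inv_mul, ← integral_const_mul]
      refine integral_congr fun i _ => ?_
      rw [← integral_const_mul]
      exact integral_congr fun j _ => by ring
    rw [h2, cancel b hb heb, ← integral_add]
    exact integral_congr fun i _ => by simp only [b]; ring
  let γ : FinProb (Z × Z) :=
    { weights := G
      nonneg := by
        refine add_nonneg (Finset.sum_nonneg fun i hi => ?_)
          (Finset.sum_nonneg fun i _ => Finset.sum_nonneg fun j _ => ?_)
        · exact Finsupp.single_nonneg.2 (mul_nonneg (κ.mass_nonneg i) (hω i hi))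
        · exact Finsupp.single_nonneg.2 (mul_nonneg (κ.mass_nonneg i) (mul_nonneg (κ.mass_nonneg j)
            (div_nonneg (mul_nonneg (ha i) (hb j)) he0)))
      total := by
        have := hfst fun _ => 1
        simp only [mul_one, integral_const] at this
        exact this }
  have hγ : γ.IsMatching μ ν :=
    ⟨ext_integral fun h => by rw [integral_map]; exact hfst h,
      ext_integral fun h => by rw [integral_map]; exact hsnd h⟩
  refine (wassersteinDist_le hγ).trans ?_
  have hcost : γ.cost = _ := hG fun t => dist t.1 t.2
  have hD0 : ∀ i ∈ κ.supp, 0 ≤ D := fun i _ => dist_nonneg.trans (hD (f i) (f i))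
  have hrest : (κ.integral fun i => κ.integral fun j => a i * b j / e * dist (f i) (g j)) ≤
      κ.integral fun i => D * a i := by
    have : (κ.integral fun i => κ.integral fun j => D * (a i * b j / e)) =
        κ.integral fun i => D * a i := by
      have h3 := cancel a ha rfl fun _ => D
      have h4 : (κ.integral fun i => a i * D) = κ.integral fun i => D * a i :=
        integral_congr fun i _ => mul_comm _ _
      rw [← h4, ← h3, ← heb, ← integral_integral_mul, div_eq_inv_mul, ← integral_const_mul]
      refine integral_congr fun i _ => ?_
      rw [← integral_const_mul]
      exact integral_congr fun j _ => by rw [heb]; ring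
    rw [← this]
    refine integral_le_integral fun i _ => integral_le_integral fun j _ => ?_
    rw [mul_comm D]
    exact mul_le_mul_of_nonneg_left (hD _ _) (div_nonneg (mul_nonneg (ha i) (hb j)) he0)
  rw [hcost]
  refine (add_le_add_right hrest _).trans ?_
  rw [← integral_add]
  refine integral_le_integral fun i hi => ?_
  have h1 : ω i ≤ w i := min_le_left _ _
  have h2 : a i ≤ |w i - w' i| := by
    simp only [a, ω]
    rcases le_total (w i) (w' i) with h | h
    · rw [min_eq_left h, sub_self]; exact abs_nonneg _
    · rw [min_eq_right h]; exact le_abs_self _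
  exact add_le_add (mul_le_mul_of_nonneg_right h1 dist_nonneg)
    (mul_le_mul_of_nonneg_left h2 (hD0 i hi))

/-! ### Continuity of integrals and of weighted push-forwards -/

open Filter Topology

variable {X Y Z : Type*}

theorem IsMatching.fst_mem_supp {κ : FinProb (X × Y)} {μ : FinProb X} {ν : FinProb Y}
    (h : κ.IsMatching μ ν) {p : X × Y} (hp : p ∈ κ.supp) : p.1 ∈ μ.supp := by
  rw [← h.1]
  exact mem_supp_map.2 ⟨p, hp, rfl⟩

theorem IsMatching.snd_mem_supp {κ : FinProb (X × Y)} {μ : FinProb X} {ν : FinProb Y}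
    (h : κ.IsMatching μ ν) {p : X × Y} (hp : p ∈ κ.supp) : p.2 ∈ ν.supp := by
  rw [← h.2]
  exact mem_supp_map.2 ⟨p, hp, rfl⟩

theorem IsMatching.integral_fst {κ : FinProb (X × Y)} {μ : FinProb X} {ν : FinProb Y}
    (h : κ.IsMatching μ ν) (f : X → ℝ) : μ.integral f = κ.integral fun p => f p.1 := by
  rw [← h.1, integral_map]

theorem IsMatching.integral_snd {κ : FinProb (X × Y)} {μ : FinProb X} {ν : FinProb Y}
    (h : κ.IsMatching μ ν) (f : Y → ℝ) : ν.integral f = κ.integral fun p => f p.2 := by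
  rw [← h.2, integral_map]

/-- If `ν` is close to `μ`, then the points of `ν` that are far from `μ` carry little mass. -/
theorem integral_far_lt [MetricSpace X] {μ ν : FinProb X} {δ η : ℝ} (hδ : 0 < δ)
    (h : dist μ ν < δ * η) {f : X → ℝ} (hf1 : ∀ q ∈ ν.supp, f q ≤ 1)
    (hf0 : ∀ q ∈ ν.supp, (∃ p ∈ μ.supp, dist p q < δ) → f q ≤ 0) : ν.integral f < η := by
  obtain ⟨κ, hκ, hc⟩ := exists_cost_lt h
  rw [hκ.integral_snd]
  have : (κ.integral fun p => f p.2) ≤ κ.integral fun p => δ⁻¹ * dist p.1 p.2 := by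
    refine integral_le_integral fun p hp => ?_
    rcases lt_or_ge (dist p.1 p.2) δ with h1 | h1
    · exact (hf0 _ (hκ.snd_mem_supp hp) ⟨_, hκ.fst_mem_supp hp, h1⟩).trans (by positivity)
    · refine (hf1 _ (hκ.snd_mem_supp hp)).trans ?_
      rwa [inv_mul_eq_div, one_le_div hδ]
  refine this.trans_lt ?_
  rw [integral_const_mul, inv_mul_lt_iff₀ hδ]
  exact hc

/-- If `ν` is close to `μ`, then each point of the support of `μ` has a point of the support of `ν`
close to it. -/
theorem exists_near [MetricSpace X] {μ ν : FinProb X} {δ : ℝ} (hδ : 0 < δ) {p : X}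
    (hp : p ∈ μ.supp) (h : dist μ ν < δ * μ.mass p) : ∃ q ∈ ν.supp, dist p q < δ := by
  classical
  by_contra! hn
  rw [dist_comm] at h
  refine lt_irrefl (μ.mass p) ?_
  conv_lhs => rw [← integral_ite]
  refine integral_far_lt hδ h (fun q _ => by split_ifs <;> norm_num) ?_
  rintro q - ⟨p', hp', hd⟩
  split_ifs with hqp
  · subst hqp
    rw [dist_comm] at hd
    exact absurd hd (not_lt.2 (hn p' hp'))
  · exact le_rfl

theorem eventually_exists_near [MetricSpace X] {δ : ℝ} (hδ : 0 < δ) (μ : FinProb X) :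
    ∀ᶠ ν in 𝓝 μ, ∀ p ∈ μ.supp, ∃ q ∈ ν.supp, dist p q < δ := by
  rw [Filter.eventually_all_finset]
  intro p hp
  have : 0 < δ * μ.mass p := mul_pos hδ (mass_pos hp)
  filter_upwards [Metric.ball_mem_nhds μ this] with ν hν
  exact exists_near hδ hp (by rwa [Metric.mem_ball, dist_comm] at hν)

/-- The pairs of a parameter `z ∈ S` and a point of the support of `ν z`. -/
def suppGraph (S : Set Z) (ν : Z → FinProb X) : Set (Z × X) :=
  {zq | zq.1 ∈ S ∧ zq.2 ∈ (ν zq.1).supp}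

/-- A property which holds near each point of the support of `ν z₀` holds uniformly, since the
support is finite. -/
theorem eventually_forall_near [MetricSpace X] [TopologicalSpace Z] {S : Set Z} {z₀ : Z}
    {ν : Z → FinProb X} {P : X → Z → X → Prop}
    (h : ∀ p ∈ (ν z₀).supp, ∀ᶠ zq in 𝓝[suppGraph S ν] (z₀, p), P p zq.1 zq.2) :
    ∃ δ > 0, ∀ᶠ z in 𝓝 z₀, ∀ p ∈ (ν z₀).supp, ∀ q, dist q p < δ → z ∈ S → q ∈ (ν z).supp →
      P p z q := by
  have key : ∀ p ∈ (ν z₀).supp, ∃ δ > 0, ∀ᶠ z in 𝓝 z₀, ∀ q, dist q p < δ → z ∈ S →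
      q ∈ (ν z).supp → P p z q := by
    intro p hp
    have h1 := h p hp
    rw [eventually_nhdsWithin_iff, nhds_prod_eq, Filter.eventually_prod_iff] at h1
    obtain ⟨pa, hpa, pb, hpb, h2⟩ := h1
    obtain ⟨δ, hδ, h3⟩ := Metric.eventually_nhds_iff.1 hpb
    refine ⟨δ, hδ, ?_⟩
    filter_upwards [hpa] with z hz q hq hzS hqs
    exact h2 hz (h3 hq) ⟨hzS, hqs⟩
  choose! δ hδ hkey using key
  obtain ⟨p₀, hp₀, hmin⟩ := (ν z₀).supp.exists_min_image δ (ν z₀).supp_nonempty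
  refine ⟨δ p₀, hδ p₀ hp₀, ?_⟩
  filter_upwards [(Filter.eventually_all_finset _).2 hkey] with z hz p hp q hq
  exact hz p hp q (hq.trans_le (hmin p hp))

/-- If `ν` is continuous at `z₀` and `h` is a bounded function of two points, one in the support of
`ν z₀` and one in that of `ν z`, which is small when they are close, then its integral against a
suitable matching is small. -/
theorem eventually_exists_matching [MetricSpace X] [TopologicalSpace Z] {S : Set Z} {z₀ : Z}
    {ν : Z → FinProb X} (hν : ContinuousWithinAt ν S z₀) {h : X → Z → X → ℝ} {C : ℝ}
    (hC : ∀ p ∈ (ν z₀).supp, ∀ z ∈ S, ∀ q ∈ (ν z).supp, h p z q ≤ C)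
    (hlim : ∀ p ∈ (ν z₀).supp, ∀ ε > 0, ∀ᶠ zq in 𝓝[suppGraph S ν] (z₀, p), h p zq.1 zq.2 < ε)
    {ε : ℝ} (hε : 0 < ε) :
    ∀ᶠ z in 𝓝[S] z₀, ∃ κ : FinProb (X × X), κ.IsMatching (ν z₀) (ν z) ∧
      (κ.integral fun pq => h pq.1 z pq.2) < ε := by
  obtain ⟨d, hd0, hall⟩ := eventually_forall_near (P := fun p z q => h p z q < ε / 2)
    fun p hp => hlim p hp (ε / 2) (half_pos hε)
  set C' := max C 1 with hC'
  have hC'0 : 0 < C' := lt_of_lt_of_le one_pos (le_max_right _ _)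
  have hη : 0 < ε / 2 * d / C' := by positivity
  have hdist : ∀ᶠ z in 𝓝[S] z₀, dist (ν z) (ν z₀) < ε / 2 * d / C' :=
    hν (Metric.ball_mem_nhds _ hη)
  filter_upwards [hdist, eventually_nhdsWithin_of_eventually_nhds hall, self_mem_nhdsWithin]
    with z hz1 hz2 hzS
  rw [dist_comm] at hz1
  obtain ⟨κ, hκ, hc⟩ := exists_cost_lt hz1
  refine ⟨κ, hκ, ?_⟩
  have : (κ.integral fun pq => h pq.1 z pq.2) ≤
      κ.integral fun pq => ε / 2 + C' / d * dist pq.1 pq.2 := by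
    refine integral_le_integral fun pq hpq => ?_
    have h1 := hκ.fst_mem_supp hpq
    have h2 := hκ.snd_mem_supp hpq
    rcases lt_or_ge (dist pq.2 pq.1) d with h3 | h3
    · have := hz2 _ h1 _ h3 hzS h2
      have h5 : 0 ≤ C' / d * dist pq.1 pq.2 := by positivity
      linarith
    · have h4 : d ≤ dist pq.1 pq.2 := by rwa [dist_comm]
      have h5 : C' ≤ C' / d * dist pq.1 pq.2 := by
        rw [div_mul_eq_mul_div, le_div_iff₀ hd0]
        exact mul_le_mul_of_nonneg_left h4 hC'0.le
      have := hC _ h1 z hzS _ h2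
      have := le_max_left C 1
      linarith
  refine this.trans_lt ?_
  rw [integral_add, integral_const, integral_const_mul]
  have h6 : C' / d * κ.cost < ε / 2 := by
    have := mul_lt_mul_of_pos_left hc (div_pos hC'0 hd0)
    refine this.trans_eq ?_
    field_simp
  have h7 : (κ.integral fun pq => dist pq.1 pq.2) = κ.cost := rfl
  rw [h7]
  linarith

/-- The integral of a bounded function that depends continuously on a parameter and on the point of
the support depends continuously on the parameter. -/
theorem continuousWithinAt_integral [MetricSpace X] [TopologicalSpace Z] {S : Set Z} {z₀ : Z}
    (hz₀ : z₀ ∈ S) {ν : Z → FinProb X} (hν : ContinuousWithinAt ν S z₀) {h : Z → X → ℝ} {C : ℝ}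
    (hC : ∀ z ∈ S, ∀ q ∈ (ν z).supp, |h z q| ≤ C)
    (hh : ∀ p ∈ (ν z₀).supp,
      ContinuousWithinAt (fun zq : Z × X => h zq.1 zq.2) (suppGraph S ν) (z₀, p)) :
    ContinuousWithinAt (fun z => (ν z).integral (h z)) S z₀ := by
  rw [ContinuousWithinAt, Metric.tendsto_nhds]
  intro ε hε
  filter_upwards [eventually_exists_matching hν (h := fun p z q => |h z q - h z₀ p|) (C := C + C)
    (fun p hp z hz q hq => (abs_sub _ _).trans (add_le_add (hC z hz q hq) (hC z₀ hz₀ p hp)))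
    (fun p hp ε hε => (Metric.tendsto_nhds.1 (hh p hp) ε hε).mono fun zq hzq => hzq) hε]
    with z ⟨κ, hκ, hlt⟩
  rw [Real.dist_eq, hκ.integral_fst, hκ.integral_snd, ← integral_sub]
  exact (abs_integral_le _ _).trans_lt hlt

/-- Weighted push-forwards with bounded weights depend continuously on the measure and on further
parameters. -/
theorem continuousWithinAt_of_push [MetricSpace X] [MetricSpace Y] [TopologicalSpace Z] {S : Set Z}
    {z₀ : Z} (hz₀ : z₀ ∈ S) {D : ℝ} (hD : ∀ x y : Y, dist x y ≤ D) {ν : Z → FinProb X}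
    (hν : ContinuousWithinAt ν S z₀) {out : Z → FinProb Y} {w : Z → X → ℝ} {f : Z → X → Y} {C : ℝ}
    (hout : ∀ z ∈ S, ∀ F : Y → ℝ, (out z).integral F = (ν z).integral fun p => w z p * F (f z p))
    (hw0 : ∀ z ∈ S, ∀ p ∈ (ν z).supp, 0 ≤ w z p) (hwC : ∀ z ∈ S, ∀ p ∈ (ν z).supp, w z p ≤ C)
    (hw : ∀ p ∈ (ν z₀).supp,
      ContinuousWithinAt (fun zq : Z × X => w zq.1 zq.2) (suppGraph S ν) (z₀, p))
    (hf : ∀ p ∈ (ν z₀).supp,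
      ContinuousWithinAt (fun zq : Z × X => f zq.1 zq.2) (suppGraph S ν) (z₀, p)) :
    ContinuousWithinAt out S z₀ := by
  rw [ContinuousWithinAt, Metric.tendsto_nhds]
  intro ε hε
  have hD0 : ∀ p : X, 0 ≤ D := fun p => dist_nonneg.trans (hD (f z₀ p) (f z₀ p))
  have hlim : ∀ p ∈ (ν z₀).supp, Filter.Tendsto
      (fun zq : Z × X => w z₀ p * dist (f z₀ p) (f zq.1 zq.2) + D * |w z₀ p - w zq.1 zq.2|)
      (𝓝[suppGraph S ν] (z₀, p)) (𝓝 0) := by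
    intro p hp
    have h1 : Filter.Tendsto (fun zq : Z × X => dist (f z₀ p) (f zq.1 zq.2))
        (𝓝[suppGraph S ν] (z₀, p)) (𝓝 (dist (f z₀ p) (f z₀ p))) :=
      tendsto_const_nhds.dist (hf p hp)
    have h2 : Filter.Tendsto (fun zq : Z × X => |w z₀ p - w zq.1 zq.2|)
        (𝓝[suppGraph S ν] (z₀, p)) (𝓝 |w z₀ p - w z₀ p|) :=
      (tendsto_const_nhds.sub (hw p hp)).abs
    have := (h1.const_mul (w z₀ p)).add (h2.const_mul D)
    simpa using this
  have hwabs : ∀ z ∈ S, ∀ p ∈ (ν z).supp, |w z p| ≤ C := fun z hz p hp => by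
    rw [abs_of_nonneg (hw0 z hz p hp)]; exact hwC z hz p hp
  filter_upwards [self_mem_nhdsWithin, eventually_exists_matching hν
    (h := fun p z q => w z₀ p * dist (f z₀ p) (f z q) + D * |w z₀ p - w z q|)
    (C := C * D + D * (C + C))
    (fun p hp z hz q hq => add_le_add
      (mul_le_mul (hwC z₀ hz₀ p hp) (hD _ _) dist_nonneg
        ((hw0 z₀ hz₀ p hp).trans (hwC z₀ hz₀ p hp)))
      (mul_le_mul_of_nonneg_left ((abs_sub _ _).trans
        (add_le_add (hwabs z₀ hz₀ p hp) (hwabs z hz q hq))) (hD0 p)))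
    (fun p hp ε hε => (hlim p hp).eventually_lt_const hε) hε] with z hz ⟨κ, hκ, hlt⟩
  rw [dist_comm]
  refine (dist_le_of_common_push hD κ (fun i hi => hw0 z₀ hz₀ _ (hκ.fst_mem_supp hi))
    (fun i hi => hw0 z hz _ (hκ.snd_mem_supp hi)) (fun F => ?_) fun F => ?_).trans_lt hlt
  · rw [hout z₀ hz₀, hκ.integral_fst]
  · rw [hout z hz, hκ.integral_snd]

end FinProb

/-! ### Lifting points of the circle to the line -/

theorem dist_coe_le (x y : ℝ) : dist (x : S1) (y : S1) ≤ |x - y| := by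
  rw [dist_eq_norm, ← AddCircle.coe_sub]
  exact QuotientAddGroup.norm_mk_le_norm

theorem dist_le_pi (p q : S1) : dist p q ≤ Real.pi := by
  rw [dist_eq_norm]
  refine (AddCircle.norm_le_half_period _ Real.two_pi_pos.ne').trans_eq ?_
  rw [abs_of_pos Real.two_pi_pos]
  ring

theorem coe_add_int_mul (x : ℝ) (j : ℤ) : ((x + j * (2 * Real.pi) : ℝ) : S1) = x := by
  rw [← zsmul_eq_mul, AddCircle.coe_add, AddCircle.coe_zsmul, AddCircle.coe_period, smul_zero,
    add_zero]

theorem exists_abs_eq_dist (x y : ℝ) :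
    ∃ j : ℤ, |x + j * (2 * Real.pi) - y| = dist (x : S1) (y : S1) := by
  refine ⟨-round ((2 * Real.pi)⁻¹ * (x - y)), ?_⟩
  rw [dist_eq_norm, ← AddCircle.coe_sub, AddCircle.norm_eq]
  push_cast
  ring_nf

theorem exists_lift_abs_eq_dist (p : S1) (y : ℝ) :
    ∃ x : ℝ, (x : S1) = p ∧ |x - y| = dist p (y : S1) := by
  obtain ⟨x, rfl⟩ := QuotientAddGroup.mk_surjective p
  obtain ⟨j, hj⟩ := exists_abs_eq_dist x y
  exact ⟨_, coe_add_int_mul x j, hj⟩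

theorem coe_eq_coe_iff {x y : ℝ} : (x : S1) = y ↔ ∃ j : ℤ, x + j * (2 * Real.pi) = y := by
  constructor
  · intro h
    obtain ⟨j, hj⟩ := exists_abs_eq_dist x y
    rw [h, dist_self, abs_eq_zero, sub_eq_zero] at hj
    exact ⟨j, hj⟩
  · rintro ⟨j, rfl⟩
    exact (coe_add_int_mul x j).symm

/-- In a set of diameter at most `r`, no point is at distance less than `π - r` from the antipode of
another. -/
theorem pi_sub_le_abs {r : ℝ} {x y : ℝ} (h : dist (x : S1) (y : S1) ≤ r) :
    Real.pi - r ≤ |x - y - Real.pi| := by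
  obtain ⟨j, hj⟩ := exists_abs_eq_dist x y
  rw [← hj] at h
  by_contra! hlt
  rw [abs_lt] at hlt
  rw [abs_le] at h
  rcases le_or_gt 0 j with h0 | h0
  · have : (0 : ℝ) ≤ j := by exact_mod_cast h0
    nlinarith [Real.pi_pos]
  · have : (j : ℝ) ≤ -1 := by exact_mod_cast Int.le_sub_one_of_lt h0
    nlinarith [Real.pi_pos]

/-! ### Labellings -/

/-- A labelling of `Θ` of order `k`: integer labels on the angles of the points of `Θ`, increasing
by `2k+1` over a full turn, and such that the antipode `y + π` of a point lies beyond `x` exactly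
when `y + π`, which has the half-integral label `ℓ y + k + 1/2`, has the larger label. Only the
values of `ℓ` on the angles of the points of `Θ` matter. -/
structure IsLabelling (Θ : Set S1) (k : ℕ) (ℓ : ℝ → ℤ) : Prop where
  add_period : ∀ x : ℝ, (x : S1) ∈ Θ → ℓ (x + 2 * Real.pi) = ℓ x + (2 * k + 1)
  lt_iff : ∀ x y : ℝ, (x : S1) ∈ Θ → (y : S1) ∈ Θ → (x < y + Real.pi ↔ ℓ x ≤ ℓ y + k)

/-- A full labelling: every integer occurs as a label. The classes of labels modulo `2k+1` are then
the arcs of `Θ`. -/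
structure IsFullLabelling (Θ : Set S1) (k : ℕ) (ℓ : ℝ → ℤ) : Prop extends IsLabelling Θ k ℓ where
  surj : ∀ i : ℤ, ∃ x : ℝ, (x : S1) ∈ Θ ∧ ℓ x = i

namespace IsLabelling

variable {Θ Θ' : Set S1} {k : ℕ} {ℓ : ℝ → ℤ}

theorem mono (h : IsLabelling Θ k ℓ) (hs : Θ' ⊆ Θ) : IsLabelling Θ' k ℓ :=
  ⟨fun x hx => h.add_period x (hs hx), fun x y hx hy => h.lt_iff x y (hs hx) (hs hy)⟩

theorem add_int_mul (h : IsLabelling Θ k ℓ) {x : ℝ} (hx : (x : S1) ∈ Θ) (j : ℤ) :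
    ℓ (x + j * (2 * Real.pi)) = ℓ x + j * (2 * k + 1) := by
  induction j using Int.induction_on with
  | zero => simp
  | succ j ih =>
    have h1 := h.add_period (x + (j : ℤ) * (2 * Real.pi)) (by rwa [coe_add_int_mul])
    have h2 : x + ((j : ℤ) + 1 : ℤ) * (2 * Real.pi) =
        x + (j : ℤ) * (2 * Real.pi) + 2 * Real.pi := by push_cast; ring
    rw [h2, h1, ih]
    ring
  | pred j ih =>
    have h1 := h.add_period (x + (-(j : ℤ) - 1 : ℤ) * (2 * Real.pi)) (by rwa [coe_add_int_mul])
    have h2 : x + (-(j : ℤ) - 1 : ℤ) * (2 * Real.pi) + 2 * Real.pi =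
        x + (-(j : ℤ) : ℤ) * (2 * Real.pi) := by push_cast; ring
    rw [h2, ih] at h1
    linarith

theorem lt_add_pi (h : IsLabelling Θ k ℓ) {x y : ℝ} (hx : (x : S1) ∈ Θ) (hy : (y : S1) ∈ Θ)
    (hl : ℓ x ≤ ℓ y + k) : x < y + Real.pi :=
  (h.lt_iff x y hx hy).2 hl

/-- The strict converse of `lt_add_pi`: no point of `Θ` is the antipode of another, as the labels of
antipodes would be half-integral. -/
theorem add_pi_lt (h : IsLabelling Θ k ℓ) {x y : ℝ} (hx : (x : S1) ∈ Θ) (hy : (y : S1) ∈ Θ)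
    (hl : ℓ y + k < ℓ x) : y + Real.pi < x := by
  have h1 : ¬ x < y + Real.pi := fun hlt => absurd ((h.lt_iff x y hx hy).1 hlt) (not_le.2 hl)
  refine lt_of_le_of_ne (not_lt.1 h1) fun he => ?_
  have h2 : ¬ y + 2 * Real.pi < x + Real.pi := by rw [← he]; linarith
  rw [h.lt_iff _ _ (by rwa [AddCircle.coe_add_period]) hx, h.add_period y hy] at h2
  omega

theorem lt_of_between (h : IsLabelling Θ k ℓ) {x y z : ℝ} (hx : (x : S1) ∈ Θ) (hy : (y : S1) ∈ Θ)
    (hz : (z : S1) ∈ Θ) (h1 : x < z + Real.pi) (h2 : z + Real.pi < y) : ℓ x < ℓ y := by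
  have h3 := (h.lt_iff x z hx hz).1 h1
  have h4 : ¬ ℓ y ≤ ℓ z + k := fun hle => absurd ((h.lt_iff y z hy hz).2 hle) (not_lt.2 h2.le)
  omega

/-- A set of diameter less than `π` has a labelling, in general not full: for large `k` the rounded
values of `(2k+1)x/2π` are fine enough to separate points from antipodes. -/
theorem exists_of_dist_le {r : ℝ} (hr : r < Real.pi)
    (hΘ : ∀ p ∈ Θ, ∀ q ∈ Θ, dist p q ≤ r) : ∃ k ℓ, IsLabelling Θ k ℓ := by
  obtain ⟨k, hk⟩ := exists_nat_gt (2 * Real.pi / (Real.pi - r))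
  have hpr : 0 < Real.pi - r := sub_pos.2 hr
  have hk' : 2 * Real.pi < k * (Real.pi - r) := by rwa [div_lt_iff₀ hpr] at hk
  set c : ℝ := (2 * k + 1) / (2 * Real.pi) with hc
  have hc0 : 0 < c := by have := Real.pi_pos; positivity
  have hcpi : c * (2 * Real.pi) = 2 * k + 1 := by
    rw [hc]; field_simp
  have hcr : 1 < c * (Real.pi - r) := by
    have := Real.pi_pos
    rw [hc, div_mul_eq_mul_div, one_lt_div (by positivity)]
    nlinarith
  refine ⟨k, fun x => round (c * x), fun x _ => ?_, fun x y hx hy => ?_⟩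
  · have : c * (x + 2 * Real.pi) = c * x + ((2 * k + 1 : ℤ) : ℝ) := by
      push_cast; linarith
    show round (c * (x + 2 * Real.pi)) = _
    rw [this, round_add_intCast]
  · have hgap := pi_sub_le_abs (hΘ _ hx _ hy)
    have hrx := abs_le.1 (abs_sub_round (c * x))
    have hry := abs_le.1 (abs_sub_round (c * y))
    constructor
    · intro hlt
      rw [abs_of_neg (by linarith)] at hgap
      have h1 : c * (Real.pi - r) ≤ c * (-(x - y - Real.pi)) :=
        mul_le_mul_of_nonneg_left hgap hc0.le
      have h2 : ((round (c * x) : ℤ) : ℝ) < ((round (c * y) + k + 1 : ℤ) : ℝ) := by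
        push_cast; nlinarith
      have : round (c * x) < round (c * y) + k + 1 := by exact_mod_cast h2
      omega
    · intro hle
      by_contra hge
      rw [abs_of_nonneg (by linarith)] at hgap
      have h1 : c * (Real.pi - r) ≤ c * (x - y - Real.pi) :=
        mul_le_mul_of_nonneg_left hgap hc0.le
      have h2 : ((round (c * x) : ℤ) : ℝ) ≤ ((round (c * y) + k : ℤ) : ℝ) := by exact_mod_cast hle
      push_cast at h2
      nlinarith

/-- The arithmetic behind `IsLabelling.exists_pred`: deleting the label `0` modulo `2k+3` and
merging the labels `k+1` and `k+2` opposite to it. -/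
theorem collapse_le_iff {k a b A B a₀ b₀ a₁ b₁ : ℤ} (hk : 0 ≤ k)
    (ha : a = A * (2 * k + 3) + a₀) (hb : b = B * (2 * k + 3) + b₀)
    (ha0 : 0 < a₀) (ha1 : a₀ < 2 * k + 3) (hb0 : 0 < b₀) (hb1 : b₀ < 2 * k + 3)
    (ha2 : a₀ ≤ k + 1 ∧ a₁ = a₀ ∨ k + 2 ≤ a₀ ∧ a₁ = a₀ - 1)
    (hb2 : b₀ ≤ k + 1 ∧ b₁ = b₀ ∨ k + 2 ≤ b₀ ∧ b₁ = b₀ - 1) :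
    a ≤ b + (k + 1) ↔ A * (2 * k + 1) + a₁ ≤ B * (2 * k + 1) + b₁ + k := by
  subst ha hb
  have ha3 : 1 ≤ a₁ ∧ a₁ ≤ 2 * k + 1 := by omega
  have hb3 : 1 ≤ b₁ ∧ b₁ ≤ 2 * k + 1 := by omega
  rcases lt_trichotomy A B with h | rfl | h
  · obtain ⟨d, rfl⟩ := Int.le.dest (Int.add_one_le_iff.2 h)
    have h1 : (0 : ℤ) ≤ d * k := by positivity
    constructor
    · intro; nlinarith
    · intro; nlinarith
  · constructor
    · intro; omega
    · intro; omega
  · rcases eq_or_lt_of_le (Int.add_one_le_iff.2 h) with rfl | h'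
    · have e1 : (B + 1) * (2 * k + 3) = B * (2 * k + 3) + (2 * k + 3) := by ring
      have e2 : (B + 1) * (2 * k + 1) = B * (2 * k + 1) + (2 * k + 1) := by ring
      rw [e1, e2]
      constructor
      · intro; omega
      · intro; omega
    · obtain ⟨d, rfl⟩ := Int.le.dest (Int.add_one_le_iff.2 h')
      have h1 : (0 : ℤ) ≤ d * k := by positivity
      constructor
      · intro; exfalso; nlinarith
      · intro; exfalso; nlinarith

/-- If a label is missing, it can be deleted, together with the separation between the two labels
opposite to it. -/
theorem exists_pred (h : IsLabelling Θ k ℓ) (hΘ : Θ.Nonempty) {i : ℤ}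
    (hi : ∀ x : ℝ, (x : S1) ∈ Θ → ℓ x ≠ i) : ∃ k', k = k' + 1 ∧ ∃ ℓ', IsLabelling Θ k' ℓ' := by
  have hmod : ∀ x : ℝ, (x : S1) ∈ Θ → (ℓ x - i) % (2 * k + 1) ≠ 0 := by
    intro x hx h0
    obtain ⟨j, hj⟩ := Int.dvd_of_emod_eq_zero h0
    refine hi (x + (-j : ℤ) * (2 * Real.pi)) (by rwa [coe_add_int_mul]) ?_
    rw [h.add_int_mul hx]
    linarith
  rcases k with _ | k'
  · obtain ⟨p, hp⟩ := hΘ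
    obtain ⟨x, rfl⟩ := QuotientAddGroup.mk_surjective p
    exact absurd (by simp) (hmod x hp)
  refine ⟨k', rfl, ?_⟩
  set n : ℤ := 2 * k' + 3 with hn
  have hn' : (2 * ((k' + 1 : ℕ) : ℤ) + 1) = n := by push_cast; omega
  rw [hn'] at hmod
  have hn0 : 0 < n := by omega
  let q : ℝ → ℤ := fun x => (ℓ x - i) / n
  let s : ℝ → ℤ := fun x => (ℓ x - i) % n
  let s' : ℝ → ℤ := fun x => if s x ≤ k' + 1 then s x else s x - 1
  have hqs : ∀ x, ℓ x - i = q x * n + s x := fun x => by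
    have := Int.mul_ediv_add_emod (ℓ x - i) n
    simp only [q, s]; linarith
  refine ⟨fun x => q x * (2 * k' + 1) + s' x, fun x hx => ?_, fun x y hx hy => ?_⟩
  · have h1 : ℓ (x + 2 * Real.pi) - i = ℓ x - i + n := by
      rw [h.add_period x hx, hn']; ring
    have h2 : q (x + 2 * Real.pi) = q x + 1 := by
      simp only [q]; rw [h1, Int.add_ediv_of_dvd_right (dvd_refl n), Int.ediv_self hn0.ne']
    have h3 : s (x + 2 * Real.pi) = s x := by
      simp only [s]; rw [h1, Int.add_emod_right]
    simp only [s', h2, h3]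
    ring
  · have h1 := h.lt_iff x y hx hy
    have hpos : ∀ z : ℝ, (z : S1) ∈ Θ → 0 < s z ∧ s z < n := fun z hz =>
      ⟨lt_of_le_of_ne (Int.emod_nonneg _ hn0.ne') (hmod z hz).symm, Int.emod_lt_of_pos _ hn0⟩
    have hs' : ∀ z, s z ≤ k' + 1 ∧ s' z = s z ∨ (k' : ℤ) + 2 ≤ s z ∧ s' z = s z - 1 := by
      intro z
      simp only [s']
      split_ifs <;> omega
    have h2 := collapse_le_iff (k := k') (by positivity) (hqs x) (hqs y) (hpos x hx).1 (hpos x hx).2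
      (hpos y hy).1 (hpos y hy).2 (hs' x) (hs' y)
    rw [h1, ← h2]
    push_cast
    constructor <;> intro <;> linarith

/-- Deleting missing labels leads to a full labelling. -/
theorem exists_full (h : IsLabelling Θ k ℓ) (hΘ : Θ.Nonempty) :
    ∃ k' ≤ k, ∃ ℓ', IsFullLabelling Θ k' ℓ' := by
  induction k generalizing ℓ with
  | zero =>
    by_cases hs : ∀ i : ℤ, ∃ x : ℝ, (x : S1) ∈ Θ ∧ ℓ x = i
    · exact ⟨0, le_rfl, ℓ, h, hs⟩
    · push Not at hs
      obtain ⟨i, hi⟩ := hs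
      obtain ⟨k', hk', -⟩ := h.exists_pred hΘ hi
      omega
  | succ k ih =>
    by_cases hs : ∀ i : ℤ, ∃ x : ℝ, (x : S1) ∈ Θ ∧ ℓ x = i
    · exact ⟨k + 1, le_rfl, ℓ, h, hs⟩
    · push Not at hs
      obtain ⟨i, hi⟩ := hs
      obtain ⟨k', hk', ℓ', h'⟩ := h.exists_pred hΘ hi
      obtain rfl : k = k' := by omega
      obtain ⟨k'', hle, hh⟩ := ih h'
      exact ⟨k'', by omega, hh⟩

theorem exists_full_lt (h : IsLabelling Θ k ℓ) (hΘ : Θ.Nonempty) {i : ℤ}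
    (hi : ∀ x : ℝ, (x : S1) ∈ Θ → ℓ x ≠ i) : ∃ k' < k, ∃ ℓ', IsFullLabelling Θ k' ℓ' := by
  obtain ⟨k', rfl, ℓ', h'⟩ := h.exists_pred hΘ hi
  obtain ⟨k'', hle, hh⟩ := h'.exists_full hΘ
  exact ⟨k'', by omega, hh⟩

end IsLabelling

namespace IsFullLabelling

variable {Θ Θ' : Set S1} {k k' : ℕ} {ℓ ℓ' : ℝ → ℤ}

theorem nonempty (h : IsFullLabelling Θ k ℓ) : Θ.Nonempty :=
  let ⟨_, hx, _⟩ := h.surj 0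
  ⟨_, hx⟩

/-- For a full labelling, two labels differ exactly when an antipode lies between the points. -/
theorem lt_iff_between (h : IsFullLabelling Θ k ℓ) {x y : ℝ} (hx : (x : S1) ∈ Θ)
    (hy : (y : S1) ∈ Θ) :
    ℓ x < ℓ y ↔ ∃ z : ℝ, (z : S1) ∈ Θ ∧ x < z + Real.pi ∧ z + Real.pi < y := by
  constructor
  · intro hlt
    obtain ⟨z, hz, hlz⟩ := h.surj (ℓ x - k)
    exact ⟨z, hz, h.lt_add_pi hx hz (by omega), h.add_pi_lt hy hz (by omega)⟩
  · rintro ⟨z, hz, h1, h2⟩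
    exact h.lt_of_between hx hy hz h1 h2

theorem lt_of_label_lt (h : IsFullLabelling Θ k ℓ) {x y : ℝ} (hx : (x : S1) ∈ Θ)
    (hy : (y : S1) ∈ Θ) (hlt : ℓ x < ℓ y) : x < y := by
  obtain ⟨z, -, h1, h2⟩ := (h.lt_iff_between hx hy).1 hlt
  exact h1.trans h2

/-- The order `k` of a full labelling is determined by the set, and so are the labels up to a
constant: by `lt_iff_between` two full labellings differ by an order automorphism of `ℤ`. -/
theorem unique (h : IsFullLabelling Θ k ℓ) (h' : IsFullLabelling Θ k' ℓ') :
    k' = k ∧ ∃ c : ℤ, ∀ x : ℝ, (x : S1) ∈ Θ → ℓ' x = ℓ x + c := by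
  choose g hg hlg using h.surj
  have hlt : ∀ x y : ℝ, (x : S1) ∈ Θ → (y : S1) ∈ Θ → (ℓ x < ℓ y ↔ ℓ' x < ℓ' y) :=
    fun x y hx hy => (h.lt_iff_between hx hy).trans (h'.lt_iff_between hx hy).symm
  have hmono : StrictMono fun i => ℓ' (g i) := fun i j hij => by
    rw [← hlt _ _ (hg i) (hg j), hlg, hlg]
    exact hij
  have hfac : ∀ x : ℝ, (x : S1) ∈ Θ → ℓ' x = ℓ' (g (ℓ x)) := fun x hx => by
    have h1 := hlt x (g (ℓ x)) hx (hg _)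
    have h2 := hlt (g (ℓ x)) x (hg _) hx
    rw [hlg] at h1 h2
    have h3 := not_congr h1
    have h4 := not_congr h2
    simp only [lt_irrefl, not_false_iff, true_iff, not_lt] at h3 h4
    exact le_antisymm h4 h3
  have hsurj : Function.Surjective fun i => ℓ' (g i) := fun i => by
    obtain ⟨x, hx, rfl⟩ := h'.surj i
    exact ⟨ℓ x, (hfac x hx).symm⟩
  let e := hmono.orderIsoOfSurjective _ hsurj
  have hsucc : ∀ i, ℓ' (g (i + 1)) = ℓ' (g i) + 1 := fun i => e.map_succ i
  have htr : ∀ i, ℓ' (g i) = i + ℓ' (g 0) := by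
    intro i
    induction i using Int.induction_on with
    | zero => simp
    | succ i ih => rw [hsucc, ih]; ring
    | pred i ih =>
      have := hsucc (-(i : ℤ) - 1)
      rw [sub_add_cancel, ih] at this
      linarith
  have hc : ∀ x : ℝ, (x : S1) ∈ Θ → ℓ' x = ℓ x + ℓ' (g 0) := fun x hx => by
    rw [hfac x hx, htr]
  refine ⟨?_, ℓ' (g 0), hc⟩
  have h1 := h'.add_period (g 0) (hg 0)
  rw [hc _ (by rw [AddCircle.coe_add_period]; exact hg 0), h.add_period _ (hg 0), hlg] at h1
  omega

end IsFullLabelling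

namespace IsLabelling

variable {Θ : Set S1} {k : ℕ} {ℓ : ℝ → ℤ} {r : ℝ}

/-- As `[x]` and `[y]` are at distance at most `r` from each other, the bound `x < y + π` improves
itself. -/
theorem le_add (h : IsLabelling Θ k ℓ) (hΘ : ∀ p ∈ Θ, ∀ q ∈ Θ, dist p q ≤ r) {x y : ℝ}
    (hx : (x : S1) ∈ Θ) (hy : (y : S1) ∈ Θ) (hl : ℓ x ≤ ℓ y + k) : x ≤ y + r := by
  have h1 := h.lt_add_pi hx hy hl
  have h2 := pi_sub_le_abs (hΘ _ hx _ hy)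
  rw [abs_of_neg (by linarith)] at h2
  linarith

/-- Labels of angles at most half a turn apart differ by at most `k`. -/
theorem abs_label_sub_le (h : IsLabelling Θ k ℓ) {x y : ℝ} (hx : (x : S1) ∈ Θ) (hy : (y : S1) ∈ Θ)
    (hxy : |x - y| ≤ Real.pi) : |(ℓ x : ℝ) - ℓ y| ≤ k := by
  have h1 : ℓ x ≤ ℓ y + k := by
    by_contra hlt
    linarith [h.add_pi_lt hx hy (not_le.1 hlt), (abs_le.1 hxy).2]
  have h2 : ℓ y ≤ ℓ x + k := by
    by_contra hlt
    linarith [h.add_pi_lt hy hx (not_le.1 hlt), (abs_le.1 hxy).1]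
  have h3 : (ℓ x : ℝ) ≤ ℓ y + k := by exact_mod_cast h1
  have h4 : (ℓ y : ℝ) ≤ ℓ x + k := by exact_mod_cast h2
  exact abs_le.2 ⟨by linarith, by linarith⟩

/-- The quantity `x - 2πℓ(x)/(2k+1)` depends only on the point `[x]`. -/
theorem sub_label_eq (h : IsLabelling Θ k ℓ) {x y : ℝ} (hx : (x : S1) ∈ Θ)
    (hxy : (x : S1) = (y : S1)) :
    x - 2 * Real.pi / (2 * k + 1) * ℓ x = y - 2 * Real.pi / (2 * k + 1) * ℓ y := by
  obtain ⟨j, rfl⟩ := coe_eq_coe_iff.1 hxy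
  rw [h.add_int_mul hx]
  push_cast
  field_simp
  ring

end IsLabelling

namespace IsFullLabelling

variable {Θ Θ' : Set S1} {k k' : ℕ} {ℓ ℓ' : ℝ → ℤ} {r : ℝ}

/-- The regular polygon inscribed in the arcs of `Θ` has diameter at most that of `Θ`: the steps by
`k` arcs have length at most `r`, and `2k+1` of them make `k` full turns. -/
theorem two_pi_mul_le (h : IsFullLabelling Θ k ℓ) (hΘ : ∀ p ∈ Θ, ∀ q ∈ Θ, dist p q ≤ r) :
    2 * Real.pi * k ≤ (2 * k + 1) * r := by
  obtain ⟨x₀, hx₀, hl₀⟩ := h.surj 0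
  have key : ∀ j : ℕ, ∀ x : ℝ, (x : S1) ∈ Θ → ℓ x = ((j : ℤ) + 1) * k →
      x ≤ x₀ + ((j : ℝ) + 1) * r := by
    intro j
    induction j with
    | zero =>
      intro x hx hl
      have := h.le_add hΘ hx hx₀ (by rw [hl, hl₀]; simp)
      simpa using this
    | succ j ih =>
      intro x hx hl
      obtain ⟨y, hy, hly⟩ := h.surj (((j : ℤ) + 1) * k)
      have h1 := h.le_add hΘ hx hy (by rw [hl, hly]; push_cast; linarith)
      have h2 := ih y hy hly
      push_cast
      linarith
  have h1 := key (2 * k) (x₀ + (k : ℤ) * (2 * Real.pi)) (by rwa [coe_add_int_mul])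
    (by rw [h.add_int_mul hx₀, hl₀]; push_cast; ring)
  push_cast at h1
  linarith

/-! ### Labellings of nearby sets -/

/-- Between angles with different labels there is the excluded interval around an antipode, of
length `2 (π - r)`. -/
theorem label_eq_of_abs_lt (h : IsFullLabelling Θ k ℓ) (hΘ : ∀ p ∈ Θ, ∀ q ∈ Θ, dist p q ≤ r)
    {x y : ℝ} (hx : (x : S1) ∈ Θ) (hy : (y : S1) ∈ Θ) (hxy : |x - y| < 2 * (Real.pi - r)) :
    ℓ x = ℓ y := by
  have key : ∀ x y : ℝ, (x : S1) ∈ Θ → (y : S1) ∈ Θ → |x - y| < 2 * (Real.pi - r) →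
      ¬ ℓ x < ℓ y := by
    intro x y hx hy hxy hlt
    obtain ⟨z, hz, h1, h2⟩ := (h.lt_iff_between hx hy).1 hlt
    have h3 := pi_sub_le_abs (hΘ _ hx _ hz)
    have h4 := pi_sub_le_abs (hΘ _ hy _ hz)
    rw [abs_of_neg (by linarith)] at h3
    rw [abs_of_pos (by linarith)] at h4
    rw [abs_lt] at hxy
    linarith
  exact le_antisymm (not_lt.1 (key y x hy hx (by rwa [abs_sub_comm])))
    (not_lt.1 (key x y hx hy hxy))

/-- A set that is close to `Θ` in the Hausdorff distance inherits the labels of `Θ`. -/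
theorem exists_near (h : IsFullLabelling Θ k ℓ) (hΘ : ∀ p ∈ Θ, ∀ q ∈ Θ, dist p q ≤ r)
    (h1 : ∀ q ∈ Θ', ∃ p ∈ Θ, dist p q < (Real.pi - r) / 4)
    (h2 : ∀ p ∈ Θ, ∃ q ∈ Θ', dist p q < (Real.pi - r) / 4) :
    ∃ ℓ', IsFullLabelling Θ' k ℓ' ∧ ∀ x y : ℝ, (x : S1) ∈ Θ → (y : S1) ∈ Θ' →
      |x - y| < (Real.pi - r) / 4 → ℓ' y = ℓ x := by
  classical
  set δ := (Real.pi - r) / 4 with hδ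
  have hex : ∀ y : ℝ, ∃ x : ℝ, (y : S1) ∈ Θ' → (x : S1) ∈ Θ ∧ |x - y| < δ := by
    intro y
    by_cases hy : (y : S1) ∈ Θ'
    · obtain ⟨p, hp, hd⟩ := h1 _ hy
      obtain ⟨x, rfl, hx⟩ := exists_lift_abs_eq_dist p y
      exact ⟨x, fun _ => ⟨hp, by rwa [hx]⟩⟩
    · exact ⟨0, fun hy' => absurd hy' hy⟩
  choose g hg using hex
  have hδ0 : 0 ≤ δ := by
    obtain ⟨p, hp⟩ := h.nonempty
    obtain ⟨q, -, hd⟩ := h2 p hp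
    exact dist_nonneg.trans hd.le
  have hgl : ∀ x y : ℝ, (x : S1) ∈ Θ → (y : S1) ∈ Θ' → |x - y| < δ → ℓ (g y) = ℓ x := by
    intro x y hx hy hxy
    obtain ⟨h3, h4⟩ := hg y hy
    refine h.label_eq_of_abs_lt hΘ h3 hx ?_
    have : |g y - x| ≤ |g y - y| + |x - y| := by
      rw [abs_sub_comm x y]; exact abs_sub_le _ _ _
    linarith
  refine ⟨fun y => ℓ (g y), ⟨⟨fun y hy => ?_, fun y y' hy hy' => ?_⟩, fun i => ?_⟩, hgl⟩
  · obtain ⟨h3, h4⟩ := hg y hy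
    rw [hgl (g y + 2 * Real.pi) (y + 2 * Real.pi) (by rwa [AddCircle.coe_add_period])
      (by rwa [AddCircle.coe_add_period]) (by rwa [add_sub_add_right_eq_sub]), h.add_period _ h3]
  · obtain ⟨h3, h4⟩ := hg y hy
    obtain ⟨h5, h6⟩ := hg y' hy'
    rw [← h.lt_iff _ _ h3 h5]
    have hgap := pi_sub_le_abs (hΘ _ h3 _ h5)
    rw [abs_lt] at h4 h6
    constructor
    · intro hlt
      by_contra hge
      rw [abs_of_nonneg (by linarith)] at hgap
      linarith
    · intro hlt
      rw [abs_of_neg (by linarith)] at hgap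
      linarith
  · obtain ⟨x, hx, rfl⟩ := h.surj i
    obtain ⟨q, hq, hd⟩ := h2 _ hx
    obtain ⟨y, rfl, hy⟩ := exists_lift_abs_eq_dist q x
    rw [dist_comm, ← hy, abs_sub_comm] at hd
    exact ⟨y, hq, hgl x y hx hq hd⟩

/-- Comparison of the labels of `Θ` with those of a set `Θ'` that has points near all points of `Θ`.
Either `Θ'` has more arcs than `Θ`, and then one of its arcs stays away from `Θ`, or `Θ'` has as
many arcs as `Θ`, and then the labels agree up to a constant and every arc of `Θ'` comes close to
`Θ`. -/
theorem near_cases (h : IsFullLabelling Θ k ℓ) (hΘ : ∀ p ∈ Θ, ∀ q ∈ Θ, dist p q ≤ r)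
    (h' : IsFullLabelling Θ' k' ℓ')
    (h2 : ∀ p ∈ Θ, ∃ q ∈ Θ', dist p q < (Real.pi - r) / 4) :
    (k < k' ∧ ∃ i, ∀ y : ℝ, (y : S1) ∈ Θ' → (∃ p ∈ Θ, dist p (y : S1) < (Real.pi - r) / 4) →
        ℓ' y ≠ i) ∨
      (k' = k ∧ (∀ i, ∃ y : ℝ, (y : S1) ∈ Θ' ∧ (∃ p ∈ Θ, dist p (y : S1) < (Real.pi - r) / 4) ∧
          ℓ' y = i) ∧
        ∃ c : ℤ, ∀ x y : ℝ, (x : S1) ∈ Θ → (y : S1) ∈ Θ' → |x - y| < (Real.pi - r) / 4 →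
          ℓ' y = ℓ x + c) := by
  set δ := (Real.pi - r) / 4 with hδ
  set Θ'' : Set S1 := {q | q ∈ Θ' ∧ ∃ p ∈ Θ, dist p q < δ} with hΘ''
  obtain ⟨l, hl, hlx⟩ := h.exists_near (Θ' := Θ'') hΘ (fun q hq => hq.2) fun p hp => by
    obtain ⟨q, hq, hd⟩ := h2 p hp
    exact ⟨q, ⟨hq, p, hp, hd⟩, hd⟩
  have hsub : IsLabelling Θ'' k' ℓ' := h'.toIsLabelling.mono fun q hq => hq.1
  by_cases hs : ∀ i : ℤ, ∃ y : ℝ, (y : S1) ∈ Θ'' ∧ ℓ' y = i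
  · right
    obtain ⟨hk, c, hc⟩ := hl.unique ⟨hsub, hs⟩
    refine ⟨hk, fun i => ?_, c, fun x y hx hy hxy => ?_⟩
    · obtain ⟨y, hy, hi⟩ := hs i
      exact ⟨y, hy.1, hy.2, hi⟩
    · have hy' : (y : S1) ∈ Θ'' := ⟨hy, x, hx, (dist_coe_le x y).trans_lt hxy⟩
      rw [hc y hy', hlx x y hx hy' hxy]
  · left
    push Not at hs
    obtain ⟨i, hi⟩ := hs
    obtain ⟨k₁, hk₁, l₁, hl₁⟩ := hsub.exists_full_lt hl.nonempty hi
    obtain ⟨rfl, -⟩ := hl.unique hl₁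
    exact ⟨hk₁, i, fun y hy hp => hi y ⟨hy, hp⟩⟩

end IsFullLabelling

/-! ### The arcs of a labelled set -/

/-- The points at angular distance between `r` and `2π - r` are excluded. -/
theorem lt_dist_coe {r x y : ℝ} (h1 : r < x - y) (h2 : x - y < 2 * Real.pi - r) :
    r < dist (x : S1) (y : S1) := by
  obtain ⟨j, hj⟩ := exists_abs_eq_dist x y
  rw [← hj, lt_abs]
  rcases le_or_gt 0 j with h0 | h0
  · have : (0 : ℝ) ≤ j := by exact_mod_cast h0
    left
    nlinarith [Real.pi_pos]
  · have : (j : ℝ) ≤ -1 := by exact_mod_cast Int.le_sub_one_of_lt h0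
    right
    nlinarith [Real.pi_pos]

theorem exists_mem_excluded {r : ℝ} (hr : r < Real.pi) {Θ : Set S1} (hΘ : Θ.Nonempty) :
    ∃ θ : ℝ, (θ : S1) ∈ excluded r Θ := by
  obtain ⟨p, hp⟩ := hΘ
  obtain ⟨x, rfl⟩ := QuotientAddGroup.mk_surjective p
  exact ⟨x + Real.pi, _, hp, lt_dist_coe (by linarith) (by linarith)⟩

theorem coe_coord (θ : ℝ) (p : S1) : (coord θ p : S1) = p := AddCircle.coe_equivIco

theorem coord_mem (θ : ℝ) (p : S1) : coord θ p ∈ Set.Ico θ (θ + 2 * Real.pi) :=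
  (AddCircle.equivIco (2 * Real.pi) θ p).2

theorem coord_coe {θ x : ℝ} (hx : x ∈ Set.Ico θ (θ + 2 * Real.pi)) : coord θ (x : S1) = x :=
  AddCircle.equivIco_coe_of_mem hx

namespace IsFullLabelling

variable {Θ : Set S1} {k : ℕ} {ℓ : ℝ → ℤ} {r : ℝ}

theorem finite_label (h : IsFullLabelling Θ k ℓ) (hfin : Θ.Finite) (i : ℤ) :
    {x : ℝ | (x : S1) ∈ Θ ∧ ℓ x = i}.Finite := by
  refine Set.Finite.of_finite_image (f := fun x : ℝ => (x : S1)) (hfin.subset ?_) ?_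
  · rintro _ ⟨x, hx, rfl⟩
    exact hx.1
  · rintro x ⟨hx, hlx⟩ y ⟨hy, hly⟩ hxy
    have := h.sub_label_eq hx hxy
    rw [hlx, hly] at this
    linarith

/-- The least angle `m i` and the greatest angle `M i` with the label `i`. -/
theorem exists_extreme (h : IsFullLabelling Θ k ℓ) (hfin : Θ.Finite) :
    ∃ m M : ℤ → ℝ, ∀ i,
      ((m i : S1) ∈ Θ ∧ ℓ (m i) = i ∧ ∀ x : ℝ, (x : S1) ∈ Θ → ℓ x = i → m i ≤ x) ∧
      ((M i : S1) ∈ Θ ∧ ℓ (M i) = i ∧ ∀ x : ℝ, (x : S1) ∈ Θ → ℓ x = i → x ≤ M i) := by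
  have h1 : ∀ i, ∃ m : ℝ, (m : S1) ∈ Θ ∧ ℓ m = i ∧ ∀ x : ℝ, (x : S1) ∈ Θ → ℓ x = i → m ≤ x := by
    intro i
    obtain ⟨m, hm, hmin⟩ :=
      Set.exists_min_image _ (fun x : ℝ => x) (h.finite_label hfin i) (h.surj i)
    exact ⟨m, hm.1, hm.2, fun x hx hl => hmin x ⟨hx, hl⟩⟩
  have h2 : ∀ i, ∃ m : ℝ, (m : S1) ∈ Θ ∧ ℓ m = i ∧ ∀ x : ℝ, (x : S1) ∈ Θ → ℓ x = i → x ≤ m := by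
    intro i
    obtain ⟨m, hm, hmin⟩ :=
      Set.exists_max_image _ (fun x : ℝ => x) (h.finite_label hfin i) (h.surj i)
    exact ⟨m, hm.1, hm.2, fun x hx hl => hmin x ⟨hx, hl⟩⟩
  choose m hm using h1
  choose M hM using h2
  exact ⟨m, M, fun i => ⟨hm i, hM i⟩⟩

/-- The lifts `[lo i, hi i]` of the arcs. The angles of points of `Θ` in `[lo i, hi i]` are those
with label `i`, and `[lo i, hi i]` is the largest interval that contains such an angle and no angle
of an excluded point. Its ends are determined by the arcs of labels `i + k` and `i - k`: the
excluded intervals next to it are centred at the antipodes of their extreme points. -/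
theorem exists_arcs (h : IsFullLabelling Θ k ℓ) (hfin : Θ.Finite) (hr : r < Real.pi)
    (hΘ : ∀ p ∈ Θ, ∀ q ∈ Θ, dist p q ≤ r) :
    ∃ lo hi : ℤ → ℝ, (∀ x : ℝ, (x : S1) ∈ Θ → ∀ i, x ∈ Set.Icc (lo i) (hi i) ↔ ℓ x = i) ∧
      (∀ i, ∀ x ∈ Set.Icc (lo i) (hi i), (x : S1) ∉ excluded r Θ) ∧
      (∀ x : ℝ, (x : S1) ∈ Θ → ∀ i < ℓ x, hi i < x) ∧
      ∀ x : ℝ, (x : S1) ∈ Θ → ∀ a b, x ∈ Set.Icc a b →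
        (∀ y ∈ Set.Icc a b, (y : S1) ∉ excluded r Θ) →
          Set.Icc a b ⊆ Set.Icc (lo (ℓ x)) (hi (ℓ x)) := by
  obtain ⟨m, M, hmM⟩ := h.exists_extreme hfin
  have hmle : ∀ x : ℝ, (x : S1) ∈ Θ → ∀ i, i ≤ ℓ x → m i ≤ x := by
    intro x hx i hi
    rcases eq_or_lt_of_le hi with h1 | h1
    · exact (hmM i).1.2.2 x hx h1.symm
    · exact (h.lt_of_label_lt (hmM i).1.1 hx (by rw [(hmM i).1.2.1]; exact h1)).le
  have hleM : ∀ x : ℝ, (x : S1) ∈ Θ → ∀ i, ℓ x ≤ i → x ≤ M i := by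
    intro x hx i hi
    rcases eq_or_lt_of_le hi with h1 | h1
    · exact (hmM i).2.2.2 x hx h1
    · exact (h.lt_of_label_lt hx (hmM i).2.1 (by rw [(hmM i).2.2.1]; exact h1)).le
  have hmem : ∀ x : ℝ, (x : S1) ∈ Θ → x ∈ Set.Icc (M (ℓ x + k) - r) (m (ℓ x - k) + r) := by
    intro x hx
    have h1 := h.le_add hΘ (hmM (ℓ x + k)).2.1 hx (by rw [(hmM _).2.2.1])
    have h2 := h.le_add hΘ hx (hmM (ℓ x - k)).1.1 (by rw [(hmM _).1.2.1]; omega)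
    constructor <;> linarith
  have hhi : ∀ x : ℝ, (x : S1) ∈ Θ → ∀ i < ℓ x, m (i - k) + r < x := by
    intro x hx i hi
    have := h.add_pi_lt hx (hmM (i - k)).1.1 (by rw [(hmM _).1.2.1]; omega)
    linarith
  have hlo : ∀ x : ℝ, (x : S1) ∈ Θ → ∀ i, ℓ x < i → x < M (i + k) - r := by
    intro x hx i hi
    have := h.add_pi_lt (hmM (i + k)).2.1 hx (by rw [(hmM _).2.2.1]; omega)
    linarith
  refine ⟨fun i => M (i + k) - r, fun i => m (i - k) + r, fun x hx i => ⟨fun hxi => ?_, ?_⟩,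
    fun i x hxi => ?_, hhi, fun x hx a b hxab hab y hy => ?_⟩
  · rcases lt_trichotomy (ℓ x) i with h1 | h1 | h1
    · exact absurd hxi.1 (not_le.2 (hlo x hx i h1))
    · exact h1
    · exact absurd hxi.2 (not_le.2 (hhi x hx i h1))
  · rintro rfl
    exact hmem x hx
  · rintro ⟨q, hq, hlt⟩
    obtain ⟨z, rfl⟩ := QuotientAddGroup.mk_surjective q
    -- the lift of `q` whose label lies in `[i - k, i + k]`
    set n : ℤ := 2 * k + 1 with hn
    have hn0 : 0 < n := by omega
    set j : ℤ := -((ℓ z - (i - k)) / n) with hj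
    have hz : ((z + j * (2 * Real.pi) : ℝ) : S1) ∈ Θ := by rwa [coe_add_int_mul]
    have hl : ℓ (z + j * (2 * Real.pi)) = i - k + (ℓ z - (i - k)) % n := by
      rw [h.add_int_mul hq, hj]
      have := Int.mul_ediv_add_emod (ℓ z - (i - k)) n
      linarith
    have h0 := Int.emod_nonneg (ℓ z - (i - k)) hn0.ne'
    have h1 := Int.emod_lt_of_pos (ℓ z - (i - k)) hn0
    have h2 := hmle _ hz (i - k) (by omega)
    have h3 := hleM _ hz (i + k) (by omega)
    refine absurd hlt (not_lt.2 ?_)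
    have h4 : ((z : ℝ) : S1) = ((z + j * (2 * Real.pi) : ℝ) : S1) := (coe_add_int_mul z j).symm
    have h5 := dist_coe_le x (z + j * (2 * Real.pi))
    rw [← h4] at h5
    refine h5.trans (abs_le.2 ⟨?_, ?_⟩)
    · have := hxi.1; linarith
    · have := hxi.2; linarith
  · have hx' := hmem x hx
    constructor
    · by_contra hlt
      simp only [not_le] at hlt
      have hM := hmM (ℓ x + k)
      refine hab (max a (M (ℓ x + k) - r - (Real.pi - r))) ⟨le_max_left _ _, ?_⟩
        ⟨_, hM.2.1, ?_⟩
      · exact max_le (hxab.1.trans hxab.2) (by linarith [hx'.1, hxab.2])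
      · rw [dist_comm]
        have h1 := le_max_left a (M (ℓ x + k) - r - (Real.pi - r))
        have h2 := le_max_right a (M (ℓ x + k) - r - (Real.pi - r))
        have h3 : max a (M (ℓ x + k) - r - (Real.pi - r)) < M (ℓ x + k) - r :=
          max_lt (hy.1.trans_lt hlt) (by linarith)
        exact lt_dist_coe (by linarith) (by linarith)
    · by_contra hlt
      simp only [not_le] at hlt
      have hm := hmM (ℓ x - k)
      refine hab (min b (m (ℓ x - k) + r + (Real.pi - r))) ⟨?_, min_le_left _ _⟩
        ⟨_, hm.1.1, ?_⟩
      · exact le_min (hxab.1.trans hxab.2) (by linarith [hx'.2, hxab.1])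
      · have h1 := min_le_left b (m (ℓ x - k) + r + (Real.pi - r))
        have h2 := min_le_right b (m (ℓ x - k) + r + (Real.pi - r))
        have h3 : m (ℓ x - k) + r < min b (m (ℓ x - k) + r + (Real.pi - r)) :=
          lt_min (hlt.trans_le hy.2) (by linarith)
        exact lt_dist_coe (by linarith) (by linarith)

end IsFullLabelling

/-- The image in the circle of a closed interval of angles. -/
def arcImage (a b : ℝ) : Set S1 := (fun θ : ℝ => (θ : S1)) '' Set.Icc a b

theorem arcImage_add (a b : ℝ) (j : ℤ) :
    arcImage (a + j * (2 * Real.pi)) (b + j * (2 * Real.pi)) = arcImage a b := by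
  ext p
  constructor
  · rintro ⟨x, hx, rfl⟩
    refine ⟨x + (-j : ℤ) * (2 * Real.pi), ?_, coe_add_int_mul x _⟩
    have := hx.1
    have := hx.2
    constructor <;> push_cast <;> linarith
  · rintro ⟨x, hx, rfl⟩
    refine ⟨x + j * (2 * Real.pi), ?_, coe_add_int_mul x _⟩
    have := hx.1
    have := hx.2
    constructor <;> linarith

namespace IsFullLabelling

variable {Θ : Set S1} {k : ℕ} {ℓ : ℝ → ℤ} {r : ℝ}

/-- The arcs of a set with a full labelling: they correspond to the labels modulo `2k+1`. -/
theorem exists_arcs_eq_range (h : IsFullLabelling Θ k ℓ) (hfin : Θ.Finite) (hr : r < Real.pi)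
    (hΘ : ∀ p ∈ Θ, ∀ q ∈ Θ, dist p q ≤ r) :
    ∃ lo hi : ℤ → ℝ, (∀ x : ℝ, (x : S1) ∈ Θ → ∀ i, x ∈ Set.Icc (lo i) (hi i) ↔ ℓ x = i) ∧
      (∀ i, ∀ x ∈ Set.Icc (lo i) (hi i), (x : S1) ∉ excluded r Θ) ∧
      (∀ x : ℝ, (x : S1) ∈ Θ → ∀ i < ℓ x, hi i < x) ∧
      (∀ i j : ℤ, arcImage (lo (i + j * (2 * k + 1))) (hi (i + j * (2 * k + 1))) =
        arcImage (lo i) (hi i)) ∧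
      (∀ i j : ℤ, arcImage (lo i) (hi i) = arcImage (lo j) (hi j) → ((2 * k + 1 : ℤ) ∣ i - j)) ∧
      {A | IsArcOf r Θ A} = Set.range fun i => arcImage (lo i) (hi i) := by
  obtain ⟨lo, hi, hmem, hex, hhi, hmax⟩ := h.exists_arcs hfin hr hΘ
  have hle : ∀ i, lo i ≤ hi i := fun i => by
    obtain ⟨x, hx, hl⟩ := h.surj i
    have := (hmem x hx i).2 hl
    exact this.1.trans this.2
  have hexj : ∀ (i j : ℤ), ∀ x ∈ Set.Icc (lo i + j * (2 * Real.pi)) (hi i + j * (2 * Real.pi)),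
      (x : S1) ∉ excluded r Θ := by
    intro i j x hx
    have := hex i (x + (-j : ℤ) * (2 * Real.pi)) (by
      have := hx.1
      have := hx.2
      constructor <;> push_cast <;> linarith)
    rwa [coe_add_int_mul] at this
  have hsub : ∀ i j : ℤ, arcImage (lo i) (hi i) ⊆
      arcImage (lo (i + j * (2 * k + 1))) (hi (i + j * (2 * k + 1))) := by
    intro i j
    obtain ⟨x, hx, rfl⟩ := h.surj i
    rw [← arcImage_add _ _ j, ← h.add_int_mul hx]
    refine Set.image_mono (hmax _ (by rwa [coe_add_int_mul]) _ _ ?_ (hexj _ j))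
    have hx' := (hmem x hx _).2 rfl
    have := hx'.1
    have := hx'.2
    constructor <;> linarith
  have hper : ∀ i j : ℤ, arcImage (lo (i + j * (2 * k + 1))) (hi (i + j * (2 * k + 1))) =
      arcImage (lo i) (hi i) := by
    intro i j
    refine Set.Subset.antisymm ?_ (hsub i j)
    have := hsub (i + j * (2 * k + 1)) (-j)
    rwa [neg_mul, add_neg_cancel_right] at this
  have hinj : ∀ i j : ℤ, arcImage (lo i) (hi i) = arcImage (lo j) (hi j) →
      ((2 * k + 1 : ℤ) ∣ i - j) := by
    intro i j hij
    obtain ⟨x, hx, rfl⟩ := h.surj i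
    have : (x : S1) ∈ arcImage (lo (ℓ x)) (hi (ℓ x)) := ⟨x, (hmem x hx _).2 rfl, rfl⟩
    rw [hij] at this
    obtain ⟨y, hy, hyx⟩ := this
    obtain ⟨c, rfl⟩ := coe_eq_coe_iff.1 (Eq.symm hyx)
    have := (hmem _ (by rwa [coe_add_int_mul]) j).1 hy
    rw [h.add_int_mul hx] at this
    exact ⟨-c, by linarith⟩
  refine ⟨lo, hi, hmem, hex, hhi, hper, hinj, ?_⟩
  have hdisj : ∀ i, Disjoint (arcImage (lo i) (hi i)) (excluded r Θ) := by
    intro i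
    rw [Set.disjoint_left]
    rintro _ ⟨x, hx, rfl⟩
    exact hex i x hx
  -- a closed arc that contains a point of label `i` and no excluded point lies in the `i`-th arc
  have hin : ∀ B : Set S1, IsClosedArc B → Disjoint B (excluded r Θ) → ∀ x : ℝ, (x : S1) ∈ Θ →
      (x : S1) ∈ B → B ⊆ arcImage (lo (ℓ x)) (hi (ℓ x)) := by
    rintro _ ⟨a, b, -, rfl⟩ hB x hx ⟨y, hy, hyx⟩
    obtain ⟨c, rfl⟩ := coe_eq_coe_iff.1 (Eq.symm hyx)
    rw [← hper (ℓ x) c, ← h.add_int_mul hx]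
    refine Set.image_mono (hmax _ (by rwa [coe_add_int_mul]) a b hy fun z hz => ?_)
    exact Set.disjoint_left.1 hB ⟨z, hz, rfl⟩
  ext A
  constructor
  · rintro ⟨⟨hA, ⟨p, hpA, hp⟩, hAd⟩, hAmax⟩
    obtain ⟨x, rfl⟩ := QuotientAddGroup.mk_surjective p
    refine ⟨ℓ x, ?_⟩
    have h1 := hin A hA hAd x hp hpA
    refine Set.Subset.antisymm (hAmax ⟨⟨_, _, hle _, rfl⟩, ⟨x, ?_, hp⟩, hdisj _⟩ h1) h1
    exact ⟨x, (hmem x hp _).2 rfl, rfl⟩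
  · rintro ⟨i, rfl⟩
    obtain ⟨x, hx, rfl⟩ := h.surj i
    have hxA : (x : S1) ∈ arcImage (lo (ℓ x)) (hi (ℓ x)) := ⟨x, (hmem x hx _).2 rfl, rfl⟩
    exact ⟨⟨⟨_, _, hle _, rfl⟩, ⟨x, hxA, hx⟩, hdisj _⟩,
      fun B hB hAB => hin B hB.1 hB.2.2 x hx (hAB hxA)⟩

/-- A set with a full labelling of order `k` has exactly `2k+1` arcs. -/
theorem encard_arcs (h : IsFullLabelling Θ k ℓ) (hfin : Θ.Finite) (hr : r < Real.pi)
    (hΘ : ∀ p ∈ Θ, ∀ q ∈ Θ, dist p q ≤ r) : {A | IsArcOf r Θ A}.encard = 2 * k + 1 := by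
  obtain ⟨lo, hi, -, -, -, hper, hinj, hrange⟩ := h.exists_arcs_eq_range hfin hr hΘ
  have hn : (0 : ℤ) < 2 * k + 1 := by omega
  have : (Set.range fun i => arcImage (lo i) (hi i)) =
      (fun i => arcImage (lo i) (hi i)) '' (Set.Ico (0 : ℤ) (2 * k + 1)) := by
    ext A
    constructor
    · rintro ⟨i, rfl⟩
      refine ⟨i % (2 * k + 1), ⟨Int.emod_nonneg _ hn.ne', Int.emod_lt_of_pos _ hn⟩, ?_⟩
      have := hper (i % (2 * k + 1)) (i / (2 * k + 1))
      rw [mul_comm (i / _), Int.emod_add_mul_ediv] at this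
      exact this.symm
    · rintro ⟨i, -, rfl⟩
      exact ⟨i, rfl⟩
  rw [hrange, this, Set.InjOn.encard_image]
  · rw [← Finset.coe_Ico, Set.encard_coe_eq_coe_finsetCard, Int.card_Ico]
    have : ((2 * (k : ℤ) + 1 - 0).toNat) = 2 * k + 1 := by omega
    rw [this]
    push_cast
    rfl
  · rintro i ⟨hi0, hi1⟩ j ⟨hj0, hj1⟩ hij
    obtain ⟨c, hc⟩ := hinj i j hij
    have : c = 0 := by
      by_contra hne
      rcases lt_or_gt_of_ne hne with h1 | h1
      · nlinarith
      · nlinarith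
    rw [this, mul_zero] at hc
    linarith

/-- The arc index counted from an excluded point is the label, up to a constant. -/
theorem exists_arcIndex_eq {μ : FinProb S1} (h : IsFullLabelling (μ.supp : Set S1) k ℓ)
    (hr : r < Real.pi) (hΘ : ∀ p ∈ μ.supp, ∀ q ∈ μ.supp, dist p q ≤ r) {θ : ℝ}
    (hθ : (θ : S1) ∈ excluded r (μ.supp : Set S1)) :
    ∃ c : ℤ, ∀ p ∈ μ.supp, (arcIndex r μ θ p : ℤ) = ℓ (coord θ p) - c := by
  obtain ⟨lo, hi, hmem, hex, hhi, hper, hinj, hrange⟩ :=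
    h.exists_arcs_eq_range μ.supp.finite_toSet hr (fun p hp q hq => hΘ p hp q hq)
  have hθ' : ((θ + 2 * Real.pi : ℝ) : S1) ∈ excluded r (μ.supp : Set S1) := by
    rwa [AddCircle.coe_add_period]
  obtain ⟨p₀, hp₀, hmin⟩ := μ.supp.exists_min_image (coord θ) μ.supp_nonempty
  have hcs : ∀ p ∈ μ.supp, ((coord θ p : ℝ) : S1) ∈ (μ.supp : Set S1) := fun p hp => by
    rw [coe_coord]; exact hp
  set n : ℤ := 2 * k + 1 with hn
  set x₀ := coord θ p₀ with hx₀
  set c := ℓ x₀ with hc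
  have hx₀m : (x₀ : S1) ∈ (μ.supp : Set S1) := hcs _ hp₀
  have hx₀w := coord_mem θ p₀
  have hx₀l : ℓ (x₀ + 2 * Real.pi) = c + n := h.add_period _ hx₀m
  -- the labels of the angles in the window `[θ, θ + 2π)` are `c, …, c + n - 1`
  have hwin : ∀ p ∈ μ.supp, c ≤ ℓ (coord θ p) ∧ ℓ (coord θ p) < c + n := by
    intro p hp
    constructor
    · by_contra hlt
      exact absurd (h.lt_of_label_lt (hcs p hp) hx₀m (not_le.1 hlt)) (not_lt.2 (hmin p hp))
    · by_contra hge
      simp only [not_lt] at hge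
      rw [← hx₀l] at hge
      have h2 : ((x₀ + 2 * Real.pi : ℝ) : S1) ∈ (μ.supp : Set S1) := by
        rwa [AddCircle.coe_add_period]
      rcases eq_or_lt_of_le hge with h1 | h1
      · have h3 := (hmem _ (hcs p hp) _).2 rfl
        have h4 := (hmem _ h2 _).2 h1
        refine hex _ (θ + 2 * Real.pi) ⟨h3.1.trans (coord_mem θ p).2.le, ?_⟩ hθ'
        exact (add_le_add_left hx₀w.1 _).trans h4.2
      · have h3 := h.lt_of_label_lt h2 (hcs p hp) h1
        have h4 := (coord_mem θ p).2
        have h5 := hx₀w.1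
        linarith
  -- the arcs with these labels lie in the window
  have hpt : ∀ i, c ≤ i → i < c + n → ∃ p ∈ μ.supp, ℓ (coord θ p) = i := by
    intro i hi1 hi2
    obtain ⟨x, hx, hl⟩ := h.surj i
    refine ⟨x, hx, ?_⟩
    obtain ⟨j, hj⟩ := coe_eq_coe_iff.1 (coe_coord θ (x : S1)).symm
    have h1 := hwin x hx
    rw [← hj, h.add_int_mul hx, hl, ← hn] at h1 ⊢
    have : j = 0 := by
      by_contra hne
      rcases lt_or_gt_of_ne hne with h3 | h3
      · nlinarith
      · nlinarith
    rw [this, zero_mul, add_zero]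
  have hsubw : ∀ i, c ≤ i → i < c + n → ∀ x ∈ Set.Icc (lo i) (hi i), coord θ (x : S1) = x := by
    intro i hi1 hi2 x hx
    obtain ⟨p, hp, hl⟩ := hpt i hi1 hi2
    have h1 := (hmem _ (hcs p hp) i).2 hl
    have h2 := coord_mem θ p
    refine coord_coe ⟨?_, ?_⟩
    · by_contra hlt
      exact hex i θ ⟨hx.1.trans (not_le.1 hlt).le, h2.1.trans h1.2⟩ hθ
    · by_contra hlt
      exact hex i (θ + 2 * Real.pi) ⟨h1.1.trans h2.2.le, (not_lt.1 hlt).trans hx.2⟩ hθ'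
  refine ⟨c, fun p hp => ?_⟩
  have hset : {A | IsArcOf r (μ.supp : Set S1) A ∧ ∀ q ∈ A, coord θ q < coord θ p} =
      (fun i => arcImage (lo i) (hi i)) '' (Set.Ico c (ℓ (coord θ p))) := by
    ext A
    constructor
    · rintro ⟨hA, hAlt⟩
      have hA' : A ∈ {A | IsArcOf r (μ.supp : Set S1) A} := hA
      rw [hrange] at hA'
      obtain ⟨i₀, rfl⟩ := hA'
      -- the representative of the label of the arc in the window
      obtain ⟨i, hi1, hi2, hi3⟩ : ∃ i, c ≤ i ∧ i < c + n ∧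
          arcImage (lo i) (hi i) = arcImage (lo i₀) (hi i₀) := by
        have hn0 : 0 < n := by omega
        have h0 := Int.emod_nonneg (i₀ - c) hn0.ne'
        have h1 := Int.emod_lt_of_pos (i₀ - c) hn0
        refine ⟨c + (i₀ - c) % n, by omega, by omega, ?_⟩
        rw [← hper (c + (i₀ - c) % n) ((i₀ - c) / n)]
        have := Int.mul_ediv_add_emod (i₀ - c) n
        have h2 : c + (i₀ - c) % n + (i₀ - c) / n * n = i₀ := by linarith
        rw [h2]
      refine ⟨i, ⟨hi1, ?_⟩, hi3⟩
      by_contra hge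
      simp only [not_lt] at hge
      obtain ⟨q, hq, hl⟩ := hpt i hi1 hi2
      have h1 := hAlt q (by
        show q ∈ arcImage (lo i₀) (hi i₀)
        rw [← hi3]
        exact ⟨coord θ q, (hmem _ (hcs q hq) i).2 hl, coe_coord θ q⟩)
      rcases eq_or_lt_of_le hge with h2 | h2
      · -- the arc contains `p` itself
        have h3 := hAlt p (by
          show p ∈ arcImage (lo i₀) (hi i₀)
          rw [← hi3]
          exact ⟨coord θ p, (hmem _ (hcs p hp) i).2 h2, coe_coord θ p⟩)
        exact lt_irrefl _ h3
      · rw [← hl] at h2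
        exact absurd (h.lt_of_label_lt (hcs p hp) (hcs q hq) h2) (not_lt.2 h1.le)
    · rintro ⟨i, ⟨hi1, hi2⟩, rfl⟩
      refine ⟨?_, ?_⟩
      · have : arcImage (lo i) (hi i) ∈ {A | IsArcOf r (μ.supp : Set S1) A} := by
          rw [hrange]; exact ⟨i, rfl⟩
        exact this
      · rintro _ ⟨x, hx, rfl⟩
        show coord θ (x : S1) < _
        rw [hsubw i hi1 (hi2.trans (hwin p hp).2) x hx]
        exact hx.2.trans_lt (hhi _ (hcs p hp) i hi2)
  have hcard : arcIndex r μ θ p = (Set.Ico c (ℓ (coord θ p))).ncard := by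
    rw [arcIndex, hset, Set.InjOn.ncard_image]
    rintro i ⟨hi1, hi2⟩ j ⟨hj1, hj2⟩ hij
    obtain ⟨d, hd⟩ := hinj i j hij
    have h1 := (hwin p hp).2
    have : d = 0 := by
      by_contra hne
      rcases lt_or_gt_of_ne hne with h1 | h1
      · nlinarith
      · nlinarith
    rw [this, mul_zero] at hd
    linarith
  rw [hcard, ← Finset.coe_Ico, Set.ncard_coe_finset, Int.card_Ico]
  have := (hwin p hp).1
  omega

end IsFullLabelling

/-! ### The collapsing homotopy in terms of labels -/

/-- The displacement from a regular polygon: the difference of the angle of `p` and the angle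
`2πℓ/(2k+1)`. It does not depend on the angle chosen for `p`. -/
def offset (k : ℕ) (ℓ : ℝ → ℤ) (p : S1) : ℝ :=
  coord 0 p - 2 * Real.pi / (2 * k + 1) * ℓ (coord 0 p)

theorem IsLabelling.offset_eq {Θ : Set S1} {k : ℕ} {ℓ : ℝ → ℤ} (h : IsLabelling Θ k ℓ) {x : ℝ}
    (hx : (x : S1) ∈ Θ) : offset k ℓ (x : S1) = x - 2 * Real.pi / (2 * k + 1) * ℓ x :=
  h.sub_label_eq (by rwa [coe_coord]) (coe_coord 0 _)

theorem IsFullLabelling.Ftilde_eq {μ : FinProb S1} {k : ℕ} {ℓ : ℝ → ℤ} {r : ℝ}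
    (h : IsFullLabelling (μ.supp : Set S1) k ℓ)
    (hr : r < Real.pi) (hΘ : ∀ p ∈ μ.supp, ∀ q ∈ μ.supp, dist p q ≤ r) (t : unitInterval) :
    Ftilde r k μ t = μ.map fun p =>
      p + ((-(t : ℝ) * (offset k ℓ p - μ.integral (offset k ℓ)) : ℝ) : S1) := by
  have hcut : (cut r μ : S1) ∈ excluded r (μ.supp : Set S1) :=
    Classical.epsilon_spec (exists_mem_excluded hr h.nonempty)
  obtain ⟨c, hc⟩ := h.exists_arcIndex_eq hr hΘ hcut
  have hc' : ∀ p ∈ μ.supp, (arcIndex r μ (cut r μ) p : ℝ) = ℓ (coord (cut r μ) p) - c := by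
    intro p hp
    have := hc p hp
    have h2 : ((arcIndex r μ (cut r μ) p : ℤ) : ℝ) = ((ℓ (coord (cut r μ) p) - c : ℤ) : ℝ) := by
      rw [this]
    push_cast at h2
    exact h2
  have hoff : ∀ p ∈ μ.supp, coord (cut r μ) p - 2 * Real.pi / (2 * k + 1) * ℓ (coord (cut r μ) p) =
      offset k ℓ p := by
    intro p hp
    have := h.offset_eq (x := coord (cut r μ) p) (by rw [coe_coord]; exact hp)
    rw [← this, coe_coord]
  have hmean : meanPosition r k μ (cut r μ) =
      μ.integral (offset k ℓ) + 2 * Real.pi / (2 * k + 1) * c := by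
    rw [meanPosition]
    rw [FinProb.integral_congr (g := fun p => offset k ℓ p + 2 * Real.pi / (2 * k + 1) * c),
      FinProb.integral_add, FinProb.integral_const]
    intro p hp
    rw [hc' p hp, ← hoff p hp]
    ring
  refine FinProb.map_congr fun p hp => ?_
  rw [F, moveIn, hmean, hc' p hp]
  conv_rhs => rw [← coe_coord (cut r μ) p, ← AddCircle.coe_add]
  rw [coe_coord, ← hoff p hp]
  congr 1
  ring

/-! ### Thinning the arcs and moving them towards a regular polygon -/

/-- The displacement from the regular polygon with the same mean as `μ`. -/
def centred (k : ℕ) (ℓ : ℝ → ℤ) (μ : FinProb S1) (p : S1) : ℝ :=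
  offset k ℓ p - μ.integral (offset k ℓ)

/-- The arc of the point `p`, as a label modulo `2k+1`. -/
def resid (k : ℕ) (ℓ : ℝ → ℤ) (p : S1) : ZMod (2 * k + 1) := (ℓ (coord 0 p) : ZMod (2 * k + 1))

/-- The mass of the arc of the point `p`. -/
def arcMass (k : ℕ) (ℓ : ℝ → ℤ) (μ : FinProb S1) (p : S1) : ℝ :=
  μ.integral fun q => if resid k ℓ q = resid k ℓ p then 1 else 0

/-- The density that removes mass `c` from each of the `2k+1` arcs, and rescales. -/
def arcWeight (k : ℕ) (ℓ : ℝ → ℤ) (c : ℝ) (μ : FinProb S1) (p : S1) : ℝ :=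
  (1 - c / arcMass k ℓ μ p) / (1 - (2 * k + 1) * c)

/-- The measure `μ` after removing mass `c` from each of the arcs, and rescaling. -/
def thinned (k : ℕ) (ℓ : ℝ → ℤ) (c : ℝ) (μ : FinProb S1) : FinProb S1 :=
  μ.reweight (arcWeight k ℓ c μ)

/-- The motion of the points of the thinned measure over the fraction `s` of their way to a regular
polygon, composed with the rotation that restores the mean of `μ`. -/
def displ (k : ℕ) (ℓ : ℝ → ℤ) (s c : ℝ) (μ : FinProb S1) (p : S1) : ℝ :=
  -s * centred k ℓ μ p - (1 - s) * (thinned k ℓ c μ).integral (centred k ℓ μ)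

/-- Thinning the arcs of `μ` by the mass `c` and moving the remaining points over the fraction `s`
of their way to a regular polygon. -/
def flow (k : ℕ) (ℓ : ℝ → ℤ) (s c : ℝ) (μ : FinProb S1) : FinProb S1 :=
  (thinned k ℓ c μ).map fun p => p + (displ k ℓ s c μ p : S1)

theorem integral_centred (k : ℕ) (ℓ : ℝ → ℤ) (μ : FinProb S1) :
    μ.integral (centred k ℓ μ) = 0 := by
  show (μ.integral fun p => offset k ℓ p - μ.integral (offset k ℓ)) = 0
  rw [FinProb.integral_sub, FinProb.integral_const, sub_self]

theorem arcMass_pos {k : ℕ} {ℓ : ℝ → ℤ} {μ : FinProb S1} {p : S1} (hp : p ∈ μ.supp) :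
    0 < arcMass k ℓ μ p :=
  FinProb.integral_pos (fun q _ => by split_ifs <;> norm_num) hp (by simp)

theorem arcWeight_nonneg {k : ℕ} {ℓ : ℝ → ℤ} {μ : FinProb S1} {c : ℝ}
    (hc : ∀ p ∈ μ.supp, c ≤ arcMass k ℓ μ p) (hc1 : (2 * k + 1) * c < 1) {p : S1}
    (hp : p ∈ μ.supp) : 0 ≤ arcWeight k ℓ c μ p :=
  div_nonneg (sub_nonneg.2 ((div_le_one (arcMass_pos hp)).2 (hc p hp))) (by linarith)

theorem displ_sub_displ (k : ℕ) (ℓ : ℝ → ℤ) (s c : ℝ) (μ : FinProb S1) (p q : S1) :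
    displ k ℓ s c μ p - displ k ℓ s c μ q = -s * (offset k ℓ p - offset k ℓ q) := by
  simp only [displ, centred]; ring

/-- The mean displacement does not depend on `s`. -/
theorem integral_displ (k : ℕ) (ℓ : ℝ → ℤ) (s c : ℝ) (μ : FinProb S1) :
    (thinned k ℓ c μ).integral (displ k ℓ s c μ) =
      -(thinned k ℓ c μ).integral (centred k ℓ μ) := by
  show ((thinned k ℓ c μ).integral fun p => -s * centred k ℓ μ p -
    (1 - s) * (thinned k ℓ c μ).integral (centred k ℓ μ)) = _
  rw [FinProb.integral_sub, FinProb.integral_const, FinProb.integral_const_mul]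
  ring

namespace IsLabelling

variable {Θ : Set S1} {k : ℕ} {ℓ : ℝ → ℤ} {r : ℝ} {μ : FinProb S1}

theorem resid_eq_iff (h : IsLabelling Θ k ℓ) {x y : ℝ} (hx : (x : S1) ∈ Θ) (hy : (y : S1) ∈ Θ) :
    resid k ℓ (x : S1) = resid k ℓ (y : S1) ↔ ((2 * k + 1 : ℕ) : ℤ) ∣ ℓ y - ℓ x := by
  have key : ∀ z : ℝ, (z : S1) ∈ Θ → resid k ℓ (z : S1) = ((ℓ z : ℤ) : ZMod (2 * k + 1)) := by
    intro z hz
    obtain ⟨j, hj⟩ := coe_eq_coe_iff.1 (coe_coord 0 (z : S1)).symm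
    rw [resid, ← hj, h.add_int_mul hz, ZMod.intCast_eq_intCast_iff_dvd_sub]
    exact ⟨-j, by push_cast; ring⟩
  rw [key x hx, key y hy, ZMod.intCast_eq_intCast_iff_dvd_sub]

/-- The moved distance of two angles is a convex combination of their distance and of the distance
of the corresponding vertices of the polygon. -/
theorem add_displ_sub (h : IsLabelling Θ k ℓ) (s c : ℝ) {x y : ℝ} (hx : (x : S1) ∈ Θ)
    (hy : (y : S1) ∈ Θ) :
    (x + displ k ℓ s c μ x) - (y + displ k ℓ s c μ y) =
      (1 - s) * (x - y) + s * (2 * Real.pi / (2 * k + 1) * (ℓ x - ℓ y)) := by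
  have h1 := displ_sub_displ k ℓ s c μ x y
  rw [h.offset_eq hx, h.offset_eq hy] at h1
  linear_combination h1

/-- The motion carries no point across an antipode. -/
theorem add_displ_lt_iff (h : IsLabelling Θ k ℓ) {s : ℝ} (c : ℝ) (hs0 : 0 ≤ s) (hs1 : s ≤ 1)
    {x y : ℝ} (hx : (x : S1) ∈ Θ) (hy : (y : S1) ∈ Θ) :
    x + displ k ℓ s c μ x < y + displ k ℓ s c μ y + Real.pi ↔ x < y + Real.pi := by
  have h1 := h.add_displ_sub (μ := μ) s c hx hy
  have hpi := Real.pi_pos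
  have hk : (0 : ℝ) < 2 * k + 1 := by positivity
  have hdiv : 2 * Real.pi / (2 * k + 1) * (ℓ x - ℓ y) - Real.pi =
      Real.pi / (2 * k + 1) * (2 * (ℓ x - ℓ y) - (2 * k + 1)) := by
    field_simp
  have hpk : 0 < Real.pi / (2 * k + 1) := by positivity
  constructor
  · intro hlt
    by_contra hge
    have h2 : ¬ ℓ x ≤ ℓ y + k := fun hle => hge ((h.lt_iff x y hx hy).2 hle)
    have h3 : (ℓ y : ℝ) + k + 1 ≤ ℓ x := by exact_mod_cast not_le.1 h2
    have h4 : 0 ≤ Real.pi / (2 * k + 1) * (2 * (ℓ x - ℓ y) - (2 * k + 1)) :=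
      mul_nonneg hpk.le (by linarith)
    rw [← hdiv] at h4
    have h5 : 0 ≤ (1 - s) * (x - y - Real.pi) := mul_nonneg (by linarith) (by linarith)
    have h6 := mul_nonneg hs0 h4
    nlinarith
  · intro hlt
    have h2 := (h.lt_iff x y hx hy).1 hlt
    have h3 : (ℓ x : ℝ) ≤ ℓ y + k := by exact_mod_cast h2
    have h4 : Real.pi / (2 * k + 1) * (2 * (ℓ x - ℓ y) - (2 * k + 1)) < 0 :=
      mul_neg_of_pos_of_neg hpk (by linarith)
    rw [← hdiv] at h4
    rcases eq_or_lt_of_le hs0 with rfl | hs0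
    · linarith
    · have h5 : (1 - s) * (x - y - Real.pi) ≤ 0 :=
        mul_nonpos_of_nonneg_of_nonpos (by linarith) (by linarith)
      have h6 := mul_neg_of_pos_of_neg hs0 h4
      nlinarith

end IsLabelling

namespace IsFullLabelling

variable {k : ℕ} {ℓ : ℝ → ℤ} {r : ℝ} {μ : FinProb S1}

/-- Each of the `2k+1` arcs contributes `1` to the integral. -/
theorem integral_inv_arcMass (h : IsFullLabelling (μ.supp : Set S1) k ℓ) :
    (μ.integral fun p => (arcMass k ℓ μ p)⁻¹) = 2 * k + 1 := by
  classical
  rw [FinProb.integral, ← Finset.sum_fiberwise μ.supp (resid k ℓ)]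
  have : ∀ j : ZMod (2 * k + 1), ∑ p ∈ μ.supp with resid k ℓ p = j,
      μ.mass p * (arcMass k ℓ μ p)⁻¹ = 1 := by
    intro j
    obtain ⟨i, rfl⟩ := ZMod.intCast_surjective j
    obtain ⟨x, hx, hl⟩ := h.surj i
    have hxr : resid k ℓ (x : S1) = (i : ZMod (2 * k + 1)) := by
      obtain ⟨c, hc⟩ := coe_eq_coe_iff.1 (coe_coord 0 (x : S1)).symm
      rw [resid, ← hc, h.add_int_mul hx, hl, ZMod.intCast_eq_intCast_iff_dvd_sub]
      exact ⟨-c, by push_cast; ring⟩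
    rw [← hxr]
    have h1 : ∀ p ∈ μ.supp.filter fun p => resid k ℓ p = resid k ℓ (x : S1),
        μ.mass p * (arcMass k ℓ μ p)⁻¹ = μ.mass p * (arcMass k ℓ μ x)⁻¹ := by
      intro p hp
      rw [arcMass, arcMass, (Finset.mem_filter.1 hp).2]
    rw [Finset.sum_congr rfl h1, ← Finset.sum_mul]
    have h2 : ∑ p ∈ μ.supp with resid k ℓ p = resid k ℓ (x : S1), μ.mass p = arcMass k ℓ μ x := by
      rw [arcMass, FinProb.integral, Finset.sum_filter]
      exact Finset.sum_congr rfl fun p _ => by split_ifs <;> simp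
    rw [h2]
    exact mul_inv_cancel₀ (arcMass_pos hx).ne'
  rw [Finset.sum_congr rfl fun j _ => this j]
  simp [ZMod.card]

theorem integral_arcWeight (h : IsFullLabelling (μ.supp : Set S1) k ℓ) {c : ℝ}
    (hc1 : (2 * k + 1) * c < 1) : μ.integral (arcWeight k ℓ c μ) = 1 := by
  have : μ.integral (arcWeight k ℓ c μ) =
      (1 - (2 * k + 1) * c)⁻¹ * (1 - c * μ.integral fun p => (arcMass k ℓ μ p)⁻¹) := by
    conv_rhs => rw [← μ.integral_const 1, ← FinProb.integral_const_mul, ← FinProb.integral_sub,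
      ← FinProb.integral_const_mul]
    refine FinProb.integral_congr fun p _ => ?_
    rw [arcWeight, FinProb.integral_const, div_eq_inv_mul, div_eq_mul_inv]
  rw [this, h.integral_inv_arcMass, mul_comm c]
  exact inv_mul_cancel₀ (by linarith)

theorem integral_thinned (h : IsFullLabelling (μ.supp : Set S1) k ℓ) {c : ℝ}
    (hc : ∀ p ∈ μ.supp, c ≤ arcMass k ℓ μ p) (hc1 : (2 * k + 1) * c < 1) (f : S1 → ℝ) :
    (thinned k ℓ c μ).integral f = μ.integral fun p => arcWeight k ℓ c μ p * f p :=
  FinProb.integral_reweight (fun _ hp => arcWeight_nonneg hc hc1 hp) (h.integral_arcWeight hc1) f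

theorem integral_flow (h : IsFullLabelling (μ.supp : Set S1) k ℓ) {c : ℝ} (s : ℝ)
    (hc : ∀ p ∈ μ.supp, c ≤ arcMass k ℓ μ p) (hc1 : (2 * k + 1) * c < 1) (f : S1 → ℝ) :
    (flow k ℓ s c μ).integral f =
      μ.integral fun p => arcWeight k ℓ c μ p * f (p + (displ k ℓ s c μ p : S1)) := by
  rw [flow, FinProb.integral_map, h.integral_thinned hc hc1]

theorem abs_offset_sub_le (h : IsFullLabelling (μ.supp : Set S1) k ℓ) {p q : S1} (hp : p ∈ μ.supp)
    (hq : q ∈ μ.supp) : |offset k ℓ p - offset k ℓ q| ≤ 2 * Real.pi := by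
  obtain ⟨y, rfl⟩ : ∃ y : ℝ, (y : S1) = q := QuotientAddGroup.mk_surjective q
  obtain ⟨x, rfl, hx⟩ := exists_lift_abs_eq_dist p y
  have hxy := hx.trans_le (dist_le_pi _ _)
  rw [h.offset_eq hp, h.offset_eq hq]
  have hpi := Real.pi_pos
  have hk : (0 : ℝ) < 2 * k + 1 := by positivity
  have h7 : |2 * Real.pi / (2 * k + 1) * ((ℓ x : ℝ) - ℓ y)| ≤ Real.pi := by
    rw [abs_mul, abs_of_pos (by positivity), div_mul_eq_mul_div, div_le_iff₀ hk]
    have := h.abs_label_sub_le hp hq hxy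
    nlinarith
  calc _ = |(x - y) - 2 * Real.pi / (2 * k + 1) * ((ℓ x : ℝ) - ℓ y)| := by congr 1; ring
    _ ≤ _ := (abs_sub _ _).trans (by linarith)

theorem abs_centred_le (h : IsFullLabelling (μ.supp : Set S1) k ℓ) {p : S1} (hp : p ∈ μ.supp) :
    |centred k ℓ μ p| ≤ 2 * Real.pi := by
  have : centred k ℓ μ p = μ.integral fun q => offset k ℓ p - offset k ℓ q := by
    rw [FinProb.integral_sub, FinProb.integral_const]; rfl
  rw [this]
  refine (FinProb.abs_integral_le _ _).trans ?_
  rw [← μ.integral_const (2 * Real.pi)]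
  refine FinProb.integral_le_integral fun q hq => ?_
  exact h.abs_offset_sub_le hp hq

/-- The flow stays in the thickening. -/
theorem dist_le_of_mem_flow (h : IsFullLabelling (μ.supp : Set S1) k ℓ)
    (hΘ : ∀ p ∈ μ.supp, ∀ q ∈ μ.supp, dist p q ≤ r) {s : ℝ} (c : ℝ) (hs0 : 0 ≤ s) (hs1 : s ≤ 1) :
    ∀ p ∈ (flow k ℓ s c μ).supp, ∀ q ∈ (flow k ℓ s c μ).supp, dist p q ≤ r := by
  intro p' hp' q' hq'
  obtain ⟨p, hp, rfl⟩ := FinProb.mem_supp_map.1 hp'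
  obtain ⟨q, hq, rfl⟩ := FinProb.mem_supp_map.1 hq'
  replace hp := FinProb.supp_reweight_subset _ _ hp
  replace hq := FinProb.supp_reweight_subset _ _ hq
  obtain ⟨y, rfl⟩ : ∃ y : ℝ, (y : S1) = q := QuotientAddGroup.mk_surjective q
  obtain ⟨x, rfl, hx⟩ := exists_lift_abs_eq_dist p y
  have hxy := abs_le.1 (hx.trans_le (hΘ _ hp _ hq))
  rw [← AddCircle.coe_add, ← AddCircle.coe_add]
  refine (dist_coe_le _ _).trans ?_
  rw [h.add_displ_sub s c hp hq]
  have hpi := Real.pi_pos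
  have hk : (0 : ℝ) < 2 * k + 1 := by positivity
  have hrk := h.two_pi_mul_le (fun p hp q hq => hΘ p hp q hq)
  have h7 : |2 * Real.pi / (2 * k + 1) * ((ℓ x : ℝ) - ℓ y)| ≤ r := by
    rw [abs_mul, abs_of_pos (by positivity), div_mul_eq_mul_div, div_le_iff₀ hk]
    have := h.abs_label_sub_le hp hq (hx.trans_le (dist_le_pi _ _))
    nlinarith [Real.pi_pos]
  have h8 : |(1 - s) * (x - y)| ≤ (1 - s) * r := by
    rw [abs_mul, abs_of_nonneg (by linarith : (0 : ℝ) ≤ 1 - s)]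
    exact mul_le_mul_of_nonneg_left (abs_le.2 hxy) (by linarith)
  have h9 : |s * (2 * Real.pi / (2 * k + 1) * ((ℓ x : ℝ) - ℓ y))| ≤ s * r := by
    rw [abs_mul, abs_of_nonneg hs0]
    exact mul_le_mul_of_nonneg_left h7 hs0
  refine (abs_add_le _ _).trans ?_
  linarith

/-- The flow moves a measure by an amount controlled by the parameters. -/
theorem dist_flow_le (h : IsFullLabelling (μ.supp : Set S1) k ℓ) {s c : ℝ} (hs0 : 0 ≤ s)
    (hs1 : s ≤ 1) (hc0 : 0 ≤ c) (hc : ∀ p ∈ μ.supp, c ≤ arcMass k ℓ μ p)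
    (hc1 : (2 * k + 1) * c ≤ 1 / 2) :
    dist μ (flow k ℓ s c μ) ≤ 2 * Real.pi * s + 12 * Real.pi * ((2 * k + 1) * c) := by
  have hpi := Real.pi_pos
  set n : ℝ := 2 * k + 1 with hn
  have hn0 : 0 < n := by positivity
  have hlt : n * c < 1 := by linarith
  have hW : (μ.integral fun p => |1 - arcWeight k ℓ c μ p|) ≤ 4 * (n * c) := by
    have h1 : ∀ p ∈ μ.supp,
        |1 - arcWeight k ℓ c μ p| ≤ 2 * (n * c) + 2 * c * (arcMass k ℓ μ p)⁻¹ := by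
      intro p hp
      have h2 : 1 - arcWeight k ℓ c μ p = (c * (arcMass k ℓ μ p)⁻¹ - n * c) / (1 - n * c) := by
        rw [arcWeight, ← hn, eq_div_iff (by linarith), sub_mul, div_mul_cancel₀ _ (by linarith),
          div_eq_mul_inv]
        ring
      have h3 : 0 ≤ c * (arcMass k ℓ μ p)⁻¹ := mul_nonneg hc0 (inv_nonneg.2 (arcMass_pos hp).le)
      have h4 : 0 ≤ n * c := mul_nonneg hn0.le hc0
      rw [h2, abs_div, abs_of_pos (by linarith : 0 < 1 - n * c), div_le_iff₀ (by linarith)]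
      have h5 : |c * (arcMass k ℓ μ p)⁻¹ - n * c| ≤ c * (arcMass k ℓ μ p)⁻¹ + n * c :=
        abs_le.2 ⟨by linarith, by linarith⟩
      nlinarith
    refine (FinProb.integral_le_integral h1).trans_eq ?_
    rw [FinProb.integral_add, FinProb.integral_const, FinProb.integral_const_mul,
      h.integral_inv_arcMass]
    ring
  have hM : |(thinned k ℓ c μ).integral (centred k ℓ μ)| ≤ 2 * Real.pi * (4 * (n * c)) := by
    have h1 : (thinned k ℓ c μ).integral (centred k ℓ μ) =
        μ.integral fun p => (arcWeight k ℓ c μ p - 1) * centred k ℓ μ p := by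
      have h2 := integral_centred k ℓ μ
      have h3 : (μ.integral fun p => (arcWeight k ℓ c μ p - 1) * centred k ℓ μ p) =
          (μ.integral fun p => arcWeight k ℓ c μ p * centred k ℓ μ p) -
            μ.integral (centred k ℓ μ) := by
        rw [← FinProb.integral_sub]
        exact FinProb.integral_congr fun p _ => by ring
      rw [h3, h2, sub_zero, h.integral_thinned hc hlt]
    rw [h1]
    refine (FinProb.abs_integral_le _ _).trans ?_
    refine le_trans ?_ (mul_le_mul_of_nonneg_left hW (by positivity))
    rw [← FinProb.integral_const_mul]
    refine FinProb.integral_le_integral fun p hp => ?_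
    rw [abs_mul, abs_sub_comm, mul_comm]
    exact mul_le_mul_of_nonneg_right (h.abs_centred_le hp) (abs_nonneg _)
  refine (FinProb.dist_le_of_common_push dist_le_pi μ (w := fun _ => 1)
    (w' := arcWeight k ℓ c μ) (f := fun p => p) (g := fun p => p + (displ k ℓ s c μ p : S1))
    (fun _ _ => zero_le_one) (fun p hp => arcWeight_nonneg hc hlt hp)
    (fun F => by simp only [one_mul]) (h.integral_flow s hc hlt)).trans ?_
  have hd : ∀ p ∈ μ.supp, dist p (p + (displ k ℓ s c μ p : S1)) ≤
      2 * Real.pi * s + 2 * Real.pi * (4 * (n * c)) := by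
    intro p hp
    have h1 : dist p (p + (displ k ℓ s c μ p : S1)) ≤ |displ k ℓ s c μ p| := by
      rw [dist_comm, dist_eq_norm, add_sub_cancel_left]
      exact QuotientAddGroup.norm_mk_le_norm
    refine h1.trans ?_
    rw [displ]
    refine (abs_sub _ _).trans (add_le_add ?_ ?_)
    · rw [abs_mul, abs_neg, abs_of_nonneg hs0, mul_comm]
      exact mul_le_mul_of_nonneg_right (h.abs_centred_le hp) hs0
    · rw [abs_mul, abs_of_nonneg (by linarith : (0 : ℝ) ≤ 1 - s)]
      exact (mul_le_of_le_one_left (abs_nonneg _) (by linarith)).trans hM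
  have h2 : (μ.integral fun p => 1 * dist p (p + (displ k ℓ s c μ p : S1)) +
      Real.pi * |1 - arcWeight k ℓ c μ p|) ≤
      μ.integral fun p => (2 * Real.pi * s + 2 * Real.pi * (4 * (n * c))) +
        Real.pi * |1 - arcWeight k ℓ c μ p| :=
    FinProb.integral_le_integral fun p hp => by
      rw [one_mul]
      exact add_le_add_left (hd p hp) _
  refine h2.trans ?_
  rw [FinProb.integral_add, FinProb.integral_const, FinProb.integral_const_mul]
  have := mul_le_mul_of_nonneg_left hW hpi.le
  linarith

theorem isLabelling_thinned (h : IsFullLabelling (μ.supp : Set S1) k ℓ) (c : ℝ) :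
    IsLabelling ((thinned k ℓ c μ).supp : Set S1) k ℓ :=
  h.toIsLabelling.mono (by exact_mod_cast FinProb.supp_reweight_subset _ _)

/-- If the removed mass is that of some arc, then this arc disappears. -/
theorem exists_missing (h : IsFullLabelling (μ.supp : Set S1) k ℓ) {c : ℝ}
    (hc : ∀ p ∈ μ.supp, c ≤ arcMass k ℓ μ p) (hc1 : (2 * k + 1) * c < 1) {p : S1}
    (hp : p ∈ μ.supp) (hpc : arcMass k ℓ μ p = c) :
    ∃ i, ∀ x : ℝ, (x : S1) ∈ ((thinned k ℓ c μ).supp : Set S1) → ℓ x ≠ i := by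
  obtain ⟨y, rfl⟩ : ∃ y : ℝ, (y : S1) = p := QuotientAddGroup.mk_surjective p
  refine ⟨ℓ y, fun x hx hl => ?_⟩
  have hx' : (x : S1) ∈ (thinned k ℓ c μ).supp := hx
  rw [thinned, FinProb.mem_supp_reweight (fun _ hp => arcWeight_nonneg hc hc1 hp)
    (h.integral_arcWeight hc1)] at hx'
  have h1 : resid k ℓ (x : S1) = resid k ℓ (y : S1) :=
    (h.resid_eq_iff hx'.1 hp).2 (by rw [hl, sub_self]; exact dvd_zero _)
  refine hx'.2 ?_
  have h2 : arcMass k ℓ μ (x : S1) = c := by rw [arcMass, h1]; exact hpc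
  rw [arcWeight, h2, div_self (by rw [← hpc]; exact (arcMass_pos hp).ne'), sub_self, zero_div]

/-- A motion that carries no point across an antipode transports a full labelling. -/
theorem exists_map (h : IsFullLabelling (μ.supp : Set S1) k ℓ) {d : S1 → ℝ}
    (hd : ∀ x y : ℝ, (x : S1) ∈ μ.supp → (y : S1) ∈ μ.supp →
      (x + d x < y + d y + Real.pi ↔ x < y + Real.pi)) :
    ∃ ℓ', IsFullLabelling ((μ.map fun p => p + (d p : S1)).supp : Set S1) k ℓ' ∧
      ∀ x : ℝ, (x : S1) ∈ μ.supp → ℓ' (x + d x) = ℓ x := by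
  classical
  set ν := μ.map fun p => p + (d p : S1) with hν
  have hex : ∀ z : ℝ, ∃ x : ℝ, (z : S1) ∈ ν.supp → (x : S1) ∈ μ.supp ∧ x + d x = z := by
    intro z
    by_cases hz : (z : S1) ∈ ν.supp
    · obtain ⟨p, hp, hpz⟩ := FinProb.mem_supp_map.1 hz
      obtain ⟨y, rfl⟩ : ∃ y : ℝ, (y : S1) = p := QuotientAddGroup.mk_surjective p
      rw [← AddCircle.coe_add] at hpz
      obtain ⟨j, hj⟩ := coe_eq_coe_iff.1 hpz
      refine ⟨y + j * (2 * Real.pi), fun _ => ⟨by rwa [coe_add_int_mul], ?_⟩⟩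
      rw [coe_add_int_mul, ← hj]
      ring
    · exact ⟨0, fun hz' => absurd hz' hz⟩
  choose g hg using hex
  have hlt : ∀ x y : ℝ, (x : S1) ∈ μ.supp → (y : S1) ∈ μ.supp → ℓ x < ℓ y → x + d x < y + d y := by
    intro x y hx hy hxy
    obtain ⟨z, hz, h1, h2⟩ := (h.lt_iff_between hx hy).1 hxy
    have h3 := (hd x z hx hz).2 h1
    have h4 := (not_congr (hd y z hy hz)).2 (not_lt.2 h2.le)
    linarith
  have huniq : ∀ x y : ℝ, (x : S1) ∈ μ.supp → (y : S1) ∈ μ.supp → x + d x = y + d y →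
      ℓ x = ℓ y := by
    intro x y hx hy hxy
    rcases lt_trichotomy (ℓ x) (ℓ y) with h1 | h1 | h1
    · exact absurd hxy (hlt x y hx hy h1).ne
    · exact h1
    · exact absurd hxy (hlt y x hy hx h1).ne'
  have hsupp : ∀ x : ℝ, (x : S1) ∈ μ.supp → ((x + d x : ℝ) : S1) ∈ ν.supp := fun x hx =>
    FinProb.mem_supp_map.2 ⟨x, hx, by rw [← AddCircle.coe_add]⟩
  have hgl : ∀ x : ℝ, (x : S1) ∈ μ.supp → ℓ (g (x + d x)) = ℓ x := fun x hx =>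
    huniq _ _ (hg _ (hsupp x hx)).1 hx (hg _ (hsupp x hx)).2
  refine ⟨fun z => ℓ (g z), ⟨⟨fun z hz => ?_, fun z z' hz hz' => ?_⟩, fun i => ?_⟩, hgl⟩
  · obtain ⟨h1, h2⟩ := hg z hz
    have h3 : z + 2 * Real.pi = (g z + 2 * Real.pi) + d ((g z + 2 * Real.pi : ℝ) : S1) := by
      rw [AddCircle.coe_add_period]
      linarith
    rw [h3, hgl _ (by rwa [AddCircle.coe_add_period]), h.add_period _ h1]
  · obtain ⟨h1, h2⟩ := hg z hz
    obtain ⟨h3, h4⟩ := hg z' hz'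
    rw [← h.lt_iff _ _ h1 h3, ← hd _ _ h1 h3, h2, h4]
  · obtain ⟨x, hx, rfl⟩ := h.surj i
    exact ⟨x + d x, hsupp x hx, hgl x hx⟩

/-- The polygon to which a moved measure is collapsed. It depends on the displacement `d` only
through its mean. -/
theorem Ftilde_map (h : IsFullLabelling (μ.supp : Set S1) k ℓ) {d : S1 → ℝ}
    (hd : ∀ x y : ℝ, (x : S1) ∈ μ.supp → (y : S1) ∈ μ.supp →
      (x + d x < y + d y + Real.pi ↔ x < y + Real.pi)) (hr : r < Real.pi)
    (hΘ : ∀ p ∈ (μ.map fun p => p + (d p : S1)).supp,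
      ∀ q ∈ (μ.map fun p => p + (d p : S1)).supp, dist p q ≤ r) :
    Ftilde r k (μ.map fun p => p + (d p : S1)) 1 = μ.map fun p =>
      p + ((μ.integral (offset k ℓ) + μ.integral d - offset k ℓ p : ℝ) : S1) := by
  obtain ⟨ℓ', h', hl⟩ := h.exists_map hd
  have hoff : ∀ p ∈ μ.supp, offset k ℓ' (p + (d p : S1)) = offset k ℓ p + d p := by
    intro p hp
    obtain ⟨x, rfl⟩ : ∃ y : ℝ, (y : S1) = p := QuotientAddGroup.mk_surjective p
    have h1 : ((x + d x : ℝ) : S1) ∈ ((μ.map fun p => p + (d p : S1)).supp : Set S1) :=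
      FinProb.mem_supp_map.2 ⟨x, hp, by rw [← AddCircle.coe_add]⟩
    have h2 := h'.offset_eq h1
    rw [hl x hp] at h2
    rw [← AddCircle.coe_add, h2, h.offset_eq hp]
    ring
  rw [h'.Ftilde_eq hr hΘ, FinProb.map_map, FinProb.integral_map,
    FinProb.integral_congr hoff, FinProb.integral_add]
  refine FinProb.map_congr fun p hp => ?_
  rw [hoff p hp, add_assoc, ← AddCircle.coe_add]
  congr 2
  simp only [Set.Icc.coe_one]
  ring

end IsFullLabelling

variable {r : ℝ}

/-! ### The strata of the thickening and the equivalence relation -/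

namespace VRm

theorem dist_le (μ : VRm S1 r) : ∀ p ∈ μ.1.supp, ∀ q ∈ μ.1.supp, dist p q ≤ r := fun _ hp _ hq =>
  (Metric.dist_le_diam_of_mem μ.1.supp.finite_toSet.isBounded hp hq).trans μ.2

theorem exists_isFullLabelling (hr : r < Real.pi) (μ : VRm S1 r) :
    ∃ k ℓ, IsFullLabelling (μ.1.supp : Set S1) k ℓ := by
  obtain ⟨k, ℓ, h⟩ := IsLabelling.exists_of_dist_le (Θ := (μ.1.supp : Set S1)) hr
    fun p hp q hq => μ.dist_le p hp q hq
  obtain ⟨k', -, ℓ', h'⟩ := h.exists_full (Finset.coe_nonempty.2 μ.1.supp_nonempty)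
  exact ⟨k', ℓ', h'⟩

end VRm

/-- The number `k` such that the support of `μ` has a full labelling of order `k`. -/
def idx (μ : VRm S1 r) : ℕ :=
  Classical.epsilon fun k => ∃ ℓ, IsFullLabelling (μ.1.supp : Set S1) k ℓ

/-- A full labelling of the support of `μ`. -/
def lab (μ : VRm S1 r) : ℝ → ℤ :=
  Classical.epsilon fun ℓ => IsFullLabelling (μ.1.supp : Set S1) (idx μ) ℓ

theorem isFull (hr : r < Real.pi) (μ : VRm S1 r) :
    IsFullLabelling (μ.1.supp : Set S1) (idx μ) (lab μ) :=
  Classical.epsilon_spec (Classical.epsilon_spec (μ.exists_isFullLabelling hr))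

theorem IsFullLabelling.idx_eq (hr : r < Real.pi) {μ : VRm S1 r} {k : ℕ} {ℓ : ℝ → ℤ}
    (h : IsFullLabelling (μ.1.supp : Set S1) k ℓ) : idx μ = k :=
  (h.unique (isFull hr μ)).1

theorem mem_V_iff (hr : r < Real.pi) {μ : VRm S1 r} {k : ℕ} : μ ∈ V r k ↔ idx μ = k := by
  have h := (isFull hr μ).encard_arcs μ.1.supp.finite_toSet hr fun p hp q hq => μ.dist_le p hp q hq
  rw [V, Set.mem_ofPred_eq, h]
  constructor
  · intro he
    have : ((2 * idx μ + 1 : ℕ) : ℕ∞) = ((2 * k + 1 : ℕ) : ℕ∞) := by exact_mod_cast he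
    have := Nat.cast_injective this
    omega
  · rintro rfl
    rfl

theorem rel_iff (hr : r < Real.pi) {μ ν : VRm S1 r} :
    Rel r μ ν ↔ idx ν = idx μ ∧ Ftilde r (idx μ) μ.1 1 = Ftilde r (idx μ) ν.1 1 := by
  simp only [Rel, mem_V_iff hr]
  constructor
  · rintro ⟨k, rfl, h2, h3⟩
    exact ⟨h2, h3⟩
  · rintro ⟨h2, h3⟩
    exact ⟨idx μ, rfl, h2, h3⟩

theorem rel_equivalence (hr : r < Real.pi) : Equivalence (Rel r) where
  refl μ := (rel_iff hr).2 ⟨rfl, rfl⟩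
  symm := by
    rintro μ ν ⟨k, h1, h2, h3⟩
    exact ⟨k, h2, h1, h3.symm⟩
  trans := by
    intro μ ν ρ h h'
    rw [rel_iff hr] at h h' ⊢
    rw [h.1] at h'
    exact ⟨h'.1, h.2.trans h'.2⟩

/-- There are only finitely many strata, since `2πk ≤ (2k+1)r`. -/
theorem exists_idx_lt (hr₀ : 0 ≤ r) (hr : r < Real.pi) : ∃ K : ℕ, ∀ μ : VRm S1 r, idx μ < K := by
  obtain ⟨K, hK⟩ := exists_nat_gt (r / (Real.pi - r))
  refine ⟨K, fun μ => ?_⟩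
  have h := (isFull hr μ).two_pi_mul_le fun p hp q hq => μ.dist_le p hp q hq
  have hpr : 0 < Real.pi - r := sub_pos.2 hr
  have h2 : (idx μ : ℝ) ≤ r / (Real.pi - r) := by
    rw [le_div_iff₀ hpr]
    nlinarith
  exact_mod_cast h2.trans_lt hK

/-- The smallest mass of an arc of `μ`. -/
def minMass (μ : VRm S1 r) : ℝ :=
  μ.1.supp.inf' μ.1.supp_nonempty (arcMass (idx μ) (lab μ) μ.1)

theorem minMass_le {μ : VRm S1 r} {p : S1} (hp : p ∈ μ.1.supp) :
    minMass μ ≤ arcMass (idx μ) (lab μ) μ.1 p := Finset.inf'_le _ hp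

theorem exists_arcMass_eq_minMass (μ : VRm S1 r) :
    ∃ p ∈ μ.1.supp, arcMass (idx μ) (lab μ) μ.1 p = minMass μ := by
  obtain ⟨p, hp, h⟩ := Finset.exists_mem_eq_inf' μ.1.supp_nonempty (arcMass (idx μ) (lab μ) μ.1)
  exact ⟨p, hp, h.symm⟩

theorem minMass_pos (μ : VRm S1 r) : 0 < minMass μ := by
  obtain ⟨p, hp, h⟩ := exists_arcMass_eq_minMass μ
  rw [← h]
  exact arcMass_pos hp

/-- The polygon of a measure has the masses of its arcs. -/
theorem mass_Ftilde_one (hr : r < Real.pi) (μ : VRm S1 r) {p : S1} (hp : p ∈ μ.1.supp) :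
    (Ftilde r (idx μ) μ.1 1).mass (p + ((-centred (idx μ) (lab μ) μ.1 p : ℝ) : S1)) =
      arcMass (idx μ) (lab μ) μ.1 p := by
  classical
  have h := isFull hr μ
  rw [h.Ftilde_eq hr μ.dist_le, ← FinProb.integral_ite, FinProb.integral_map, arcMass]
  refine FinProb.integral_congr fun q hq => ?_
  obtain ⟨x, rfl⟩ : ∃ y : ℝ, (y : S1) = p := QuotientAddGroup.mk_surjective p
  obtain ⟨y, rfl⟩ : ∃ y : ℝ, (y : S1) = q := QuotientAddGroup.mk_surjective q
  have hk : (0 : ℝ) < 2 * idx μ + 1 := by positivity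
  have hpi := Real.pi_pos
  congr 1
  rw [h.resid_eq_iff hq hp, ← AddCircle.coe_add, ← AddCircle.coe_add, coe_eq_coe_iff, eq_iff_iff]
  rw [centred, h.offset_eq hp, h.offset_eq hq]
  simp only [Set.Icc.coe_one]
  have key : ∀ j : ℤ, (y + -1 * (y - 2 * Real.pi / (2 * idx μ + 1) * lab μ y -
        μ.1.integral (offset (idx μ) (lab μ))) + j * (2 * Real.pi) =
      x + -(x - 2 * Real.pi / (2 * idx μ + 1) * lab μ x - μ.1.integral (offset (idx μ) (lab μ)))) ↔
      lab μ x - lab μ y = ((2 * idx μ + 1 : ℕ) : ℤ) * j := by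
    intro j
    have h1 : (lab μ x - lab μ y = ((2 * idx μ + 1 : ℕ) : ℤ) * j) ↔
        (lab μ x : ℝ) - lab μ y = (2 * idx μ + 1) * j := by
      constructor
      · intro h; exact_mod_cast congrArg (Int.cast : ℤ → ℝ) h
      · intro h; exact_mod_cast h
    rw [h1]
    have h2 : 2 * Real.pi / (2 * (idx μ : ℝ) + 1) * (2 * idx μ + 1) = 2 * Real.pi :=
      div_mul_cancel₀ _ hk.ne'
    constructor
    · intro h
      refine mul_left_cancel₀ (a := 2 * Real.pi / (2 * (idx μ : ℝ) + 1)) (by positivity) ?_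
      rw [← mul_assoc, h2]
      linarith
    · intro h
      have h3 := congrArg (fun z => 2 * Real.pi / (2 * (idx μ : ℝ) + 1) * z) h
      simp only [← mul_assoc, h2] at h3
      linarith
  constructor
  · rintro ⟨j, hj⟩
    exact ⟨j, (key j).1 hj⟩
  · rintro ⟨j, hj⟩
    exact ⟨j, (key j).2 hj⟩

theorem mem_supp_Ftilde_one (hr : r < Real.pi) (μ : VRm S1 r) {z : S1} :
    z ∈ (Ftilde r (idx μ) μ.1 1).supp ↔
      ∃ p ∈ μ.1.supp, p + ((-centred (idx μ) (lab μ) μ.1 p : ℝ) : S1) = z := by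
  rw [(isFull hr μ).Ftilde_eq hr μ.dist_le, FinProb.mem_supp_map]
  simp only [Set.Icc.coe_one, neg_one_mul, centred]

theorem minMass_eq_of_rel (hr : r < Real.pi) {μ ν : VRm S1 r} (h : Rel r μ ν) :
    minMass μ = minMass ν := by
  have key : ∀ μ ν : VRm S1 r, Rel r μ ν → minMass ν ≤ minMass μ := by
    intro μ ν h
    rw [rel_iff hr] at h
    obtain ⟨p, hp, hmin⟩ := exists_arcMass_eq_minMass μ
    rw [← hmin, ← mass_Ftilde_one hr μ hp, h.2, ← h.1]
    have h1 := (mem_supp_Ftilde_one hr μ).2 ⟨p, hp, rfl⟩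
    rw [h.2, ← h.1] at h1
    obtain ⟨q, hq, hqz⟩ := (mem_supp_Ftilde_one hr ν).1 h1
    rw [h.1] at hqz ⊢
    rw [← hqz, ← h.1, mass_Ftilde_one hr ν hq]
    exact minMass_le hq
  exact le_antisymm (key ν μ ((rel_equivalence hr).symm h)) (key μ ν h)

/-! ### The flow on the thickening -/

open Classical in
/-- The flow as a map of the thickening, for the chosen labellings. -/
def flowVR (s c : ℝ) (μ : VRm S1 r) : VRm S1 r :=
  if h : Metric.diam ((flow (idx μ) (lab μ) s c μ.1).supp : Set S1) ≤ r then ⟨_, h⟩ else μ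

theorem val_flowVR (hr₀ : 0 ≤ r) (hr : r < Real.pi) {s : ℝ} (c : ℝ) (hs0 : 0 ≤ s) (hs1 : s ≤ 1)
    (μ : VRm S1 r) : (flowVR s c μ).1 = flow (idx μ) (lab μ) s c μ.1 := by
  have : Metric.diam ((flow (idx μ) (lab μ) s c μ.1).supp : Set S1) ≤ r :=
    Metric.diam_le_of_forall_dist_le hr₀ fun p hp q hq =>
      (isFull hr μ).dist_le_of_mem_flow μ.dist_le c hs0 hs1 p hp q hq
  rw [flowVR, dif_pos this]

theorem flowVR_zero (hr₀ : 0 ≤ r) (hr : r < Real.pi) (μ : VRm S1 r) : flowVR 0 0 μ = μ := by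
  have h := isFull hr μ
  refine Subtype.ext ?_
  rw [val_flowVR hr₀ hr 0 le_rfl zero_le_one]
  have hw : arcWeight (idx μ) (lab μ) 0 μ.1 = fun _ => 1 := by
    funext p
    simp [arcWeight]
  have ht : thinned (idx μ) (lab μ) 0 μ.1 = μ.1 := by
    refine FinProb.ext_integral fun f => ?_
    rw [h.integral_thinned (fun p hp => (arcMass_pos hp).le) (by norm_num), hw]
    simp
  rw [flow, ht]
  refine FinProb.map_id_of_eq fun p _ => ?_
  rw [displ, ht, integral_centred]
  simp

/-- The flow has the number of arcs of the thinned measure. -/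
theorem idx_flowVR (hr₀ : 0 ≤ r) (hr : r < Real.pi) {s : ℝ} (c : ℝ) (hs0 : 0 ≤ s) (hs1 : s ≤ 1)
    (μ : VRm S1 r) {k : ℕ} {ℓ : ℝ → ℤ}
    (h : IsFullLabelling ((thinned (idx μ) (lab μ) c μ.1).supp : Set S1) k ℓ) :
    idx (flowVR s c μ) = k := by
  have hL := (isFull hr μ).isLabelling_thinned c
  obtain ⟨ℓ', h', -⟩ := h.exists_map (d := displ (idx μ) (lab μ) s c μ.1) fun x y hx hy =>
    (isFull hr μ).add_displ_lt_iff c hs0 hs1 (FinProb.supp_reweight_subset _ _ hx)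
      (FinProb.supp_reweight_subset _ _ hy)
  refine IsFullLabelling.idx_eq (ℓ := ℓ') hr ?_
  rw [val_flowVR hr₀ hr c hs0 hs1]
  exact h'

theorem exists_isFullLabelling_thinned (hr : r < Real.pi) (c : ℝ) (μ : VRm S1 r) :
    ∃ k ≤ idx μ, ∃ ℓ, IsFullLabelling ((thinned (idx μ) (lab μ) c μ.1).supp : Set S1) k ℓ :=
  ((isFull hr μ).isLabelling_thinned c).exists_full
    (Finset.coe_nonempty.2 (FinProb.supp_nonempty _))

/-- The class of the flow does not depend on how far the points are moved. -/
theorem rel_flowVR (hr₀ : 0 ≤ r) (hr : r < Real.pi) {s s' : ℝ} (c : ℝ) (hs0 : 0 ≤ s) (hs1 : s ≤ 1)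
    (hs0' : 0 ≤ s') (hs1' : s' ≤ 1) (μ : VRm S1 r) : Rel r (flowVR s c μ) (flowVR s' c μ) := by
  obtain ⟨k, -, ℓ, h⟩ := exists_isFullLabelling_thinned hr c μ
  have key : ∀ s : ℝ, 0 ≤ s → s ≤ 1 → idx (flowVR s c μ) = k ∧
      Ftilde r k (flowVR s c μ).1 1 = (thinned (idx μ) (lab μ) c μ.1).map fun p =>
        p + (((thinned (idx μ) (lab μ) c μ.1).integral (offset k ℓ) +
          -(thinned (idx μ) (lab μ) c μ.1).integral (centred (idx μ) (lab μ) μ.1) -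
            offset k ℓ p : ℝ) : S1) := by
    intro s hs0 hs1
    refine ⟨idx_flowVR hr₀ hr c hs0 hs1 μ h, ?_⟩
    rw [← integral_displ (s := s), val_flowVR hr₀ hr c hs0 hs1]
    refine h.Ftilde_map (fun x y hx hy => (isFull hr μ).add_displ_lt_iff c hs0 hs1
      (FinProb.supp_reweight_subset _ _ hx) (FinProb.supp_reweight_subset _ _ hy)) hr ?_
    exact (isFull hr μ).dist_le_of_mem_flow μ.dist_le c hs0 hs1
  rw [rel_iff hr, (key s hs0 hs1).1, (key s' hs0' hs1').1]
  exact ⟨rfl, (key s hs0 hs1).2.trans (key s' hs0' hs1').2.symm⟩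

/-- Moved all the way, the flow depends only on the class. -/
theorem flowVR_one_eq (hr₀ : 0 ≤ r) (hr : r < Real.pi) {μ ν : VRm S1 r} (h : Rel r μ ν) {c : ℝ}
    (hc : c ≤ minMass μ) (hc1 : (2 * idx μ + 1) * c < 1) : flowVR 1 c μ = flowVR 1 c ν := by
  -- the flow is a function of the polygon
  have key : ∀ μ : VRm S1 r, c ≤ minMass μ → (2 * idx μ + 1) * c < 1 → ∀ f : S1 → ℝ,
      (flowVR 1 c μ).1.integral f = (Ftilde r (idx μ) μ.1 1).integral fun z =>
        (1 - c / (Ftilde r (idx μ) μ.1 1).mass z) / (1 - (2 * idx μ + 1) * c) * f z := by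
    intro μ hc hc1 f
    have hF := (isFull hr μ).Ftilde_eq hr μ.dist_le 1
    rw [val_flowVR hr₀ hr c zero_le_one le_rfl,
      (isFull hr μ).integral_flow 1 (fun p hp => hc.trans (minMass_le hp)) hc1]
    have h1 : (Ftilde r (idx μ) μ.1 1) =
        μ.1.map fun p => p + ((-centred (idx μ) (lab μ) μ.1 p : ℝ) : S1) := by
      rw [hF]
      simp only [Set.Icc.coe_one, neg_one_mul, centred]
    have h2 : ∀ g : S1 → ℝ, (Ftilde r (idx μ) μ.1 1).integral g =
        μ.1.integral fun p => g (p + ((-centred (idx μ) (lab μ) μ.1 p : ℝ) : S1)) := by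
      intro g
      rw [h1, FinProb.integral_map]
    rw [h2]
    refine FinProb.integral_congr fun p hp => ?_
    rw [mass_Ftilde_one hr μ hp, arcWeight, displ, sub_self, zero_mul, sub_zero, neg_one_mul]
  have hm := minMass_eq_of_rel hr h
  rw [rel_iff hr] at h
  refine Subtype.ext (FinProb.ext_integral fun f => ?_)
  rw [key μ hc hc1, key ν (hm ▸ hc) (by rw [h.1]; exact hc1), h.1, h.2]

/-- The flow is compatible with the equivalence relation. -/
theorem rel_flowVR_of_rel (hr₀ : 0 ≤ r) (hr : r < Real.pi) {μ ν : VRm S1 r} (h : Rel r μ ν)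
    {s c : ℝ} (hs0 : 0 ≤ s) (hs1 : s ≤ 1) (hc : c ≤ minMass μ) (hc1 : (2 * idx μ + 1) * c < 1) :
    Rel r (flowVR s c μ) (flowVR s c ν) := by
  have h1 := rel_flowVR hr₀ hr c hs0 hs1 zero_le_one le_rfl μ
  have h2 := rel_flowVR hr₀ hr c zero_le_one le_rfl hs0 hs1 ν
  rw [flowVR_one_eq hr₀ hr h hc hc1] at h1
  exact (rel_equivalence hr).trans h1 h2

theorem idx_flowVR_le_idx (hr₀ : 0 ≤ r) (hr : r < Real.pi) {s : ℝ} (c : ℝ) (hs0 : 0 ≤ s)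
    (hs1 : s ≤ 1) (μ : VRm S1 r) : idx (flowVR s c μ) ≤ idx μ := by
  obtain ⟨k, hk, ℓ, h⟩ := exists_isFullLabelling_thinned hr c μ
  rwa [idx_flowVR hr₀ hr c hs0 hs1 μ h]

/-- Removing the mass of the smallest arc from all arcs leads into a lower stratum. -/
theorem idx_flowVR_lt_idx (hr₀ : 0 ≤ r) (hr : r < Real.pi) {s : ℝ} (hs0 : 0 ≤ s) (hs1 : s ≤ 1)
    (μ : VRm S1 r) (hc1 : (2 * idx μ + 1) * minMass μ < 1) :
    idx (flowVR s (minMass μ) μ) < idx μ := by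
  obtain ⟨p, hp, hpm⟩ := exists_arcMass_eq_minMass μ
  obtain ⟨i, hi⟩ := (isFull hr μ).exists_missing (fun p hp => minMass_le hp) hc1 hp hpm
  obtain ⟨k, hk, ℓ, h⟩ := ((isFull hr μ).isLabelling_thinned (minMass μ)).exists_full_lt
    (Finset.coe_nonempty.2 (FinProb.supp_nonempty _)) hi
  rwa [idx_flowVR hr₀ hr _ hs0 hs1 μ h]

theorem dist_flowVR_le (hr₀ : 0 ≤ r) (hr : r < Real.pi) (μ : VRm S1 r) {s c : ℝ} (hs0 : 0 ≤ s)
    (hs1 : s ≤ 1) (hc0 : 0 ≤ c) (hc : c ≤ minMass μ) (hc1 : (2 * idx μ + 1) * c ≤ 1 / 2) :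
    dist μ (flowVR s c μ) ≤ 2 * Real.pi * s + 12 * Real.pi * ((2 * idx μ + 1) * c) := by
  rw [Subtype.dist_eq, val_flowVR hr₀ hr c hs0 hs1]
  exact (isFull hr μ).dist_flow_le hs0 hs1 hc0 (fun p hp => hc.trans (minMass_le hp)) hc1

open Filter Topology

/-! ### Continuity of the labels -/

/-- The measures with exactly `2k+1` arcs. -/
def stratum (r : ℝ) (k : ℕ) : Set (VRm S1 r) := {μ | idx μ = k}

/-- The measures with at most `2k-1` arcs. -/
def lower (r : ℝ) (k : ℕ) : Set (VRm S1 r) := {μ | idx μ < k}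

theorem eventually_supp_near (hr : r < Real.pi) (μ : VRm S1 r) :
    ∀ᶠ ν : VRm S1 r in 𝓝 μ, ∀ p ∈ (μ.1.supp : Set S1), ∃ q ∈ (ν.1.supp : Set S1),
      dist p q < (Real.pi - r) / 4 := by
  have hδ : 0 < (Real.pi - r) / 4 := by linarith
  exact continuous_subtype_val.continuousAt.eventually (FinProb.eventually_exists_near hδ μ.1)

/-- The number of arcs is lower semicontinuous. -/
theorem eventually_idx_le (hr : r < Real.pi) (μ : VRm S1 r) :
    ∀ᶠ ν : VRm S1 r in 𝓝 μ, idx μ ≤ idx ν := by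
  filter_upwards [eventually_supp_near hr μ] with ν hν
  rcases (isFull hr μ).near_cases (fun p hp q hq => μ.dist_le p hp q hq) (isFull hr ν) hν with h | h
  · exact h.1.le
  · exact h.1.ge

/-- Near a measure `μ`, in its stratum, each arc has a point near `μ`, and the labels of such points
agree with those of `μ` up to a constant. -/
theorem eventually_labels (hr : r < Real.pi) (μ : VRm S1 r) :
    ∀ᶠ ν : VRm S1 r in 𝓝 μ, idx ν = idx μ →
      (∀ i, ∃ y : ℝ, (y : S1) ∈ ν.1.supp ∧
        (∃ p ∈ μ.1.supp, dist p (y : S1) < (Real.pi - r) / 4) ∧ lab ν y = i) ∧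
      ∃ c : ℤ, ∀ x y : ℝ, (x : S1) ∈ μ.1.supp → (y : S1) ∈ ν.1.supp →
        |x - y| < (Real.pi - r) / 4 → lab ν y = lab μ x + c := by
  filter_upwards [eventually_supp_near hr μ] with ν hν hidx
  rcases (isFull hr μ).near_cases (fun p hp q hq => μ.dist_le p hp q hq) (isFull hr ν) hν with h | h
  · exact absurd hidx h.1.ne'
  · exact h.2

/-- Differences of offsets, and coincidence of arcs, vary continuously within a stratum. -/
theorem eventually_offset (hr : r < Real.pi) (μ : VRm S1 r) :
    ∀ᶠ ν : VRm S1 r in 𝓝 μ, idx ν = idx μ →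
      ∀ p ∈ μ.1.supp, ∀ p' ∈ μ.1.supp, ∀ q ∈ ν.1.supp, ∀ q' ∈ ν.1.supp,
        dist p q < (Real.pi - r) / 4 → dist p' q' < (Real.pi - r) / 4 →
        |(offset (idx ν) (lab ν) q - offset (idx ν) (lab ν) q') -
          (offset (idx μ) (lab μ) p - offset (idx μ) (lab μ) p')| ≤ dist p q + dist p' q' ∧
        (resid (idx ν) (lab ν) q = resid (idx ν) (lab ν) q' ↔
          resid (idx μ) (lab μ) p = resid (idx μ) (lab μ) p') := by
  filter_upwards [eventually_labels hr μ] with ν hν hidx p hp p' hp' q hq q' hq' hd hd'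
  obtain ⟨-, c, hc⟩ := hν hidx
  obtain ⟨y, rfl⟩ : ∃ y : ℝ, (y : S1) = q := QuotientAddGroup.mk_surjective q
  obtain ⟨y', rfl⟩ : ∃ y : ℝ, (y : S1) = q' := QuotientAddGroup.mk_surjective q'
  obtain ⟨x, rfl, hx⟩ := exists_lift_abs_eq_dist p y
  obtain ⟨x', rfl, hx'⟩ := exists_lift_abs_eq_dist p' y'
  have h1 := hc x y hp hq (by rwa [hx])
  have h2 := hc x' y' hp' hq' (by rwa [hx'])
  constructor
  · rw [(isFull hr ν).offset_eq hq, (isFull hr ν).offset_eq hq', (isFull hr μ).offset_eq hp,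
      (isFull hr μ).offset_eq hp', h1, h2, hidx, ← hx, ← hx']
    have : y - 2 * Real.pi / (2 * (idx μ : ℝ) + 1) * ((lab μ x + c : ℤ) : ℝ) -
        (y' - 2 * Real.pi / (2 * (idx μ : ℝ) + 1) * ((lab μ x' + c : ℤ) : ℝ)) -
        (x - 2 * Real.pi / (2 * (idx μ : ℝ) + 1) * (lab μ x : ℝ) -
          (x' - 2 * Real.pi / (2 * (idx μ : ℝ) + 1) * (lab μ x' : ℝ))) = (x' - y') - (x - y) := by
      push_cast
      ring
    rw [this, add_comm]
    exact abs_sub _ _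
  · rw [(isFull hr ν).resid_eq_iff hq hq', (isFull hr μ).resid_eq_iff hp hp', h1, h2, hidx,
      add_sub_add_right_eq_sub]

theorem continuous_mass_val : Continuous fun μ : VRm S1 r => μ.1 := continuous_subtype_val

variable {k : ℕ}

/-- The graph of the supports over a stratum. -/
abbrev stratumGraph (r : ℝ) (k : ℕ) : Set (VRm S1 r × S1) :=
  FinProb.suppGraph (stratum r k) fun μ => μ.1

/-- Points of `stratumGraph`, with a second point of the same support, near a given such pair. -/
theorem eventually_pair {μ : VRm S1 r} {p p' : S1} {δ : ℝ} (hδ : 0 < δ)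
    {P : VRm S1 r → Prop} (hP : ∀ᶠ ν in 𝓝 μ, P ν) :
    ∀ᶠ z : (VRm S1 r × S1) × S1 in
      𝓝[FinProb.suppGraph (stratumGraph r k) fun zq => zq.1.1] ((μ, p), p'),
      P z.1.1 ∧ idx z.1.1 = k ∧ z.1.2 ∈ z.1.1.1.supp ∧ z.2 ∈ z.1.1.1.supp ∧
        dist p z.1.2 < δ ∧ dist p' z.2 < δ := by
  have h1 : Tendsto (fun z : (VRm S1 r × S1) × S1 => z.1.1) (𝓝 ((μ, p), p')) (𝓝 μ) :=
    (continuous_fst.comp continuous_fst).tendsto ((μ, p), p')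
  have h2 : Tendsto (fun z : (VRm S1 r × S1) × S1 => z.1.2) (𝓝 ((μ, p), p')) (𝓝 p) :=
    (continuous_snd.comp continuous_fst).tendsto ((μ, p), p')
  have h3 : Tendsto (fun z : (VRm S1 r × S1) × S1 => z.2) (𝓝 ((μ, p), p')) (𝓝 p') :=
    continuous_snd.tendsto ((μ, p), p')
  filter_upwards [eventually_nhdsWithin_of_eventually_nhds (h1.eventually hP),
    eventually_nhdsWithin_of_eventually_nhds (h2.eventually (Metric.ball_mem_nhds p hδ)),
    eventually_nhdsWithin_of_eventually_nhds (h3.eventually (Metric.ball_mem_nhds p' hδ)),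
    self_mem_nhdsWithin] with z hz1 hz2 hz3 hz4
  rw [dist_comm] at hz2 hz3
  exact ⟨hz1, hz4.1.1, hz4.1.2, hz4.2, hz2, hz3⟩

/-- The displacement from the polygon is continuous on a stratum. -/
theorem continuousWithinAt_centred (hr : r < Real.pi) {μ : VRm S1 r} (hμ : idx μ = k) {p : S1}
    (hp : p ∈ μ.1.supp) :
    ContinuousWithinAt (fun z : VRm S1 r × S1 => centred k (lab z.1) z.1.1 z.2)
      (stratumGraph r k) (μ, p) := by
  have hint : (fun z : VRm S1 r × S1 => centred k (lab z.1) z.1.1 z.2) = fun z =>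
      z.1.1.integral fun q => offset k (lab z.1) z.2 - offset k (lab z.1) q := by
    funext z
    rw [FinProb.integral_sub, FinProb.integral_const]
    rfl
  rw [hint]
  refine FinProb.continuousWithinAt_integral (ν := fun z : VRm S1 r × S1 => z.1.1)
    (C := 2 * Real.pi) (show (μ, p) ∈ stratumGraph r k from ⟨hμ, hp⟩)
    (continuous_mass_val.comp continuous_fst).continuousWithinAt ?_ ?_
  · rintro ⟨ν, q⟩ ⟨hν, hq⟩ q' hq'
    have hν' : idx ν = k := hν
    subst hν'
    exact (isFull hr ν).abs_offset_sub_le hq hq'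
  · intro p' hp'
    have hδ : 0 < (Real.pi - r) / 4 := by linarith
    rw [ContinuousWithinAt, Metric.tendsto_nhds]
    intro ε hε
    filter_upwards [eventually_pair (k := k) (p := p) (p' := p')
      (lt_min hδ (half_pos hε)) (eventually_offset hr μ)] with z hz
    obtain ⟨h1, h2, h3, h4, h5, h6⟩ := hz
    have h7 := (h1 (h2.trans hμ.symm) p hp p' hp' _ h3 _ h4 (h5.trans_le (min_le_left _ _))
      (h6.trans_le (min_le_left _ _))).1
    rw [h2, hμ] at h7
    rw [Real.dist_eq]
    refine h7.trans_lt ?_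
    have := h5.trans_le (min_le_right _ _)
    have := h6.trans_le (min_le_right _ _)
    linarith

/-- The masses of the arcs are continuous on a stratum. -/
theorem continuousWithinAt_arcMass (hr : r < Real.pi) {μ : VRm S1 r} (hμ : idx μ = k) {p : S1}
    (hp : p ∈ μ.1.supp) :
    ContinuousWithinAt (fun z : VRm S1 r × S1 => arcMass k (lab z.1) z.1.1 z.2)
      (stratumGraph r k) (μ, p) := by
  refine FinProb.continuousWithinAt_integral (ν := fun z : VRm S1 r × S1 => z.1.1)
    (h := fun z q => if resid k (lab z.1) q = resid k (lab z.1) z.2 then 1 else 0)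
    (C := 1) (show (μ, p) ∈ stratumGraph r k from ⟨hμ, hp⟩)
    (continuous_mass_val.comp continuous_fst).continuousWithinAt ?_ ?_
  · intro z _ q' _
    split_ifs <;> norm_num
  · intro p' hp'
    have hδ : 0 < (Real.pi - r) / 4 := by linarith
    refine tendsto_const_nhds.congr' ?_
    filter_upwards [eventually_pair (k := k) (p := p) (p' := p') hδ (eventually_offset hr μ)]
      with z hz
    obtain ⟨h1, h2, h3, h4, h5, h6⟩ := hz
    have h7 := (h1 (h2.trans hμ.symm) p' hp' p hp _ h4 _ h3 h6 h5).2
    rw [h2, hμ] at h7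
    simp only [h7]

theorem eventually_minMass (hr : r < Real.pi) (μ : VRm S1 r) {ε : ℝ} (hε : 0 < ε) :
    ∀ᶠ ν in 𝓝 μ, idx ν = idx μ → |minMass ν - minMass μ| < ε := by
  obtain ⟨δ, hδ, hnear⟩ := FinProb.eventually_forall_near (z₀ := μ) (S := stratum r (idx μ))
    (ν := fun μ : VRm S1 r => μ.1)
    (P := fun p ν q => |arcMass (idx μ) (lab ν) ν.1 q - arcMass (idx μ) (lab μ) μ.1 p| < ε)
    fun p hp => Metric.tendsto_nhds.1 (continuousWithinAt_arcMass hr rfl hp) ε hε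
  have hδ' : 0 < min δ ((Real.pi - r) / 4) := lt_min hδ (by linarith)
  filter_upwards [hnear, eventually_labels hr μ, eventually_offset hr μ,
    continuous_mass_val.continuousAt.eventually (FinProb.eventually_exists_near hδ' μ.1)]
    with ν h1 h2 h3 h4 hidx
  rw [abs_lt]
  constructor
  · -- the smallest arc of `ν` contains a point close to the support of `μ`
    obtain ⟨q, hq, hqm⟩ := exists_arcMass_eq_minMass ν
    obtain ⟨y₀, rfl⟩ : ∃ y : ℝ, (y : S1) = q := QuotientAddGroup.mk_surjective q
    obtain ⟨y, hy, ⟨p, hp, hpy⟩, hl⟩ := (h2 hidx).1 (lab ν y₀)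
    obtain ⟨q', hq', hd⟩ := h4 p hp
    have e1 : resid (idx ν) (lab ν) (y₀ : S1) = resid (idx ν) (lab ν) (y : S1) :=
      ((isFull hr ν).resid_eq_iff hq hy).2 (by rw [hl, sub_self]; exact dvd_zero _)
    have e2 : resid (idx ν) (lab ν) (y : S1) = resid (idx ν) (lab ν) q' :=
      (h3 hidx p hp p hp y hy q' hq' hpy (hd.trans_le (min_le_right _ _))).2.2 rfl
    have e3 : arcMass (idx ν) (lab ν) ν.1 q' = minMass ν := by
      rw [← hqm, arcMass, arcMass, e1, e2]
    have h5 := h1 p hp q' (by rw [dist_comm]; exact hd.trans_le (min_le_left _ _)) hidx hq'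
    rw [← hidx, e3, hidx, abs_lt] at h5
    have := minMass_le hp
    linarith [h5.1]
  · obtain ⟨p, hp, hpm⟩ := exists_arcMass_eq_minMass μ
    obtain ⟨q, hq, hd⟩ := h4 p hp
    have h5 := h1 p hp q (by rw [dist_comm]; exact hd.trans_le (min_le_left _ _)) hidx hq
    have h6 := minMass_le hq
    rw [hidx] at h6
    rw [hpm, abs_lt] at h5
    linarith [h5.2]

/-- The minimal mass of an arc is continuous on a stratum. -/
theorem continuousWithinAt_minMass (hr : r < Real.pi) {μ : VRm S1 r} (hμ : idx μ = k) :
    ContinuousWithinAt minMass (stratum r k) μ := by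
  rw [ContinuousWithinAt, Metric.tendsto_nhds]
  intro ε hε
  filter_upwards [eventually_nhdsWithin_of_eventually_nhds (eventually_minMass hr μ hε),
    self_mem_nhdsWithin] with ν hν hk
  exact hν (Eq.trans hk hμ.symm)

/-- The minimal mass of an arc tends to zero when the number of arcs drops in the limit, since some
arc then stays away from the support of the limit. -/
theorem eventually_minMass_lt (hr : r < Real.pi) (μ : VRm S1 r) {ε : ℝ} (hε : 0 < ε) :
    ∀ᶠ ν in 𝓝 μ, idx μ < idx ν → minMass ν < ε := by
  have hδ : 0 < (Real.pi - r) / 4 := by linarith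
  filter_upwards [eventually_supp_near hr μ, Metric.ball_mem_nhds μ (mul_pos hδ hε)]
    with ν hν hd hlt
  rcases (isFull hr μ).near_cases (fun p hp q hq => μ.dist_le p hp q hq) (isFull hr ν) hν with h | h
  · obtain ⟨-, i, hi⟩ := h
    obtain ⟨y, hy, hyi⟩ := (isFull hr ν).surj i
    refine (minMass_le hy).trans_lt ?_
    rw [Metric.mem_ball, dist_comm] at hd
    refine FinProb.integral_far_lt hδ hd (fun q _ => by split_ifs <;> norm_num) ?_
    rintro q hq ⟨p, hp, hpq⟩
    split_ifs with hres
    · exfalso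
      obtain ⟨z, rfl⟩ : ∃ z : ℝ, (z : S1) = q := QuotientAddGroup.mk_surjective q
      obtain ⟨j, hj⟩ := ((isFull hr ν).resid_eq_iff hq hy).1 hres
      refine hi (z + j * (2 * Real.pi)) (by rwa [coe_add_int_mul])
        ⟨p, hp, by rwa [coe_add_int_mul]⟩ ?_
      rw [(isFull hr ν).add_int_mul hq, ← hyi]
      push_cast at hj
      linarith
    · exact le_rfl
  · exact absurd hlt (by rw [h.1]; exact lt_irrefl _)

/-! ### Continuity of the flow -/

/-- A family of measures in the stratum of order `k`, together with parameters of the flow, that is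
continuous at a point. -/
structure FlowFamily {Z : Type*} [TopologicalSpace Z] (k : ℕ) (S : Set Z) (z₀ : Z)
    (m : Z → VRm S1 r) (s c : Z → ℝ) : Prop where
  mem : z₀ ∈ S
  cont : ContinuousWithinAt m S z₀
  idx_eq : ∀ z ∈ S, idx (m z) = k
  cont_s : ContinuousWithinAt s S z₀
  cont_c : ContinuousWithinAt c S z₀
  s_nonneg : ∀ z ∈ S, 0 ≤ s z
  s_le_one : ∀ z ∈ S, s z ≤ 1
  c_nonneg : ∀ z ∈ S, 0 ≤ c z
  c_le_minMass : ∀ z ∈ S, c z ≤ minMass (m z)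
  c_le_half : ∀ z ∈ S, (2 * k + 1) * c z ≤ 1 / 2

namespace FlowFamily

variable {Z : Type*} [TopologicalSpace Z] {S : Set Z} {z₀ : Z} {m : Z → VRm S1 r} {s c : Z → ℝ}

/-- The graph of the supports of the family. -/
abbrev graph (S : Set Z) (m : Z → VRm S1 r) : Set (Z × S1) :=
  FinProb.suppGraph S fun z => (m z).1

theorem cont_val (h : FlowFamily k S z₀ m s c) : ContinuousWithinAt (fun z => (m z).1) S z₀ :=
  continuous_mass_val.continuousAt.comp_continuousWithinAt h.cont

theorem tendsto_fst (m : Z → VRm S1 r) (p : S1) :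
    Tendsto (Prod.fst : Z × S1 → Z) (𝓝[graph S m] (z₀, p)) (𝓝[S] z₀) :=
  tendsto_nhdsWithin_iff.2 ⟨continuous_fst.continuousAt.continuousWithinAt,
    eventually_nhdsWithin_of_forall fun _ hz => hz.1⟩

theorem tendsto_pull (h : FlowFamily k S z₀ m s c) (p : S1) :
    Tendsto (fun z : Z × S1 => (m z.1, z.2)) (𝓝[graph S m] (z₀, p))
      (𝓝[stratumGraph r k] (m z₀, p)) :=
  tendsto_nhdsWithin_iff.2 ⟨(h.cont.tendsto.comp (tendsto_fst m p)).prodMk_nhds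
    continuous_snd.continuousAt.continuousWithinAt,
    eventually_nhdsWithin_of_forall fun _ hz => ⟨h.idx_eq _ hz.1, hz.2⟩⟩

theorem isFull (h : FlowFamily k S z₀ m s c) (hr : r < Real.pi) {z : Z} (hz : z ∈ S) :
    IsFullLabelling ((m z).1.supp : Set S1) k (lab (m z)) := by
  have := VRCircle.isFull hr (m z)
  rwa [h.idx_eq z hz] at this

theorem c_le_arcMass (h : FlowFamily k S z₀ m s c) {z : Z} (hz : z ∈ S) :
    ∀ p ∈ (m z).1.supp, c z ≤ arcMass k (lab (m z)) (m z).1 p := by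
  intro p hp
  have := minMass_le hp
  rw [h.idx_eq z hz] at this
  exact (h.c_le_minMass z hz).trans this

theorem c_lt_one (h : FlowFamily k S z₀ m s c) {z : Z} (hz : z ∈ S) :
    (2 * k + 1) * c z < 1 := by
  linarith [h.c_le_half z hz]

theorem arcWeight_nonneg (h : FlowFamily k S z₀ m s c) {z : Z} (hz : z ∈ S) :
    ∀ p ∈ (m z).1.supp, 0 ≤ arcWeight k (lab (m z)) (c z) (m z).1 p := fun _ hp =>
  VRCircle.arcWeight_nonneg (h.c_le_arcMass hz) (h.c_lt_one hz) hp

theorem arcWeight_le_two (h : FlowFamily k S z₀ m s c) {z : Z} (hz : z ∈ S) :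
    ∀ p ∈ (m z).1.supp, arcWeight k (lab (m z)) (c z) (m z).1 p ≤ 2 := by
  intro p hp
  have h1 := h.c_le_half z hz
  have h2 : 0 ≤ c z / arcMass k (lab (m z)) (m z).1 p :=
    div_nonneg (h.c_nonneg z hz) (arcMass_pos hp).le
  rw [arcWeight, div_le_iff₀ (by linarith)]
  linarith

theorem cont_centred (h : FlowFamily k S z₀ m s c) (hr : r < Real.pi) {p : S1}
    (hp : p ∈ (m z₀).1.supp) :
    ContinuousWithinAt (fun z : Z × S1 => centred k (lab (m z.1)) (m z.1).1 z.2)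
      (graph S m) (z₀, p) :=
  Tendsto.comp (g := fun z : VRm S1 r × S1 => centred k (lab z.1) z.1.1 z.2)
    (f := fun z : Z × S1 => (m z.1, z.2))
    (continuousWithinAt_centred hr (h.idx_eq z₀ h.mem) hp) (h.tendsto_pull p)

theorem cont_arcWeight (h : FlowFamily k S z₀ m s c) (hr : r < Real.pi) {p : S1}
    (hp : p ∈ (m z₀).1.supp) :
    ContinuousWithinAt (fun z : Z × S1 => arcWeight k (lab (m z.1)) (c z.1) (m z.1).1 z.2)
      (graph S m) (z₀, p) := by
  have hmass : ContinuousWithinAt (fun z : Z × S1 => arcMass k (lab (m z.1)) (m z.1).1 z.2)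
      (graph S m) (z₀, p) :=
    Tendsto.comp (g := fun z : VRm S1 r × S1 => arcMass k (lab z.1) z.1.1 z.2)
      (f := fun z : Z × S1 => (m z.1, z.2))
      (continuousWithinAt_arcMass hr (h.idx_eq z₀ h.mem) hp) (h.tendsto_pull p)
  have hc : ContinuousWithinAt (fun z : Z × S1 => c z.1) (graph S m) (z₀, p) :=
    h.cont_c.tendsto.comp (tendsto_fst m p)
  have h1 : ContinuousWithinAt (fun z : Z × S1 => 1 - (2 * (k : ℝ) + 1) * c z.1)
      (graph S m) (z₀, p) := continuousWithinAt_const.sub (continuousWithinAt_const.mul hc)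
  have h2 : ContinuousWithinAt (fun z : Z × S1 => 1 - c z.1 / arcMass k (lab (m z.1)) (m z.1).1 z.2)
      (graph S m) (z₀, p) := continuousWithinAt_const.sub (hc.div hmass (arcMass_pos hp).ne')
  refine h2.div h1 ?_
  have := h.c_lt_one h.mem
  show 1 - (2 * (k : ℝ) + 1) * c z₀ ≠ 0
  linarith

theorem cont_mean (h : FlowFamily k S z₀ m s c) (hr : r < Real.pi) :
    ContinuousWithinAt (fun z => (thinned k (lab (m z)) (c z) (m z).1).integral
      (centred k (lab (m z)) (m z).1)) S z₀ := by
  have h1 : ContinuousWithinAt (fun z => (m z).1.integral fun p =>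
      arcWeight k (lab (m z)) (c z) (m z).1 p * centred k (lab (m z)) (m z).1 p) S z₀ := by
    refine FinProb.continuousWithinAt_integral h.mem h.cont_val (C := 2 * (2 * Real.pi)) ?_ ?_
    · intro z hz p hp
      rw [abs_mul, abs_of_nonneg (h.arcWeight_nonneg hz p hp)]
      exact mul_le_mul (h.arcWeight_le_two hz p hp) ((h.isFull hr hz).abs_centred_le hp)
        (abs_nonneg _) two_pos.le
    · intro p hp
      exact (h.cont_arcWeight hr hp).mul (h.cont_centred hr hp)
  exact h1.congr
    (fun z hz => (h.isFull hr hz).integral_thinned (h.c_le_arcMass hz) (h.c_lt_one hz) _)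
    ((h.isFull hr h.mem).integral_thinned (h.c_le_arcMass h.mem) (h.c_lt_one h.mem) _)

theorem cont_displ (h : FlowFamily k S z₀ m s c) (hr : r < Real.pi) {p : S1}
    (hp : p ∈ (m z₀).1.supp) :
    ContinuousWithinAt (fun z : Z × S1 => displ k (lab (m z.1)) (s z.1) (c z.1) (m z.1).1 z.2)
      (graph S m) (z₀, p) := by
  have hs : ContinuousWithinAt (fun z : Z × S1 => s z.1) (graph S m) (z₀, p) :=
    h.cont_s.tendsto.comp (tendsto_fst m p)
  have hmean : ContinuousWithinAt (fun z : Z × S1 =>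
      (thinned k (lab (m z.1)) (c z.1) (m z.1).1).integral (centred k (lab (m z.1)) (m z.1).1))
      (graph S m) (z₀, p) := (h.cont_mean hr).tendsto.comp (tendsto_fst m p)
  exact (hs.neg.mul (h.cont_centred hr hp)).sub ((continuousWithinAt_const.sub hs).mul hmean)

/-- The flow is continuous on a stratum, jointly with its parameters. -/
theorem cont_flowVR (h : FlowFamily k S z₀ m s c) (hr₀ : 0 ≤ r) (hr : r < Real.pi) :
    ContinuousWithinAt (fun z => flowVR (s z) (c z) (m z)) S z₀ := by
  have hpush : ContinuousWithinAt (fun z => (flowVR (s z) (c z) (m z)).1) S z₀ := by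
    refine FinProb.continuousWithinAt_of_push h.mem dist_le_pi h.cont_val
      (w := fun z p => arcWeight k (lab (m z)) (c z) (m z).1 p)
      (f := fun z p => p + (displ k (lab (m z)) (s z) (c z) (m z).1 p : S1)) (C := 2) ?_
      (fun z hz => h.arcWeight_nonneg hz) (fun z hz => h.arcWeight_le_two hz)
      (fun p hp => h.cont_arcWeight hr hp) ?_
    · intro z hz F
      rw [val_flowVR hr₀ hr _ (h.s_nonneg z hz) (h.s_le_one z hz), h.idx_eq z hz]
      exact (h.isFull hr hz).integral_flow _ (h.c_le_arcMass hz) (h.c_lt_one hz) F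
    · intro p hp
      have h1 : ContinuousWithinAt (fun z : Z × S1 =>
          ((displ k (lab (m z.1)) (s z.1) (c z.1) (m z.1).1 z.2 : ℝ) : S1)) (graph S m) (z₀, p) :=
        (AddCircle.continuous_mk' (2 * Real.pi)).continuousAt.comp_continuousWithinAt
          (h.cont_displ hr hp)
      exact continuous_snd.continuousWithinAt.add h1
  exact tendsto_subtype_rng.2 hpush

end FlowFamily

/-! ### The collapse of one stratum -/

/-- The collapse of the stratum of order `k`. The measures whose arcs have mass at least
`1/(4(2k+1))` are moved to polygons, and the motion fades out towards the lower strata. The mass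
`min (minMass μ) (1/(2(2k+1)))` is removed from each arc, so that measures with an arc of mass at
most `1/(2(2k+1))` end in lower strata. -/
def collapseStratum (k : ℕ) (μ : VRm S1 r) (t : unitInterval) : VRm S1 r :=
  if idx μ = k then
    flowVR (t * min 1 (4 * (2 * k + 1) * minMass μ)) (t * min (minMass μ) (1 / (2 * (2 * k + 1)))) μ
  else μ

/-- The parameters of `collapseStratum` are admissible for the flow. -/
theorem collapseStratum_params (k : ℕ) {m : ℝ} (hm : 0 < m) (t : unitInterval) :
    0 ≤ (t : ℝ) * min 1 (4 * (2 * k + 1) * m) ∧ (t : ℝ) * min 1 (4 * (2 * k + 1) * m) ≤ 1 ∧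
      0 ≤ (t : ℝ) * min m (1 / (2 * (2 * k + 1))) ∧ (t : ℝ) * min m (1 / (2 * (2 * k + 1))) ≤ m ∧
      (2 * k + 1) * ((t : ℝ) * min m (1 / (2 * (2 * k + 1)))) ≤ 1 / 2 := by
  have hk : (0 : ℝ) < 2 * k + 1 := by positivity
  have ht0 := t.2.1
  have ht1 := t.2.2
  have h1 : 0 ≤ min 1 (4 * (2 * k + 1) * m) := le_min zero_le_one (by positivity)
  have h2 : 0 ≤ min m (1 / (2 * (2 * (k : ℝ) + 1))) := le_min hm.le (by positivity)
  have h3 : (t : ℝ) * min m (1 / (2 * (2 * k + 1))) ≤ min m (1 / (2 * (2 * k + 1))) :=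
    mul_le_of_le_one_left h2 ht1
  refine ⟨mul_nonneg ht0 h1, (mul_le_of_le_one_left h1 ht1).trans (min_le_left _ _),
    mul_nonneg ht0 h2, h3.trans (min_le_left _ _), ?_⟩
  have h4 := mul_le_mul_of_nonneg_left (h3.trans (min_le_right _ _)) hk.le
  refine h4.trans_eq ?_
  field_simp

theorem collapseStratum_zero (hr₀ : 0 ≤ r) (hr : r < Real.pi) (k : ℕ) (μ : VRm S1 r) :
    collapseStratum k μ 0 = μ := by
  rw [collapseStratum]
  split_ifs
  · simp only [Set.Icc.coe_zero, zero_mul]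
    exact flowVR_zero hr₀ hr μ
  · rfl

theorem idx_collapseStratum_le (hr₀ : 0 ≤ r) (hr : r < Real.pi) (k : ℕ) (μ : VRm S1 r)
    (t : unitInterval) :
    idx (collapseStratum k μ t) ≤ idx μ := by
  have h := collapseStratum_params k (minMass_pos μ) t
  rw [collapseStratum]
  split_ifs
  · exact idx_flowVR_le_idx hr₀ hr _ h.1 h.2.1 μ
  · exact le_rfl

theorem rel_collapseStratum (hr₀ : 0 ≤ r) (hr : r < Real.pi) (k : ℕ) {μ ν : VRm S1 r}
    (hμν : Rel r μ ν) (t : unitInterval) :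
    Rel r (collapseStratum k μ t) (collapseStratum k ν t) := by
  have h := collapseStratum_params k (minMass_pos μ) t
  have hi := ((rel_iff hr).1 hμν).1
  rw [collapseStratum, collapseStratum, hi, ← minMass_eq_of_rel hr hμν]
  split_ifs with hk
  · exact rel_flowVR_of_rel hr₀ hr hμν h.1 h.2.1 h.2.2.2.1 (by rw [hk]; linarith [h.2.2.2.2])
  · exact hμν

theorem idx_collapseStratum_one_lt (hr₀ : 0 ≤ r) (hr : r < Real.pi) {μ : VRm S1 r} (hk : idx μ = k)
    (hm : minMass μ ≤ 1 / (2 * (2 * k + 1))) : idx (collapseStratum k μ 1) < k := by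
  have h := collapseStratum_params k (minMass_pos μ) 1
  rw [collapseStratum, if_pos hk, min_eq_left hm]
  rw [min_eq_left hm] at h
  simp only [Set.Icc.coe_one, one_mul] at h ⊢
  have := idx_flowVR_lt_idx hr₀ hr h.1 h.2.1 μ (by rw [hk]; linarith [h.2.2.2.2])
  rwa [hk] at this

theorem collapseStratum_one_eq (hr₀ : 0 ≤ r) (hr : r < Real.pi) {μ ν : VRm S1 r} (hμν : Rel r μ ν)
    (hk : idx μ = k) (hm : 1 ≤ 4 * (2 * k + 1) * minMass μ) :
    collapseStratum k μ 1 = collapseStratum k ν 1 := by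
  have h := collapseStratum_params k (minMass_pos μ) 1
  have hi := ((rel_iff hr).1 hμν).1
  rw [collapseStratum, collapseStratum, if_pos hk, if_pos (hi.trans hk), ← minMass_eq_of_rel hr hμν,
    min_eq_left hm]
  rw [min_eq_left hm] at h
  simp only [Set.Icc.coe_one, one_mul] at h ⊢
  exact flowVR_one_eq hr₀ hr hμν h.2.2.2.1 (by rw [hk]; linarith [h.2.2.2.2])

/-- The smallest mass of an arc, extended by zero to the lower strata. -/
def height (k : ℕ) (μ : VRm S1 r) : ℝ := if idx μ = k then minMass μ else 0

theorem nhdsWithin_lower_succ (hr : r < Real.pi) {μ : VRm S1 r} (hμ : idx μ = k) :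
    𝓝[lower r (k + 1)] μ = 𝓝[stratum r k] μ := by
  refine nhdsWithin_eq_iff_eventuallyEq.2 ?_
  filter_upwards [eventually_idx_le hr μ] with ν hν
  rw [eq_iff_iff]
  show idx ν < k + 1 ↔ idx ν = k
  omega

theorem continuousOn_height (hr : r < Real.pi) (k : ℕ) :
    ContinuousOn (height k) (lower r (k + 1)) := by
  intro μ hμ
  rcases eq_or_lt_of_le (Nat.lt_succ_iff.1 hμ) with h | h
  · rw [ContinuousWithinAt, nhdsWithin_lower_succ hr h]
    exact (continuousWithinAt_minMass hr h).congr (fun ν hν => if_pos hν) (if_pos h)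
  · rw [ContinuousWithinAt, Metric.tendsto_nhds]
    intro ε hε
    filter_upwards [eventually_nhdsWithin_of_eventually_nhds (eventually_minMass_lt hr μ hε)]
      with ν hν
    have h0 : height k μ = 0 := if_neg h.ne
    rw [h0, dist_zero_right, Real.norm_eq_abs, height]
    split_ifs with hk
    · rw [abs_of_pos (minMass_pos ν)]
      exact hν (h.trans_eq hk.symm)
    · rwa [abs_zero]

theorem dist_collapseStratum_le (hr₀ : 0 ≤ r) (hr : r < Real.pi) (k : ℕ) (μ : VRm S1 r)
    (t : unitInterval) :
    dist μ (collapseStratum k μ t) ≤ 20 * Real.pi * ((2 * k + 1) * height k μ) := by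
  have hpi := Real.pi_pos
  have h := collapseStratum_params k (minMass_pos μ) t
  rw [collapseStratum, height]
  split_ifs with hk
  · refine (dist_flowVR_le hr₀ hr μ h.1 h.2.1 h.2.2.1 h.2.2.2.1 (by
      rw [hk]; exact h.2.2.2.2)).trans ?_
    have hm := (minMass_pos μ).le
    have h1 : (t : ℝ) * min 1 (4 * (2 * k + 1) * minMass μ) ≤ 4 * (2 * k + 1) * minMass μ :=
      (mul_le_of_le_one_left (le_min zero_le_one (by positivity)) t.2.2).trans (min_le_right _ _)
    have h2 := mul_le_mul_of_nonneg_left h1 (by positivity : 0 ≤ 2 * Real.pi)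
    have h3 := mul_le_mul_of_nonneg_left h.2.2.2.1
      (by positivity : 0 ≤ 12 * Real.pi * (2 * (k : ℝ) + 1))
    rw [hk]
    nlinarith
  · simp

theorem continuousOn_collapseStratum (hr₀ : 0 ≤ r) (hr : r < Real.pi) (k : ℕ) :
    ContinuousOn (fun z : VRm S1 r × unitInterval => collapseStratum k z.1 z.2)
      (lower r (k + 1) ×ˢ Set.univ) := by
  rintro ⟨μ, t⟩ ⟨hμ, -⟩
  have ht : Continuous fun z : VRm S1 r × unitInterval => (z.2 : ℝ) :=
    continuous_subtype_val.comp continuous_snd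
  rcases eq_or_lt_of_le (Nat.lt_succ_iff.1 hμ) with h | h
  · have hmin : ContinuousWithinAt (fun z : VRm S1 r × unitInterval => minMass z.1)
        (stratum r k ×ˢ Set.univ) (μ, t) :=
      (continuousWithinAt_minMass hr h).comp continuous_fst.continuousWithinAt fun z hz => hz.1
    have key := FlowFamily.cont_flowVR (k := k) (S := stratum r k ×ˢ Set.univ)
      (z₀ := (μ, t)) (m := fun z : VRm S1 r × unitInterval => z.1)
      (s := fun z => (z.2 : ℝ) * min 1 (4 * (2 * k + 1) * minMass z.1))
      (c := fun z => (z.2 : ℝ) * min (minMass z.1) (1 / (2 * (2 * k + 1))))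
      ⟨⟨h, trivial⟩, continuous_fst.continuousWithinAt, fun z hz => hz.1,
      ht.continuousWithinAt.mul (continuousWithinAt_const.min (continuousWithinAt_const.mul hmin)),
      ht.continuousWithinAt.mul (hmin.min continuousWithinAt_const),
      fun z _ => (collapseStratum_params k (minMass_pos z.1) z.2).1,
      fun z _ => (collapseStratum_params k (minMass_pos z.1) z.2).2.1,
      fun z _ => (collapseStratum_params k (minMass_pos z.1) z.2).2.2.1,
      fun z _ => (collapseStratum_params k (minMass_pos z.1) z.2).2.2.2.1,
      fun z _ => (collapseStratum_params k (minMass_pos z.1) z.2).2.2.2.2⟩ hr₀ hr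
    have hnhds : 𝓝[lower r (k + 1) ×ˢ Set.univ] (μ, t) = 𝓝[stratum r k ×ˢ Set.univ] (μ, t) := by
      rw [nhdsWithin_prod_eq, nhdsWithin_prod_eq, nhdsWithin_lower_succ hr h]
    rw [ContinuousWithinAt, hnhds]
    exact key.congr (fun z hz => if_pos hz.1) (if_pos h)
  · have h0 : ∀ t, collapseStratum k μ t = μ := fun t => if_neg h.ne
    rw [ContinuousWithinAt, tendsto_iff_dist_tendsto_zero]
    have hh : Tendsto (fun z : VRm S1 r × unitInterval =>
        20 * Real.pi * ((2 * k + 1) * height k z.1) + dist z.1 μ)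
        (𝓝[lower r (k + 1) ×ˢ Set.univ] (μ, t)) (𝓝 0) := by
      have h1 : ContinuousWithinAt (fun z : VRm S1 r × unitInterval => height k z.1)
          (lower r (k + 1) ×ˢ Set.univ) (μ, t) :=
        ContinuousWithinAt.comp (f := Prod.fst) (x := (μ, t)) (continuousOn_height hr k μ hμ)
          continuous_fst.continuousWithinAt fun z hz => hz.1
      have h2 : ContinuousWithinAt (fun z : VRm S1 r × unitInterval => dist z.1 μ)
          (lower r (k + 1) ×ˢ Set.univ) (μ, t) :=
        (continuous_fst.dist continuous_const).continuousWithinAt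
      have h3 := (((h1.const_mul (2 * (k : ℝ) + 1)).const_mul (20 * Real.pi)).add h2).tendsto
      have h4 : height k μ = 0 := if_neg h.ne
      rwa [Pi.add_apply, h4, mul_zero, mul_zero, dist_self, add_zero] at h3
    refine squeeze_zero (fun _ => dist_nonneg) (fun z => ?_) hh
    show dist (collapseStratum k z.1 z.2) (collapseStratum k μ t) ≤ _
    rw [h0, dist_comm (collapseStratum k z.1 z.2)]
    refine (dist_triangle μ z.1 _).trans ?_
    rw [dist_comm μ, add_comm]
    exact add_le_add_left (dist_collapseStratum_le hr₀ hr k z.1 z.2) _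

/-! ### The collapse of all strata -/

/-- A homotopy on a set `W` of measures, starting at the identity, compatible with the equivalence
relation, whose final map is constant on the equivalence classes. -/
structure IsCollapse (W : Set (VRm S1 r)) (H : VRm S1 r × unitInterval → VRm S1 r) : Prop where
  cont : ContinuousOn H (W ×ˢ Set.univ)
  zero : ∀ μ, H (μ, 0) = μ
  mem : ∀ μ ∈ W, ∀ t, H (μ, t) ∈ W
  rel : ∀ μ ∈ W, ∀ ν ∈ W, Rel r μ ν → ∀ t, Rel r (H (μ, t)) (H (ν, t))
  one : ∀ μ ∈ W, ∀ ν ∈ W, Rel r μ ν → H (μ, 1) = H (ν, 1)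

/-- The time at which the collapse of the lower strata is run after the collapse of the stratum of
order `k`: it is reached in full where the arcs have mass at most `1/(4(2k+1))`, and is zero where
they have mass at least `1/(2(2k+1))`. -/
def lateTime (k : ℕ) (z : VRm S1 r × unitInterval) : unitInterval :=
  Set.projIcc 0 1 zero_le_one
    ((2 * (z.2 : ℝ) - 1) * max 0 (min 1 (2 - 4 * (2 * k + 1) * height k z.1)))

/-- The time of the collapse of the stratum of order `k`, run in the first half. -/
def earlyTime (t : unitInterval) : unitInterval := Set.projIcc 0 1 zero_le_one (2 * (t : ℝ))

/-- A function which is nonpositive in the first half of the time or where all arcs have mass at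
least `1/(2(2k+1))`, and nonnegative in the second half where some arc has at most this mass. -/
def phase (k : ℕ) (z : VRm S1 r × unitInterval) : ℝ :=
  min ((z.2 : ℝ) - 1 / 2) (1 / (2 * (2 * k + 1)) - height k z.1)

open Classical in
/-- The collapse of the strata of order at most `k`, given the collapse `H` of the lower ones. -/
def extendCollapse (k : ℕ) (H : VRm S1 r × unitInterval → VRm S1 r)
    (z : VRm S1 r × unitInterval) : VRm S1 r :=
  if phase k z ≤ 0 then collapseStratum k z.1 (earlyTime z.2)
  else H (collapseStratum k z.1 1, lateTime k z)

theorem collapseStratum_one_mem_lower (hr₀ : 0 ≤ r) (hr : r < Real.pi) {μ : VRm S1 r}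
    (hμ : μ ∈ lower r (k + 1)) (hm : height k μ ≤ 1 / (2 * (2 * k + 1))) :
    collapseStratum k μ 1 ∈ lower r k := by
  rcases eq_or_lt_of_le (Nat.lt_succ_iff.1 hμ) with h | h
  · rw [height, if_pos h] at hm
    exact idx_collapseStratum_one_lt hr₀ hr h hm
  · rw [collapseStratum, if_neg h.ne]
    exact h

theorem height_eq_of_rel (hr : r < Real.pi) {μ ν : VRm S1 r} (h : Rel r μ ν) :
    height k μ = height k ν := by
  rw [height, height, minMass_eq_of_rel hr h, ((rel_iff hr).1 h).1]

theorem collapseStratum_one_eq_of_height (hr₀ : 0 ≤ r) (hr : r < Real.pi) {μ ν : VRm S1 r}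
    (h : Rel r μ ν) (hm : 1 ≤ 4 * (2 * k + 1) * height k μ) :
    collapseStratum k μ 1 = collapseStratum k ν 1 := by
  rw [height] at hm
  split_ifs at hm with hk
  · exact collapseStratum_one_eq hr₀ hr h hk hm
  · norm_num at hm

theorem continuousOn_extendCollapse (hr₀ : 0 ≤ r) (hr : r < Real.pi)
    {H : VRm S1 r × unitInterval → VRm S1 r} (hH : IsCollapse (lower r k) H) :
    ContinuousOn (extendCollapse k H) (lower r (k + 1) ×ˢ Set.univ) := by
  classical
  set D : Set (VRm S1 r × unitInterval) := lower r (k + 1) ×ˢ Set.univ with hD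
  have ht : Continuous fun z : D => (z.1.2 : ℝ) :=
    continuous_subtype_val.comp (continuous_snd.comp continuous_subtype_val)
  have hh : Continuous fun z : D => height k z.1.1 :=
    (continuousOn_height hr k).comp_continuous (continuous_fst.comp continuous_subtype_val)
      fun z => z.2.1
  have hphase : Continuous fun z : D => phase k z.1 :=
    (ht.sub continuous_const).min (continuous_const.sub hh)
  have hearly : Continuous fun z : D => earlyTime z.1.2 :=
    continuous_projIcc.comp (continuous_const.mul ht)
  have hlate : Continuous fun z : D => lateTime k z.1 :=
    continuous_projIcc.comp (((continuous_const.mul ht).sub continuous_const).mul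
      (continuous_const.max (continuous_const.min
        (continuous_const.sub (continuous_const.mul hh)))))
  have hone : Continuous fun z : D => collapseStratum k z.1.1 1 :=
    (continuousOn_collapseStratum hr₀ hr k).comp_continuous
      (f := fun z : D => (z.1.1, (1 : unitInterval)))
      ((continuous_fst.comp continuous_subtype_val).prodMk continuous_const)
      fun z => ⟨z.2.1, trivial⟩
  rw [continuousOn_iff_continuous_domRestrict]
  refine continuous_if_le hphase continuous_const ?_ ?_ ?_
  · refine Continuous.continuousOn ?_
    exact (continuousOn_collapseStratum hr₀ hr k).comp_continuous
      (f := fun z : D => (z.1.1, earlyTime z.1.2))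
      ((continuous_fst.comp continuous_subtype_val).prodMk hearly) fun z => ⟨z.2.1, trivial⟩
  · refine hH.cont.comp (hone.prodMk hlate).continuousOn fun z hz => ⟨?_, trivial⟩
    have h1 : 0 ≤ phase k z.1 := hz
    exact collapseStratum_one_mem_lower hr₀ hr z.2.1 (by linarith [h1.trans (min_le_right _ _)])
  · rintro ⟨⟨μ, t⟩, hz⟩ h0
    have h0' : min ((t : ℝ) - 1 / 2) (1 / (2 * (2 * k + 1)) - height k μ) = 0 := h0
    have hk : (0 : ℝ) < 2 * k + 1 := by positivity
    have ht2 : (1 : ℝ) / 2 ≤ t := by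
      have := min_le_left ((t : ℝ) - 1 / 2) (1 / (2 * (2 * k + 1)) - height k μ)
      linarith
    -- on the common boundary the early time is `1` and the late time is `0`
    have he : earlyTime t = 1 := Set.projIcc_of_right_le _ (by linarith)
    have hl : lateTime k (μ, t) = 0 := by
      refine Set.projIcc_of_le_left _ (le_of_eq ?_)
      rcases min_choice ((t : ℝ) - 1 / 2) (1 / (2 * (2 * k + 1)) - height k μ) with h | h
      · rw [h] at h0'
        have : 2 * (t : ℝ) - 1 = 0 := by linarith
        show (2 * (t : ℝ) - 1) * _ = 0
        rw [this, zero_mul]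
      · rw [h] at h0'
        have h1 : 4 * (2 * (k : ℝ) + 1) * height k μ = 2 := by
          have : height k μ = 1 / (2 * (2 * k + 1)) := by linarith
          rw [this]
          field_simp
          norm_num
        show (2 * (t : ℝ) - 1) * max 0 (min 1 (2 - 4 * (2 * k + 1) * height k μ)) = 0
        rw [h1, sub_self, min_eq_right zero_le_one, max_self, mul_zero]
    show collapseStratum k μ (earlyTime t) = H (collapseStratum k μ 1, lateTime k (μ, t))
    rw [he, hl, hH.zero]

theorem isCollapse_extend (hr₀ : 0 ≤ r) (hr : r < Real.pi)
    {H : VRm S1 r × unitInterval → VRm S1 r} (hH : IsCollapse (lower r k) H) :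
    IsCollapse (lower r (k + 1)) (extendCollapse k H) := by
  have hk : (0 : ℝ) < 2 * k + 1 := by positivity
  have hlow : ∀ {μ : VRm S1 r} {t : unitInterval}, μ ∈ lower r (k + 1) → ¬ phase k (μ, t) ≤ 0 →
      collapseStratum k μ 1 ∈ lower r k := by
    intro μ t hμ h
    have h1 := (not_le.1 h).le.trans (min_le_right _ _)
    exact collapseStratum_one_mem_lower hr₀ hr hμ (by linarith)
  have hphase : ∀ {μ ν : VRm S1 r} (t : unitInterval), Rel r μ ν →
      phase k (μ, t) = phase k (ν, t) := fun t h => by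
    simp only [phase, height_eq_of_rel hr h]
  have hlate : ∀ {μ ν : VRm S1 r} (t : unitInterval), Rel r μ ν →
      lateTime k (μ, t) = lateTime k (ν, t) := fun t h => by
    simp only [lateTime, height_eq_of_rel hr h]
  refine ⟨continuousOn_extendCollapse hr₀ hr hH, fun μ => ?_, fun μ hμ t => ?_,
    fun μ hμ ν hν h t => ?_, fun μ hμ ν hν h => ?_⟩
  · have h1 : phase k (μ, 0) ≤ 0 := (min_le_left _ _).trans (by simp)
    have h2 : earlyTime 0 = 0 := Set.projIcc_of_le_left _ (by simp)
    rw [extendCollapse, if_pos h1]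
    show collapseStratum k μ (earlyTime 0) = μ
    rw [h2, collapseStratum_zero hr₀ hr]
  · rw [extendCollapse]
    split_ifs with hp
    · exact (idx_collapseStratum_le hr₀ hr k μ _).trans_lt hμ
    · exact Nat.lt_succ_of_lt (hH.mem _ (hlow hμ hp) _)
  · rw [extendCollapse, extendCollapse, ← hphase t h, ← hlate t h]
    split_ifs with hp
    · exact rel_collapseStratum hr₀ hr k h _
    · exact hH.rel _ (hlow hμ hp) _ (hlow hν (hphase t h ▸ hp)) (rel_collapseStratum hr₀ hr k h 1) _
  · rw [extendCollapse, extendCollapse, ← hphase 1 h, ← hlate 1 h]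
    have h1 : earlyTime 1 = 1 := Set.projIcc_of_right_le _ (by norm_num)
    split_ifs with hp
    · show collapseStratum k μ (earlyTime 1) = collapseStratum k ν (earlyTime 1)
      rw [h1]
      refine collapseStratum_one_eq_of_height hr₀ hr h ?_
      have h2 : 1 / (2 * (2 * (k : ℝ) + 1)) ≤ height k μ := by
        by_contra hlt
        refine hp.not_gt (lt_min ?_ ?_)
        · norm_num
        · exact sub_pos.2 (not_le.1 hlt)
      rw [div_le_iff₀ (by positivity)] at h2
      linarith
    · rcases le_or_gt 1 (4 * (2 * (k : ℝ) + 1) * height k μ) with h3 | h3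
      · rw [collapseStratum_one_eq_of_height hr₀ hr h h3]
      · have h4 : lateTime k (μ, 1) = 1 := by
          refine Set.projIcc_of_right_le _ ?_
          show (1 : ℝ) ≤ (2 * ((1 : unitInterval) : ℝ) - 1) *
            max 0 (min 1 (2 - 4 * (2 * k + 1) * height k μ))
          rw [min_eq_left (by linarith), max_eq_right zero_le_one, Set.Icc.coe_one]
          norm_num
        rw [h4]
        exact hH.one _ (hlow hμ hp) _ (hlow hν (hphase 1 h ▸ hp)) (rel_collapseStratum hr₀ hr k h 1)

theorem exists_isCollapse (hr₀ : 0 ≤ r) (hr : r < Real.pi) (k : ℕ) :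
    ∃ H, IsCollapse (lower r k) H := by
  induction k with
  | zero =>
    have hempty : ∀ μ : VRm S1 r, μ ∉ lower r 0 := fun μ hμ => Nat.not_lt_zero _ hμ
    exact ⟨Prod.fst, continuous_fst.continuousOn, fun _ => rfl, fun μ hμ => absurd hμ (hempty μ),
      fun μ hμ => absurd hμ (hempty μ), fun μ hμ => absurd hμ (hempty μ)⟩
  | succ k ih =>
    obtain ⟨H, hH⟩ := ih
    exact ⟨_, isCollapse_extend hr₀ hr hH⟩

end VRCircle

/-- A continuous collapse of the classes of a relation, compatible with the relation, makes the
quotient map a homotopy equivalence. -/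
theorem exists_homotopyEquiv_quot {X : Type*} [TopologicalSpace X] {R : X → X → Prop}
    {H : X × unitInterval → X} (hH : Continuous H) (h0 : ∀ x, H (x, 0) = x)
    (hR : ∀ x y, R x y → ∀ t, R (H (x, t)) (H (y, t))) (h1 : ∀ x y, R x y → H (x, 1) = H (y, 1)) :
    ∃ e : ContinuousMap.HomotopyEquiv X (Quot R), ∀ x, e x = Quot.mk R x := by
  have hq : Topology.IsQuotientMap (Quot.mk R) := isQuotientMap_quot_mk
  let q : C(X, Quot R) := ⟨Quot.mk R, hq.continuous⟩
  let g : C(Quot R, X) := ⟨Quot.lift (fun x => H (x, 1)) h1,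
    continuous_quot_lift h1 (hH.comp (continuous_id.prodMk continuous_const))⟩
  let K : unitInterval × Quot R → Quot R := fun z =>
    Quot.map (fun x => H (x, z.1)) (fun x y hxy => hR x y hxy z.1) z.2
  have hK : Continuous K := by
    refine hq.continuous_lift_prod_right ?_
    show Continuous fun z : unitInterval × X => Quot.mk R (H (z.2, z.1))
    exact hq.continuous.comp (hH.comp continuous_swap)
  let hleft : ContinuousMap.Homotopy (ContinuousMap.id X) (g.comp q) :=
    { toFun := fun z => H (z.2, z.1)
      continuous_toFun := hH.comp continuous_swap
      map_zero_left := h0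
      map_one_left := fun _ => rfl }
  let hright : ContinuousMap.Homotopy (ContinuousMap.id (Quot R)) (q.comp g) :=
    { toFun := K
      continuous_toFun := hK
      map_zero_left := by
        rintro ⟨x⟩
        exact congrArg (Quot.mk R) (h0 x)
      map_one_left := by
        rintro ⟨x⟩
        rfl }
  exact ⟨⟨q, g, ⟨hleft.symm⟩, ⟨hright.symm⟩⟩, fun _ => rfl⟩

theorem mainTheorem2 (r : ℝ) (hr₀ : 0 ≤ r) (hr : r < Real.pi) :
    Equivalence (VRCircle.Rel r) ∧
      ∃ e : ContinuousMap.HomotopyEquiv (VRCircle.VRm VRCircle.S1 r) (Quot (VRCircle.Rel r)),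
        ∀ μ : VRCircle.VRm VRCircle.S1 r, e μ = Quot.mk (VRCircle.Rel r) μ := by
  refine ⟨VRCircle.rel_equivalence hr, ?_⟩
  obtain ⟨K, hK⟩ := VRCircle.exists_idx_lt hr₀ hr
  obtain ⟨H, hH⟩ := VRCircle.exists_isCollapse hr₀ hr K
  have huniv : VRCircle.lower r K ×ˢ (Set.univ : Set unitInterval) = Set.univ :=
    Set.eq_univ_of_forall fun z => ⟨hK z.1, trivial⟩
  have hcont := hH.cont
  rw [huniv, continuousOn_univ] at hcont
  exact exists_homotopyEquiv_quot hcont hH.zero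
    (fun μ ν h t => hH.rel μ (hK μ) ν (hK ν) h t) fun μ ν h => hH.one μ (hK μ) ν (hK ν) h

end
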